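/- Let $M$ be a smooth, compact, connected manifold without boundary, endowed with a smooth Riemannian metric; let $d$ be its distance, and let $|p|_x$ be the dual norm on $T_x^*M$. A function $\phi:M\to\mathbb{R}$ is *semiconcave* if there is a nondecreasing, upper semicontinuous $\omega:[0,\infty)\to[0,\infty)$ with $\lim_{r\to0^+}\omega(r)=0$ such that $$\lambda\phi(x)+(1-\lambda)\phi(y)-\phi(\gamma(\lambda))\le\lambda(1-\lambda)\,d(x,y)\,\omega(d(x,y))$$ for all $x,y\in M$, all $\lambda\in[0,1]$ and every minimizing geodesic $\gamma:[0,1]\to M$, parametrized proportionally to arc length, with $\gamma(0)=y$ and $\gamma(1)=x$. Its superdifferential at $x\in M$ is $$D^+\phi(x)=\{D\psi(x):\ r>0,\ \psi\in C^1(B_r(x)),\ \psi\ge\phi \text{ on } B_r(x),\ \psi(x)=\phi(x)\}\subset T_x^*M .$$ Let $H:T^*M\to\mathbb{R}$ satisfy - (H1) $H$ is locally Lipschitz; - (H2) $p\mapsto H(x,p)$ is differentiable for every $x$, and $(x,p)\mapsto H_p(x,p)$ is continuous as a map from $T^*M$ to $TM$; - (H3) $p\mapsto H(x,p)$ is strictly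 convex for every $x$, and $H(x,p)/|p|_x\to+\infty$ as $|p|_x\to\infty$, uniformly in $x$. **Theorem.** Let $\phi$ be a semiconcave function on $M$ (with any modulus $\omega$), and let $H$ satisfy (H1)-(H3). Then for every $y\in M$ the function $H(y,\cdot)$ attains its minimum over $D^+\phi(y)$ at exactly one point $\mathbf{p}^{\#}_{\phi,H}(y)$, and for every $x\in M$ there is a strict singular characteristic $\gamma:\mathbb{R}\to M$ for $(\phi,H)$ with $\gamma(0)=x$ that is Lipschitz. Here a *strict singular characteristic* for $(\phi,H)$ is a locally absolutely continuous curve $\gamma:\mathbb{R}\to M$ such that $\gamma$ is differentiable at $t$ with $$\dot\gamma(t)=H_p\big(\gamma(t),\mathbf{p}^{\#}_{\phi,H}(\gamma(t))\big)\qquad\text{for almost every } t\in\mathbb{R}.$$ -/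

import Mathlib

open Bundle Set Filter Topology Manifold MeasureTheory
open scoped ContDiff NNReal

section MetricNotions

variable {M : Type*} [MetricSpace M]

/-- `γ`, restricted to `[0, 1]`, is a minimizing geodesic from `x` to `y`, parametrized
proportionally to arc length: the distance between any two of its points is the length of
the arc of `γ` between them. -/
def IsMinimizingGeodesic (γ : ℝ → M) (x y : M) : Prop :=
  γ 0 = x ∧ γ 1 = y ∧
    ∀ s ∈ Icc (0 : ℝ) 1, ∀ t ∈ Icc (0 : ℝ) 1, dist (γ s) (γ t) = |s - t| * dist x y

/-- A modulus `w : [0, ∞) → [0, ∞)`: nondecreasing, upper semicontinuous, with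
`w(r) → 0` as `r → 0⁺`. -/
structure IsModulus (w : ℝ≥0 → ℝ≥0) : Prop where
  monotone : Monotone w
  upperSemicontinuous : UpperSemicontinuous w
  tendsto_zero : Tendsto w (𝓝[>] 0) (𝓝 0)

/-- `φ` is semiconcave with modulus `w`. Here `l` is the weight of `x`, so that `γ l` is the
point which divides the geodesic from `y` to `x` in the ratio `l : 1 - l`. -/
def IsSemiconcaveWith (w : ℝ≥0 → ℝ≥0) (φ : M → ℝ) : Prop :=
  ∀ (x y : M) (γ : ℝ → M), IsMinimizingGeodesic γ y x → ∀ l ∈ Icc (0 : ℝ) 1,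
    l * φ x + (1 - l) * φ y - φ (γ l) ≤ l * (1 - l) * dist x y * (w (nndist x y) : ℝ)

/-- `φ` is semiconcave, with an arbitrary modulus. -/
def IsSemiconcave (φ : M → ℝ) : Prop :=
  ∃ w : ℝ≥0 → ℝ≥0, IsModulus w ∧ IsSemiconcaveWith w φ

end MetricNotions

/-- A real function on a manifold is locally Lipschitz if it is so in the charts. -/
def IsLocallyLipschitzInCharts {F H N : Type*} [NormedAddCommGroup F] [NormedSpace ℝ F]
    [TopologicalSpace H] (I : ModelWithCorners ℝ F H) [TopologicalSpace N] [ChartedSpace H N]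
    (f : N → ℝ) : Prop :=
  ∀ q : N, LocallyLipschitzOn (extChartAt I q).target (f ∘ (extChartAt I q).symm)

noncomputable section Cotangent

variable {E : Type*} [NormedAddCommGroup E] [NormedSpace ℝ E]
  {M : Type*} [MetricSpace M] [ChartedSpace E M]

variable (E) in
/-- The cotangent space of `M` at `x`. -/
abbrev CotangentSpace (x : M) : Type _ :=
  TangentSpace 𝓘(ℝ, E) x →L[ℝ] ℝ

variable (E M) in
/-- The cotangent bundle of `M`. As a bundle of linear maps from the tangent bundle to the
trivial line bundle, it carries Mathlib's topology and manifold structure. -/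
abbrev CotangentBundle : Type _ :=
  TotalSpace (E →L[ℝ] ℝ) (CotangentSpace E : M → Type _)

instance tangentSpaceT2 (x : M) : T2Space (TangentSpace 𝓘(ℝ, E) x) :=
  inferInstanceAs (T2Space E)

instance tangentSpaceFiniteDimensional [FiniteDimensional ℝ E] (x : M) :
    FiniteDimensional ℝ (TangentSpace 𝓘(ℝ, E) x) :=
  inferInstanceAs (FiniteDimensional ℝ E)

/-- The restriction `p ↦ H(x, p)` of `H` to the fibre over `x`. -/
def fibreHamiltonian (H : CotangentBundle E M → ℝ) (x : M) : CotangentSpace E x → ℝ :=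
  fun p ↦ H ⟨x, p⟩

section Velocity

variable [FiniteDimensional ℝ E]

/-- The derivative `H_p(x, p)` of `H` along the fibre, which is an element of the dual of
the cotangent space at `x`, regarded as a tangent vector at `x`. -/
def fibreDerivative (H : CotangentBundle E M → ℝ) (z : CotangentBundle E M) :
    TangentSpace 𝓘(ℝ, E) z.proj :=
  (Module.evalEquiv ℝ (TangentSpace 𝓘(ℝ, E) z.proj)).symm
    ((fderiv ℝ (fibreHamiltonian H z.proj) z.snd).toLinearMap ∘ₗ
      (LinearMap.toContinuousLinearMap :
        (TangentSpace 𝓘(ℝ, E) z.proj →ₗ[ℝ] ℝ) ≃ₗ[ℝ] CotangentSpace E z.proj).toLinearMap)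

/-- The defining property of `H_p(x, p)`. -/
theorem apply_fibreDerivative (H : CotangentBundle E M → ℝ) (z : CotangentBundle E M)
    (q : CotangentSpace E z.proj) :
    q (fibreDerivative H z) = fderiv ℝ (fibreHamiltonian H z.proj) z.snd q :=
  Module.apply_evalEquiv_symm_apply (R := ℝ) (M := TangentSpace 𝓘(ℝ, E) z.proj) q.toLinearMap _

end Velocity

/-- The standing conditions on a Hamiltonian `H : T*M → ℝ`; the norm on the cotangent spaces is
the one that is dual to the Riemannian norm on the tangent spaces. -/
structure IsHamiltonian [FiniteDimensional ℝ E] [IsManifold 𝓘(ℝ, E) ∞ M]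
    [RiemannianBundle (fun x : M ↦ TangentSpace 𝓘(ℝ, E) x)]
    (H : CotangentBundle E M → ℝ) : Prop where
  /-- `H` is locally Lipschitz. -/
  locallyLipschitz : IsLocallyLipschitzInCharts (𝓘(ℝ, E).prod 𝓘(ℝ, E →L[ℝ] ℝ)) H
  /-- `p ↦ H(x, p)` is differentiable. -/
  differentiable : ∀ x : M, Differentiable ℝ (fibreHamiltonian H x)
  /-- `H_p : T*M → TM` is continuous. -/
  continuous_fibreDerivative : Continuous (fun z : CotangentBundle E M ↦
    (⟨z.proj, fibreDerivative H z⟩ : TangentBundle 𝓘(ℝ, E) M))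
  /-- `p ↦ H(x, p)` is strictly convex. -/
  strictConvex : ∀ x : M, StrictConvexOn ℝ univ (fibreHamiltonian H x)
  /-- `H(x, p) / |p| → ∞` as `|p| → ∞`, uniformly in `x`. -/
  superlinear : ∀ K : ℝ, ∃ R : ℝ, ∀ (x : M) (p : CotangentSpace E x),
    R < ‖p‖ → K ≤ fibreHamiltonian H x p / ‖p‖

/-- The superdifferential `D⁺φ(x)`: the differentials at `x` of the functions of class `C¹` on
a ball around `x` which touch `φ` from above at `x`. -/
def superdifferential (φ : M → ℝ) (x : M) : Set (CotangentSpace E x) :=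
  {p | ∃ r > 0, ∃ ψ : M → ℝ,
    ContMDiffOn 𝓘(ℝ, E) 𝓘(ℝ, ℝ) 1 ψ (Metric.ball x r) ∧
    (∀ y ∈ Metric.ball x r, φ y ≤ ψ y) ∧ ψ x = φ x ∧
    HasMFDerivAt 𝓘(ℝ, E) 𝓘(ℝ, ℝ) ψ x p}

/-- `p` is an element of `D⁺φ(x)` at which `H(x, ·)` attains its minimum over `D⁺φ(x)`. -/
def IsMinimalEnergy (φ : M → ℝ) (H : CotangentBundle E M → ℝ) (x : M)
    (p : CotangentSpace E x) : Prop :=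
  p ∈ superdifferential φ x ∧ IsMinOn (fibreHamiltonian H x) (superdifferential φ x) p

/-- The minimal energy selection `p^#(x)`, the minimizer of `H(x, ·)` over `D⁺φ(x)`. (The value
is arbitrary if there is no minimizer.) -/
def minimalEnergySelection (φ : M → ℝ) (H : CotangentBundle E M → ℝ) (x : M) :
    CotangentSpace E x :=
  Classical.epsilon (IsMinimalEnergy φ H x)

/-- `γ : ℝ → M` is a strict singular characteristic for `(φ, H)`: it is locally absolutely
continuous, and `γ'(t) = H_p(γ(t), p^#(γ(t)))` for almost every `t`. -/
structure IsStrictSingularCharacteristic [FiniteDimensional ℝ E]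
    (φ : M → ℝ) (H : CotangentBundle E M → ℝ) (γ : ℝ → M) : Prop where
  absolutelyContinuous : ∀ a b : ℝ, AbsolutelyContinuousOnInterval γ a b
  equation : ∀ᵐ t : ℝ, HasMFDerivAt 𝓘(ℝ, ℝ) 𝓘(ℝ, E) γ t
    ((1 : ℝ →L[ℝ] ℝ).smulRight
      (fibreDerivative H ⟨γ t, minimalEnergySelection φ H (γ t)⟩))

end Cotangent

/-! The equation is the equality case of an energy inequality. For a C¹ function f, `energyGap` is
H(z, Df(z)) minus the minimum of H(z, ·) over D⁺φ(z). Suppose that for every f and every c above the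
gap at γ(t₀), the increment of φ - f along γ from t₀ to t is at least -(t - t₀)c for t slightly
larger than t₀. If γ has velocity v at t₀, a function touching φ from above at γ(t₀) with
differential p = p^#(γ(t₀)) turns this into q(v) - p(v) ≤ H(q) - H(p) for every covector q. So v is
a subgradient of H(γ(t₀), ·) at p, and v = H_p (`hasMFDerivAt_of_energyGap`).

Curves with this property are limits of discrete chains (`exists_energy_curve`). A forward step of
length τ from u is implicit Euler: maximize φ(y) - τ L((y - u)/τ), where L is the conjugate of H(u,
·); then (y - u)/τ is a subgradient of H(u, ·) at some q in D⁺φ(y). A backward step from z follows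
-H_p(z, p^#(z)). In both cases the approximate concavity of φ and the subgradient inequality give
the energy inequality up to τε (`IsLocalSystem.exists_step_inequality`). Speeds are uniformly
bounded, so the chains have Lipschitz limits. The graph of D⁺φ is closed, hence the minimal energy
is lower semicontinuous, the gap is upper semicontinuous, and the inequality survives in the limit.

This needs φ to be Lipschitz in coordinates, and concave up to an error ε l(1 - l)‖x - y‖ near the
centre, whereas semiconcavity only speaks of minimizing geodesics and does not presuppose
continuity. The bridge is that minimizing geodesics deviate from segments by a function of the end
points with arbitrarily small Lipschitz constant (`IsNormalModel.exists_norm_deviation_sub_le`). No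
geodesic equation is used: discretized energies show that the second differences of the squared
distance are almost those of ‖y - x‖² (`IsNormalModel.exists_abs_secondDiff_dist_sq_le`), and points
of minimizing geodesics minimize weighted sums of squared distances. Iterated geodesic joins then
fill a ball on which φ is bounded below; local Lipschitz continuity and
`IsNormalModel.isApproxConcave` follow. -/

/-! ### Coordinates in which the squared distance is a Riemannian metric to third order. -/

section NormalModel

variable {V : Type*} [NormedAddCommGroup V] [InnerProductSpace ℝ V] {M : Type*} [MetricSpace M]

noncomputable local instance : NormedAddCommGroup (V →L[ℝ] V →L[ℝ] ℝ) :=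
  ContinuousLinearMap.toNormedAddCommGroup

noncomputable local instance : NormedSpace ℝ (V →L[ℝ] V →L[ℝ] ℝ) :=
  ContinuousLinearMap.toNormedSpace

/-- A local parametrization `e` of a metric space in which the squared distance agrees to third
order with a Riemannian metric `g` of class `C²`, which is the inner product of `V` at `0`. -/
structure IsNormalModel (e : V → M) (g : V → V →L[ℝ] V →L[ℝ] ℝ) : Prop where
  contDiffAt : ContDiffAt ℝ 2 g 0
  symm : ∀ᶠ u in 𝓝 (0 : V), ∀ v w, g u v w = g u w v
  metric_zero : ∀ v w, g 0 v w = inner ℝ v w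
  dist_sq : ∃ K : ℝ, 0 < K ∧ ∃ R > 0, ∀ u ∈ Metric.ball (0 : V) R, ∀ v ∈ Metric.ball (0 : V) R,
    |dist (e u) (e v) ^ 2 - g u (v - u) (v - u)| ≤ K * ‖v - u‖ ^ 3
  image_mem_nhds : ∀ U ∈ 𝓝 (0 : V), e '' U ∈ 𝓝 (e 0)

/-- Quantitative consequences of `IsNormalModel` on the ball of radius `R`. -/
structure IsControlledOn (e : V → M) (g : V → V →L[ℝ] V →L[ℝ] ℝ) (K R : ℝ) : Prop where
  symm : ∀ u ∈ Metric.ball (0 : V) R, ∀ v w, g u v w = g u w v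
  lipschitz : ∀ u ∈ Metric.ball (0 : V) R, ∀ v ∈ Metric.ball (0 : V) R,
    ‖g u - g v‖ ≤ K * ‖u - v‖
  secondDiff : ∀ m θ : V, m + θ ∈ Metric.ball (0 : V) R → m - θ ∈ Metric.ball (0 : V) R →
    ‖g (m + θ) + g (m - θ) - (2 : ℝ) • g m‖ ≤ K * ‖θ‖ ^ 2
  dist_sq : ∀ u ∈ Metric.ball (0 : V) R, ∀ v ∈ Metric.ball (0 : V) R,
    |dist (e u) (e v) ^ 2 - g u (v - u) (v - u)| ≤ K * ‖v - u‖ ^ 3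

/-- Mean value inequality for t ↦ g (m + tθ) + g (m - tθ) on [0, 1]: its derivative compares the
differential of g at two points at distance at most 2‖θ‖. -/
theorem norm_secondDiff_le_of_lipschitz_fderiv {F : Type*} [NormedAddCommGroup F] [NormedSpace ℝ F]
    {g : V → F} {s : Set V} {K : ℝ≥0} (hs : Convex ℝ s) (hd : ∀ u ∈ s, DifferentiableAt ℝ g u)
    (hK : LipschitzOnWith K (fderiv ℝ g) s) {m θ : V} (hp : m + θ ∈ s) (hm : m - θ ∈ s) :
    ‖g (m + θ) + g (m - θ) - (2 : ℝ) • g m‖ ≤ 2 * K * ‖θ‖ ^ 2 := by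
  have hmem : ∀ t ∈ Icc (-1 : ℝ) 1, m + t • θ ∈ s := by
    intro t ht
    have := hs hp hm (a := (1 + t) / 2) (b := (1 - t) / 2) (by linarith [ht.1])
      (by linarith [ht.2]) (by ring)
    convert this using 1
    module
  have hder : ∀ t ∈ Icc (0 : ℝ) 1, HasDerivWithinAt (fun t : ℝ ↦ g (m + t • θ) + g (m + (-t) • θ))
      (fderiv ℝ g (m + t • θ) θ - fderiv ℝ g (m + (-t) • θ) θ) (Icc 0 1) t := by
    intro t ht
    have h1 := (hd _ (hmem t ⟨by linarith [ht.1], ht.2⟩)).hasFDerivAt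
    have h2 := (hd _ (hmem (-t) ⟨by linarith [ht.2], by linarith [ht.1]⟩)).hasFDerivAt
    have l1 : HasDerivAt (fun t : ℝ ↦ m + t • θ) θ t := by
      simpa using ((hasDerivAt_id t).smul_const θ).const_add m
    have l2 : HasDerivAt (fun t : ℝ ↦ m + (-t) • θ) (-θ) t := by
      simpa using ((hasDerivAt_neg t).smul_const θ).const_add m
    have := (h1.comp_hasDerivAt t l1).add (h2.comp_hasDerivAt t l2)
    convert! this.hasDerivWithinAt using 1
    simp [sub_eq_add_neg]
  have hb : ∀ t ∈ Ico (0 : ℝ) 1, ‖fderiv ℝ g (m + t • θ) θ - fderiv ℝ g (m + (-t) • θ) θ‖ ≤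
      2 * K * ‖θ‖ ^ 2 := by
    intro t ht
    have h1 := hmem t ⟨by linarith [ht.1], ht.2.le⟩
    have h2 := hmem (-t) ⟨by linarith [ht.2], by linarith [ht.1]⟩
    have h3 := hK.norm_sub_le h1 h2
    rw [← sub_apply]
    refine (ContinuousLinearMap.le_opNorm _ _).trans ?_
    have h4 : ‖m + t • θ - (m + (-t) • θ)‖ ≤ 2 * ‖θ‖ := by
      rw [show m + t • θ - (m + (-t) • θ) = (2 * t) • θ by module, norm_smul]
      gcongr
      rw [Real.norm_of_nonneg (by linarith [ht.1])]
      linarith [ht.2]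
    calc _ ≤ (K * (2 * ‖θ‖)) * ‖θ‖ := by gcongr; exact h3.trans (by gcongr)
      _ = _ := by ring
  have := norm_image_sub_le_of_norm_deriv_le_segment_01' hder hb
  convert this using 2
  simp [two_smul, sub_eq_add_neg]

theorem ContDiffAt.exists_lipschitzOnWith_fderiv {F : Type*} [NormedAddCommGroup F]
    [NormedSpace ℝ F] {g : V → F} {x : V} (h : ContDiffAt ℝ 2 g x) :
    ∃ K : ℝ≥0, ∃ t ∈ 𝓝 x, LipschitzOnWith K (fderiv ℝ g) t :=
  (h.fderiv_right (m := 1) (by norm_num)).exists_lipschitzOnWith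

theorem IsNormalModel.exists_isControlledOn {e : V → M} {g : V → V →L[ℝ] V →L[ℝ] ℝ}
    (h : IsNormalModel e g) : ∃ K > 0, ∃ R > 0, IsControlledOn e g K R := by
  obtain ⟨K₀, hK₀, R₀, hR₀, hdist⟩ := h.dist_sq
  obtain ⟨K₁, t₁, ht₁, hl₁⟩ := (h.contDiffAt.of_le one_le_two).exists_lipschitzOnWith
  obtain ⟨K₂, t₂, ht₂, hl₂⟩ := h.contDiffAt.exists_lipschitzOnWith_fderiv
  have hdiff : ∀ᶠ u in 𝓝 (0 : V), DifferentiableAt ℝ g u :=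
    (h.contDiffAt.eventually (by simp)).mono fun u hu ↦ hu.differentiableAt (by simp)
  obtain ⟨R₁, hR₁, hall⟩ := Metric.eventually_nhds_iff_ball.1
    (((h.symm.and hdiff).and ht₁).and ht₂)
  refine ⟨K₀ + K₁ + 2 * K₂, by positivity, min R₀ R₁, by positivity, ?_, ?_, ?_, ?_⟩
  · intro u hu
    exact (hall u (Metric.ball_subset_ball (min_le_right _ _) hu)).1.1.1
  · intro u hu v hv
    have := hl₁.norm_sub_le (hall u (Metric.ball_subset_ball (min_le_right _ _) hu)).1.2
      (hall v (Metric.ball_subset_ball (min_le_right _ _) hv)).1.2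
    refine this.trans ?_
    gcongr
    linarith [K₂.coe_nonneg]
  · intro m θ hp hm
    have := norm_secondDiff_le_of_lipschitz_fderiv (convex_ball (0 : V) R₁)
      (fun u hu ↦ (hall u hu).1.1.2) (hl₂.mono fun u hu ↦ (hall u hu).2)
      (Metric.ball_subset_ball (min_le_right _ _) hp)
      (Metric.ball_subset_ball (min_le_right _ _) hm)
    refine this.trans ?_
    gcongr
    linarith [K₁.coe_nonneg]
  · intro u hu v hv
    refine (hdist u (Metric.ball_subset_ball (min_le_left _ _) hu) v
      (Metric.ball_subset_ball (min_le_left _ _) hv)).trans ?_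
    gcongr
    linarith [K₁.coe_nonneg, K₂.coe_nonneg]

theorem IsControlledOn.mono {e : V → M} {g : V → V →L[ℝ] V →L[ℝ] ℝ} {K R R' : ℝ}
    (h : IsControlledOn e g K R) (hR : R' ≤ R) : IsControlledOn e g K R' where
  symm u hu := h.symm u (Metric.ball_subset_ball hR hu)
  lipschitz u hu v hv := h.lipschitz u (Metric.ball_subset_ball hR hu) v
    (Metric.ball_subset_ball hR hv)
  secondDiff m θ hp hm := h.secondDiff m θ (Metric.ball_subset_ball hR hp)
    (Metric.ball_subset_ball hR hm)
  dist_sq u hu v hv := h.dist_sq u (Metric.ball_subset_ball hR hu) v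
    (Metric.ball_subset_ball hR hv)

variable {e : V → M} {g : V → V →L[ℝ] V →L[ℝ] ℝ}

theorem IsControlledOn.abs_metric_sub_inner_le {K R : ℝ} (h : IsControlledOn e g K R)
    (h0 : ∀ v w, g 0 v w = inner ℝ v w) {u : V} (hu : u ∈ Metric.ball 0 R) (v w : V) :
    |g u v w - inner ℝ v w| ≤ K * ‖u‖ * ‖v‖ * ‖w‖ := by
  have hR : 0 < R := (norm_nonneg u).trans_lt (by simpa using hu)
  have h1 := h.lipschitz u hu 0 (by simpa using hR)
  rw [← h0, ← Real.norm_eq_abs, show g u v w - g 0 v w = (g u - g 0) v w from rfl]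
  refine (ContinuousLinearMap.le_opNorm₂ _ _ _).trans ?_
  gcongr
  simpa using h1

/-- The distance is as close as desired to the norm of `V`, near `0`. -/
theorem IsNormalModel.exists_abs_dist_sq_sub_le (h : IsNormalModel e g) {ε : ℝ} (hε : 0 < ε) :
    ∃ R > 0, ∀ u ∈ Metric.ball (0 : V) R, ∀ v ∈ Metric.ball (0 : V) R,
      |dist (e u) (e v) ^ 2 - ‖v - u‖ ^ 2| ≤ ε * ‖v - u‖ ^ 2 := by
  obtain ⟨K, hK, R, hR, hc⟩ := h.exists_isControlledOn
  -- For ‖u‖, ‖v‖ ≤ ε / (3K) the cubic error costs 2ε/3 and the drift of g from the inner product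
  -- costs ε/3.
  refine ⟨min R (ε / (3 * K)), by positivity, fun u hu v hv ↦ ?_⟩
  have hu' := Metric.ball_subset_ball (min_le_left _ _) hu
  have hv' := Metric.ball_subset_ball (min_le_left _ _) hv
  have h1 := hc.dist_sq u hu' v hv'
  have h2 := hc.abs_metric_sub_inner_le h.metric_zero hu' (v - u) (v - u)
  rw [real_inner_self_eq_norm_sq] at h2
  have hu2 : ‖u‖ ≤ ε / (3 * K) := by
    have := (mem_ball_zero_iff.1 hu).le; exact this.trans (min_le_right _ _)
  have hv2 : ‖v‖ ≤ ε / (3 * K) := by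
    have := (mem_ball_zero_iff.1 hv).le; exact this.trans (min_le_right _ _)
  have h3 : ‖v - u‖ ≤ 2 * (ε / (3 * K)) := (norm_sub_le _ _).trans (by linarith)
  have h4 : K * ‖v - u‖ ^ 3 ≤ (2 * ε / 3) * ‖v - u‖ ^ 2 := by
    calc K * ‖v - u‖ ^ 3 = K * ‖v - u‖ * ‖v - u‖ ^ 2 := by ring
      _ ≤ K * (2 * (ε / (3 * K))) * ‖v - u‖ ^ 2 := by gcongr
      _ = _ := by field_simp
  have h5 : K * ‖u‖ * ‖v - u‖ * ‖v - u‖ ≤ (ε / 3) * ‖v - u‖ ^ 2 := by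
    calc K * ‖u‖ * ‖v - u‖ * ‖v - u‖ = K * ‖u‖ * ‖v - u‖ ^ 2 := by ring
      _ ≤ K * (ε / (3 * K)) * ‖v - u‖ ^ 2 := by gcongr
      _ = _ := by field_simp
  calc _ ≤ _ := abs_sub_le _ (g u (v - u) (v - u)) _
    _ ≤ _ := add_le_add h1 h2
    _ ≤ _ := by linarith

theorem IsNormalModel.exists_dist_bounds (h : IsNormalModel e g) {ε : ℝ} (hε : 0 < ε)
    (hε1 : ε < 1) :
    ∃ R > 0, ∀ u ∈ Metric.ball (0 : V) R, ∀ v ∈ Metric.ball (0 : V) R,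
      (1 - ε) * ‖u - v‖ ≤ dist (e u) (e v) ∧ dist (e u) (e v) ≤ (1 + ε) * ‖u - v‖ := by
  obtain ⟨R, hR, hb⟩ := h.exists_abs_dist_sq_sub_le hε
  refine ⟨R, hR, fun u hu v hv ↦ ?_⟩
  have := abs_le.1 (hb u hu v hv)
  rw [norm_sub_rev] at this
  constructor
  · refine le_of_sq_le_sq ?_ dist_nonneg
    have : ((1 - ε) * ‖u - v‖) ^ 2 ≤ (1 - ε) * ‖u - v‖ ^ 2 := by
      rw [mul_pow]; gcongr; nlinarith
    linarith
  · refine le_of_sq_le_sq ?_ (by positivity)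
    have : (1 + ε) * ‖u - v‖ ^ 2 ≤ ((1 + ε) * ‖u - v‖) ^ 2 := by
      rw [mul_pow]; gcongr; nlinarith
    linarith

/-- The pointwise estimate behind the almost-parallelogram identity for the energy. -/
theorem IsControlledOn.abs_energy_secondDiff_le {K R : ℝ} (hc : IsControlledOn e g K R)
    (hK : 0 < K) (h0 : ∀ v w, g 0 v w = inner ℝ v w) {m θ μ τ : V} {B : ℝ}
    (hp : m + θ ∈ Metric.ball (0 : V) R) (hm : m - θ ∈ Metric.ball (0 : V) R)
    (hμ : ‖μ‖ ≤ B) :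
    |g (m + θ) (μ + τ) (μ + τ) + g (m - θ) (μ - τ) (μ - τ) - 2 * g m μ μ - 2 * ‖τ‖ ^ 2| ≤
      (K * B ^ 2 + 2 * K * B) * ‖θ‖ ^ 2 + (2 * K * B + 2 * K * R) * ‖τ‖ ^ 2 := by
  have hB : 0 ≤ B := (norm_nonneg μ).trans hμ
  have h1 := hc.secondDiff m θ hp hm
  have h2 := hc.lipschitz _ hp _ hm
  have h3 := hc.abs_metric_sub_inner_le h0 hp τ τ
  have h4 := hc.abs_metric_sub_inner_le h0 hm τ τ
  have hs : ‖m + θ‖ ≤ R := by simpa using (mem_ball_zero_iff.1 hp).le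
  have hs' : ‖m - θ‖ ≤ R := by simpa using (mem_ball_zero_iff.1 hm).le
  rw [real_inner_self_eq_norm_sq] at h3 h4
  have e1 : |(g (m + θ) + g (m - θ) - (2 : ℝ) • g m) μ μ| ≤ K * ‖θ‖ ^ 2 * B ^ 2 := by
    rw [← Real.norm_eq_abs]
    calc _ ≤ ‖g (m + θ) + g (m - θ) - (2 : ℝ) • g m‖ * ‖μ‖ * ‖μ‖ :=
          ContinuousLinearMap.le_opNorm₂ _ _ _
      _ ≤ K * ‖θ‖ ^ 2 * B * B := by gcongr
      _ = _ := by ring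
  have e2 : |(g (m + θ) - g (m - θ)) μ τ| ≤ K * (2 * ‖θ‖) * B * ‖τ‖ := by
    rw [← Real.norm_eq_abs]
    have : ‖m + θ - (m - θ)‖ = 2 * ‖θ‖ := by
      rw [show m + θ - (m - θ) = (2 : ℝ) • θ by module, norm_smul]; simp
    rw [this] at h2
    calc _ ≤ ‖g (m + θ) - g (m - θ)‖ * ‖μ‖ * ‖τ‖ := ContinuousLinearMap.le_opNorm₂ _ _ _
      _ ≤ _ := by gcongr
  have e3 : K * ‖m + θ‖ * ‖τ‖ * ‖τ‖ ≤ K * R * ‖τ‖ ^ 2 := by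
    rw [sq, ← mul_assoc]; gcongr
  have e4 : K * ‖m - θ‖ * ‖τ‖ * ‖τ‖ ≤ K * R * ‖τ‖ ^ 2 := by
    rw [sq, ← mul_assoc]; gcongr
  -- Sorting by degree in τ: a second difference of g, a first difference of g tested on (μ, τ), and
  -- two τ-terms close to ‖τ‖². The middle term, of order ‖θ‖‖τ‖, is split into squares afterwards.
  have key : g (m + θ) (μ + τ) (μ + τ) + g (m - θ) (μ - τ) (μ - τ) - 2 * g m μ μ - 2 * ‖τ‖ ^ 2 =
      (g (m + θ) + g (m - θ) - (2 : ℝ) • g m) μ μ + 2 * (g (m + θ) - g (m - θ)) μ τ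
      + (g (m + θ) τ τ - ‖τ‖ ^ 2) + (g (m - θ) τ τ - ‖τ‖ ^ 2) := by
    simp only [map_add, map_sub, add_apply, sub_apply, smul_apply, smul_eq_mul,
      hc.symm _ hp τ μ, hc.symm _ hm τ μ]
    ring
  rw [key]
  have e5 : 2 * (K * (2 * ‖θ‖) * B * ‖τ‖) ≤ 2 * K * B * (‖θ‖ ^ 2 + ‖τ‖ ^ 2) := by
    have : 0 ≤ 2 * K * B * (‖θ‖ - ‖τ‖) ^ 2 := by positivity
    linarith [this, show 2 * K * B * (‖θ‖ - ‖τ‖) ^ 2 = 2 * K * B * (‖θ‖ ^ 2 + ‖τ‖ ^ 2)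
      - 2 * (K * (2 * ‖θ‖) * B * ‖τ‖) by ring]
  rw [abs_le] at *
  constructor <;> nlinarith [e1.1, e1.2, e2.1, e2.2, h3.1, h3.2, h4.1, h4.2]

end NormalModel

/-! ### Discretized geodesics and their energy. -/

section Chains

variable {V : Type*} [NormedAddCommGroup V] [InnerProductSpace ℝ V] {M : Type*} [MetricSpace M]
  {e : V → M} {g : V → V →L[ℝ] V →L[ℝ] ℝ}

theorem IsMinimizingGeodesic.dist_left {γ : ℝ → M} {x y : M} (h : IsMinimizingGeodesic γ x y)
    {t : ℝ} (ht : t ∈ Icc (0 : ℝ) 1) : dist x (γ t) = t * dist x y := by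
  have := h.2.2 0 (by simp) t ht
  rwa [h.1, zero_sub, abs_neg, abs_of_nonneg ht.1] at this

theorem IsMinimizingGeodesic.dist_right {γ : ℝ → M} {x y : M} (h : IsMinimizingGeodesic γ x y)
    {t : ℝ} (ht : t ∈ Icc (0 : ℝ) 1) : dist (γ t) y = (1 - t) * dist x y := by
  have := h.2.2 t ht 1 (by simp)
  rwa [h.2.1, abs_sub_comm, abs_of_nonneg (by linarith [ht.2])] at this

/-- Minimizing geodesics between points near `e 0` lift through `e`. -/
theorem IsNormalModel.exists_lift (h : IsNormalModel e g) {R : ℝ} (hR : 0 < R) :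
    ∃ r > 0, r ≤ R ∧ ∀ u ∈ Metric.ball (0 : V) r, ∀ v ∈ Metric.ball (0 : V) r, ∀ γ : ℝ → M,
      IsMinimizingGeodesic γ (e u) (e v) → ∃ a : ℝ → V,
        (∀ t ∈ Icc (0 : ℝ) 1, a t ∈ Metric.ball (0 : V) R ∧ e (a t) = γ t) ∧ a 0 = u ∧ a 1 = v := by
  obtain ⟨R₁, hR₁, hd⟩ := h.exists_dist_bounds (ε := 1 / 2) (by norm_num) (by norm_num)
  have hm : 0 < min R R₁ := lt_min hR hR₁
  obtain ⟨s, hs, hsub⟩ := Metric.mem_nhds_iff.1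
    (h.image_mem_nhds _ (Metric.ball_mem_nhds (0 : V) hm))
  -- For ‖u‖, ‖v‖ < s/6 the geodesic has length below s/2 and starts within s/4 of `e 0`, so it
  -- stays in the ball of radius s covered by `e`.
  refine ⟨min (min R R₁) (s / 6), by positivity, (min_le_left _ _).trans (min_le_left _ _), ?_⟩
  intro u hu v hv γ hγ
  have hu1 : u ∈ Metric.ball (0 : V) (min R R₁) := Metric.ball_subset_ball (min_le_left _ _) hu
  have hv1 : v ∈ Metric.ball (0 : V) (min R R₁) := Metric.ball_subset_ball (min_le_left _ _) hv
  have hR1 : ∀ {w}, w ∈ Metric.ball (0 : V) (min R R₁) → w ∈ Metric.ball (0 : V) R₁ :=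
    fun hw ↦ Metric.ball_subset_ball (min_le_right _ _) hw
  have hu2 : ‖u‖ < s / 6 := (mem_ball_zero_iff.1 hu).trans_le (min_le_right _ _)
  have hv2 : ‖v‖ < s / 6 := (mem_ball_zero_iff.1 hv).trans_le (min_le_right _ _)
  have hinj : ∀ p ∈ Metric.ball (0 : V) (min R R₁), ∀ q ∈ Metric.ball (0 : V) (min R R₁),
      e p = e q → p = q := by
    intro p hp q hq hpq
    have := (hd p (hR1 hp) q (hR1 hq)).1
    rw [hpq, dist_self] at this
    exact sub_eq_zero.1 (norm_eq_zero.1 (le_antisymm (by linarith) (norm_nonneg _)))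
  have hex : ∀ t : ℝ, ∃ p, t ∈ Icc (0 : ℝ) 1 → p ∈ Metric.ball (0 : V) (min R R₁) ∧ e p = γ t := by
    intro t
    by_cases ht : t ∈ Icc (0 : ℝ) 1
    · have h1 := (hd u (hR1 hu1) v (hR1 hv1)).2
      have h2 := (hd u (hR1 hu1) 0 (by simpa using hR₁)).2
      have h3 := hγ.dist_left ht
      have h4 : t * dist (e u) (e v) ≤ dist (e u) (e v) :=
        mul_le_of_le_one_left dist_nonneg ht.2
      have h5 := norm_sub_le u v
      have : γ t ∈ Metric.ball (e 0) s := by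
        rw [Metric.mem_ball]
        refine (dist_triangle_left _ _ (e u)).trans_lt ?_
        rw [sub_zero] at h2
        linarith
      obtain ⟨p, hp, hpe⟩ := hsub this
      exact ⟨p, fun _ ↦ ⟨hp, hpe⟩⟩
    · exact ⟨0, fun h ↦ absurd h ht⟩
  choose a ha using hex
  refine ⟨a, fun t ht ↦ ⟨Metric.ball_subset_ball (min_le_left _ _) (ha t ht).1, (ha t ht).2⟩,
    ?_, ?_⟩
  · exact hinj _ (ha 0 (by simp)).1 _ hu1 ((ha 0 (by simp)).2.trans hγ.1)
  · exact hinj _ (ha 1 (by simp)).1 _ hv1 ((ha 1 (by simp)).2.trans hγ.2.1)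

/-- The energy of a polygonal chain with `N` edges, each travelled in time `1 / N`. -/
noncomputable def chainEnergy (g : V → V →L[ℝ] V →L[ℝ] ℝ) (N : ℕ) (c : ℕ → V) : ℝ :=
  N * ∑ i ∈ Finset.range N, g (c i) (c (i + 1) - c i) (c (i + 1) - c i)

/-- Triangle inequality and Cauchy–Schwarz, with equality for equally spaced points of a minimizing
geodesic. So the squared distance is a minimum of discrete energies, and chains serve as
competitors. -/
theorem dist_sq_le_mul_sum (p : ℕ → M) (N : ℕ) :
    dist (p 0) (p N) ^ 2 ≤ N * ∑ i ∈ Finset.range N, dist (p i) (p (i + 1)) ^ 2 := by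
  have h1 := dist_le_range_sum_dist p N
  have h2 := sq_sum_le_card_mul_sum_sq (s := Finset.range N) (f := fun i ↦ dist (p i) (p (i + 1)))
  rw [Finset.card_range] at h2
  exact (pow_le_pow_left₀ dist_nonneg h1 2).trans h2

/-- Each of the N edges has length at most C/N and contributes a cubic error; with the prefactor N
this leaves K C³ / N, which vanishes under refinement. -/
theorem IsControlledOn.abs_sum_dist_sq_sub_chainEnergy_le {K R : ℝ} (hc : IsControlledOn e g K R)
    (hK : 0 < K) {N : ℕ} (hN : 0 < N) {c : ℕ → V} {C : ℝ}
    (hmem : ∀ i ≤ N, c i ∈ Metric.ball (0 : V) R) (hC : ∀ i < N, N * ‖c (i + 1) - c i‖ ≤ C) :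
    |N * ∑ i ∈ Finset.range N, dist (e (c i)) (e (c (i + 1))) ^ 2 - chainEnergy g N c| ≤
      K * C ^ 3 / N := by
  have hN' : (0 : ℝ) < N := by exact_mod_cast hN
  rw [chainEnergy, ← mul_sub, ← Finset.sum_sub_distrib, abs_mul, abs_of_pos hN']
  have : ∀ i ∈ Finset.range N, |dist (e (c i)) (e (c (i + 1))) ^ 2 -
      g (c i) (c (i + 1) - c i) (c (i + 1) - c i)| ≤ K * (C / N) ^ 3 := by
    intro i hi
    have hi := Finset.mem_range.1 hi
    refine (hc.dist_sq _ (hmem _ hi.le) _ (hmem _ hi)).trans ?_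
    gcongr
    rw [le_div_iff₀ hN', mul_comm]
    exact hC i hi
  calc _ ≤ N * ∑ i ∈ Finset.range N, K * (C / N) ^ 3 := by
        gcongr
        exact (Finset.abs_sum_le_sum_abs _ _).trans (Finset.sum_le_sum this)
    _ = _ := by
        rw [Finset.sum_const, Finset.card_range, nsmul_eq_mul]
        field_simp

/-- Sum of `abs_energy_secondDiff_le` over the edges, with the velocities N(m(i+1) - m i) and
N(θ(i+1) - θ i) in the roles of μ and τ. -/
theorem IsControlledOn.abs_chainEnergy_secondDiff_le {K R : ℝ} (hc : IsControlledOn e g K R)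
    (hK : 0 < K) (h0 : ∀ v w, g 0 v w = inner ℝ v w) {N : ℕ} (hN : 0 < N) {m θ : ℕ → V} {B : ℝ}
    (hp : ∀ i ≤ N, m i + θ i ∈ Metric.ball (0 : V) R)
    (hm : ∀ i ≤ N, m i - θ i ∈ Metric.ball (0 : V) R)
    (hB : ∀ i < N, N * ‖m (i + 1) - m i‖ ≤ B) :
    |chainEnergy g N (fun i ↦ m i + θ i) + chainEnergy g N (fun i ↦ m i - θ i)
        - 2 * chainEnergy g N m - 2 * (N * ∑ i ∈ Finset.range N, ‖θ (i + 1) - θ i‖ ^ 2)| ≤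
      (K * B ^ 2 + 2 * K * B) * ((∑ i ∈ Finset.range N, ‖θ i‖ ^ 2) / N) +
      (2 * K * B + 2 * K * R) * (N * ∑ i ∈ Finset.range N, ‖θ (i + 1) - θ i‖ ^ 2) := by
  have hN' : (0 : ℝ) < N := by exact_mod_cast hN
  have pt : ∀ i ∈ Finset.range N,
      |g (m i + θ i) (m (i + 1) + θ (i + 1) - (m i + θ i)) (m (i + 1) + θ (i + 1) - (m i + θ i))
      + g (m i - θ i) (m (i + 1) - θ (i + 1) - (m i - θ i)) (m (i + 1) - θ (i + 1) - (m i - θ i))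
      - 2 * g (m i) (m (i + 1) - m i) (m (i + 1) - m i) - 2 * ‖θ (i + 1) - θ i‖ ^ 2| ≤
      (K * B ^ 2 + 2 * K * B) * (‖θ i‖ ^ 2 / N ^ 2) +
        (2 * K * B + 2 * K * R) * ‖θ (i + 1) - θ i‖ ^ 2 := by
    intro i hi
    have hi := Finset.mem_range.1 hi
    have := hc.abs_energy_secondDiff_le hK h0 (hp i hi.le) (hm i hi.le)
      (μ := (N : ℝ) • (m (i + 1) - m i)) (τ := (N : ℝ) • (θ (i + 1) - θ i)) (B := B)
      (by rw [norm_smul, Real.norm_of_nonneg hN'.le]; exact hB i hi)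
    rw [← smul_add, ← smul_sub, norm_smul, Real.norm_of_nonneg hN'.le, mul_pow] at this
    simp only [map_smul, smul_apply, smul_eq_mul] at this
    rw [show m (i + 1) + θ (i + 1) - (m i + θ i) = m (i + 1) - m i + (θ (i + 1) - θ i) by abel,
      show m (i + 1) - θ (i + 1) - (m i - θ i) = m (i + 1) - m i - (θ (i + 1) - θ i) by abel]
    have h2 : (0 : ℝ) < N ^ 2 := by positivity
    refine le_of_mul_le_mul_left ?_ h2
    rw [← abs_of_pos h2, ← abs_mul, abs_of_pos h2]
    refine le_trans (le_of_eq ?_) (this.trans (le_of_eq ?_))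
    · congr 1; ring
    · field_simp
  unfold chainEnergy
  rw [show ∀ a b c d : ℝ, (N : ℝ) * a + N * b - 2 * (N * c) - 2 * (N * d) =
    N * (a + b - 2 * c - 2 * d) by intros; ring, Finset.mul_sum _ _ (2 : ℝ),
    Finset.mul_sum _ _ (2 : ℝ), ← Finset.sum_add_distrib, ← Finset.sum_sub_distrib,
    ← Finset.sum_sub_distrib, abs_mul, abs_of_pos hN']
  calc _ ≤ (N : ℝ) * ∑ i ∈ Finset.range N, ((K * B ^ 2 + 2 * K * B) * (‖θ i‖ ^ 2 / N ^ 2) +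
        (2 * K * B + 2 * K * R) * ‖θ (i + 1) - θ i‖ ^ 2) := by
        gcongr
        exact (Finset.abs_sum_le_sum_abs _ _).trans (Finset.sum_le_sum pt)
    _ = _ := by
        rw [Finset.sum_add_distrib, ← Finset.mul_sum, ← Finset.mul_sum, ← Finset.sum_div]
        field_simp

/-- Lifted uniform subdivision of a minimizing geodesic. -/
theorem exists_chain {a : ℝ → V} {γ : ℝ → M} {u v : V} {R : ℝ}
    (hγ : IsMinimizingGeodesic γ (e u) (e v))
    (ha : ∀ t ∈ Icc (0 : ℝ) 1, a t ∈ Metric.ball (0 : V) R ∧ e (a t) = γ t) (h0 : a 0 = u)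
    (h1 : a 1 = v) {N : ℕ} (hN : 0 < N) :
    ∃ c : ℕ → V, c 0 = u ∧ c N = v ∧ (∀ i ≤ N, c i ∈ Metric.ball (0 : V) R) ∧
      ∀ i < N, N * dist (e (c i)) (e (c (i + 1))) = dist (e u) (e v) := by
  have hN' : (0 : ℝ) < N := by exact_mod_cast hN
  have hI : ∀ i ≤ N, (i / N : ℝ) ∈ Icc (0 : ℝ) 1 := fun i hi ↦
    ⟨by positivity, (div_le_one hN').2 (by exact_mod_cast hi)⟩
  refine ⟨fun i ↦ a (i / N), by simpa using h0, by simpa [hN'.ne'] using h1,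
    fun i hi ↦ (ha _ (hI i hi)).1, fun i hi ↦ ?_⟩
  have h2 := hI (i + 1) hi
  rw [(ha _ (hI i hi.le)).2, (ha _ h2).2, hγ.2.2 _ (hI i hi.le) _ h2]
  push_cast
  rw [show (i / N : ℝ) - (i + 1) / N = -(1 / N) by ring, abs_neg, abs_of_pos (by positivity)]
  field_simp

theorem norm_sq_sub_le_mul_sum (θ : ℕ → V) (N : ℕ) :
    ‖θ N - θ 0‖ ^ 2 ≤ N * ∑ i ∈ Finset.range N, ‖θ (i + 1) - θ i‖ ^ 2 := by
  have := dist_sq_le_mul_sum θ N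
  simpa [dist_eq_norm, norm_sub_rev] using this

/-- A discrete Poincaré inequality: a variation is controlled by its initial value and its kinetic
energy. -/
theorem sum_norm_sq_le (θ : ℕ → V) {N : ℕ} (hN : 0 < N) :
    (∑ i ∈ Finset.range N, ‖θ i‖ ^ 2) / N ≤
      2 * ‖θ 0‖ ^ 2 + 2 * (N * ∑ i ∈ Finset.range N, ‖θ (i + 1) - θ i‖ ^ 2) := by
  have hN' : (0 : ℝ) < N := by exact_mod_cast hN
  rw [div_le_iff₀ hN']
  calc _ ≤ ∑ i ∈ Finset.range N, (2 * ‖θ 0‖ ^ 2 +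
        2 * (N * ∑ i ∈ Finset.range N, ‖θ (i + 1) - θ i‖ ^ 2)) := by
        refine Finset.sum_le_sum fun i hi ↦ ?_
        have hi := Finset.mem_range.1 hi
        have h1 := norm_sq_sub_le_mul_sum θ i
        have h2 : (i : ℝ) * ∑ j ∈ Finset.range i, ‖θ (j + 1) - θ j‖ ^ 2 ≤
            N * ∑ j ∈ Finset.range N, ‖θ (j + 1) - θ j‖ ^ 2 := by
          have : (i : ℝ) ≤ N := by exact_mod_cast hi.le
          gcongr
        have h3 : ‖θ i‖ ≤ ‖θ 0‖ + ‖θ i - θ 0‖ := by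
          simpa using norm_add_le (θ 0) (θ i - θ 0)
        have h4 : ‖θ i‖ ^ 2 ≤ (‖θ 0‖ + ‖θ i - θ 0‖) ^ 2 := by gcongr
        nlinarith [sq_nonneg (‖θ 0‖ - ‖θ i - θ 0‖)]
    _ = _ := by rw [Finset.sum_const, Finset.card_range, nsmul_eq_mul]; ring

end Chains

theorem le_of_forall_nat_le_add_div {X Y Z : ℝ} (h : ∀ N : ℕ, 0 < N → X ≤ Y + Z / N) : X ≤ Y := by
  have : Tendsto (fun N : ℕ ↦ Y + Z / N) atTop (𝓝 (Y + 0)) :=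
    tendsto_const_nhds.add (tendsto_const_div_atTop_nhds_zero_nat Z)
  rw [add_zero] at this
  exact ge_of_tendsto this ((eventually_gt_atTop 0).mono h)

/-! ### Second differences of the squared distance. -/

section SecondDiff

variable {V : Type*} [NormedAddCommGroup V] [InnerProductSpace ℝ V] {M : Type*} [MetricSpace M]
  {e : V → M} {g : V → V →L[ℝ] V →L[ℝ] ℝ}

/-- Near `0`, the squared distance is almost quadratic. -/
theorem IsNormalModel.exists_abs_secondDiff_dist_sq_le (hm : IsNormalModel e g)
    (hgeo : ∀ x y : M, ∃ γ : ℝ → M, IsMinimizingGeodesic γ x y) {ε : ℝ} (hε : 0 < ε) :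
    ∃ R > 0, ∀ x y h k : V, x + h ∈ Metric.ball (0 : V) R → x - h ∈ Metric.ball (0 : V) R →
      y + k ∈ Metric.ball (0 : V) R → y - k ∈ Metric.ball (0 : V) R →
      |dist (e (x + h)) (e (y + k)) ^ 2 + dist (e (x - h)) (e (y - k)) ^ 2
        - 2 * dist (e x) (e y) ^ 2 - 2 * ‖k - h‖ ^ 2| ≤ ε * (‖h‖ ^ 2 + ‖k‖ ^ 2) := by
  obtain ⟨K, hK, R₀, hR₀, hc₀⟩ := hm.exists_isControlledOn
  obtain ⟨R₁, hR₁, hd⟩ := hm.exists_dist_bounds (ε := 1 / 2) (by norm_num) (by norm_num)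
  -- The total error will be 2β‖h‖² + 3β‖k - h‖² ≤ 8β(‖h‖² + ‖k‖²). The condition 3β ≤ 1 keeps the
  -- factor 2 - 3β of the kinetic energy nonnegative in the lower bound.
  obtain ⟨β, hβ, hβε, hβ3⟩ : ∃ β > 0, 8 * β ≤ ε ∧ 3 * β ≤ 1 :=
    ⟨min (ε / 8) (1 / 3), by positivity, by linarith [min_le_left (ε / 8) (1 / 3)],
      by linarith [min_le_right (ε / 8) (1 / 3)]⟩
  obtain ⟨R, hR, hRR₀, hRR₁, hR1, hRβ⟩ : ∃ R > 0, R ≤ R₀ ∧ R ≤ R₁ ∧ R ≤ 1 ∧ 15 * K * R ≤ β := by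
    refine ⟨min (min R₀ R₁) (min 1 (β / (15 * K))), by positivity,
      (min_le_left _ _).trans (min_le_left _ _), (min_le_left _ _).trans (min_le_right _ _),
      (min_le_right _ _).trans (min_le_left _ _), ?_⟩
    rw [mul_comm, ← le_div_iff₀ (by positivity)]
    exact (min_le_right _ _).trans (min_le_right _ _)
  have hc := hc₀.mono hRR₀
  -- Geodesics between points of norm below R/2 have coordinate speed at most 3R. With B = 3R and R
  -- ≤ 1 both coefficients of the pointwise estimate are at most 15KR.
  have hcoef1 : K * (3 * R) ^ 2 + 2 * K * (3 * R) ≤ β := by nlinarith [mul_pos hK hR]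
  have hcoef2 : 2 * K * (3 * R) + 2 * K * R ≤ β := by nlinarith [mul_pos hK hR]
  obtain ⟨r, hr, hrR, hlift⟩ := hm.exists_lift (half_pos hR)
  have hdist : ∀ u ∈ Metric.ball (0 : V) R, ∀ v ∈ Metric.ball (0 : V) R,
      ‖v - u‖ ≤ 2 * dist (e u) (e v) ∧ 2 * dist (e u) (e v) ≤ 3 * ‖v - u‖ := by
    intro u hu v hv
    have := hd u (Metric.ball_subset_ball hRR₁ hu) v (Metric.ball_subset_ball hRR₁ hv)
    rw [norm_sub_rev] at this
    constructor <;> linarith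
  -- chains with `N` edges on a geodesic between two points of the small ball
  have hchain : ∀ u ∈ Metric.ball (0 : V) r, ∀ v ∈ Metric.ball (0 : V) r, ∀ N : ℕ, 0 < N →
      ∃ c : ℕ → V, c 0 = u ∧ c N = v ∧ (∀ i ≤ N, c i ∈ Metric.ball (0 : V) (R / 2)) ∧
        (∀ i < N, N * ‖c (i + 1) - c i‖ ≤ 3 * R) ∧
        N * ∑ i ∈ Finset.range N, dist (e (c i)) (e (c (i + 1))) ^ 2 = dist (e u) (e v) ^ 2 := by
    intro u hu v hv N hN
    have hN' : (0 : ℝ) < N := by exact_mod_cast hN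
    obtain ⟨γ, hγ⟩ := hgeo (e u) (e v)
    obtain ⟨a, ha, ha0, ha1⟩ := hlift u hu v hv γ hγ
    obtain ⟨c, hc0, hcN, hcm, hcd⟩ := exists_chain hγ ha ha0 ha1 hN
    have hcm' : ∀ i ≤ N, c i ∈ Metric.ball (0 : V) R := fun i hi ↦
      Metric.ball_subset_ball (by linarith) (hcm i hi)
    refine ⟨c, hc0, hcN, hcm, fun i hi ↦ ?_, ?_⟩
    · have h1 := (hdist _ (hcm' i hi.le) _ (hcm' (i + 1) hi)).1
      have h2 := (hdist _ (Metric.ball_subset_ball (by linarith) hu) _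
        (Metric.ball_subset_ball (by linarith : r ≤ R) hv)).2
      have h3 := norm_sub_le v u
      have h4 := mem_ball_zero_iff.1 hu
      have h5 := mem_ball_zero_iff.1 hv
      have h6 := hcd i hi
      nlinarith
    · rw [Finset.sum_congr rfl fun i hi ↦ by
        rw [show dist (e (c i)) (e (c (i + 1))) = dist (e u) (e v) / N by
          rw [← hcd i (Finset.mem_range.1 hi)]; field_simp]]
      rw [Finset.sum_const, Finset.card_range, nsmul_eq_mul]
      field_simp
  refine ⟨r, hr, fun x y h k hxp hxm hyp hym ↦ ?_⟩
  have hhr : ∀ p q : V, p + q ∈ Metric.ball (0 : V) r → p - q ∈ Metric.ball (0 : V) r →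
      p ∈ Metric.ball (0 : V) r ∧ ‖q‖ < r := by
    intro p q hp hq
    rw [mem_ball_zero_iff] at *
    have h1 : ‖(2 : ℝ) • p‖ ≤ ‖p + q‖ + ‖p - q‖ := by
      rw [show (2 : ℝ) • p = (p + q) + (p - q) by module]; exact norm_add_le _ _
    have h2 : ‖(2 : ℝ) • q‖ ≤ ‖p + q‖ + ‖p - q‖ := by
      rw [show (2 : ℝ) • q = (p + q) - (p - q) by module]; exact norm_sub_le _ _
    rw [norm_smul, Real.norm_ofNat] at h1 h2
    constructor <;> linarith
  obtain ⟨hx, hh⟩ := hhr x h hxp hxm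
  obtain ⟨hy, hk⟩ := hhr y k hyp hym
  have hkh : ‖k - h‖ ^ 2 ≤ 2 * (‖h‖ ^ 2 + ‖k‖ ^ 2) := by
    have := parallelogram_law_with_norm ℝ k h
    nlinarith [mul_self_nonneg ‖k + h‖]
  -- the estimate for three chains with the right endpoints
  have main : ∀ N : ℕ, 0 < N → ∀ m θ : ℕ → V, θ 0 = h →
      (∀ i ≤ N, m i + θ i ∈ Metric.ball (0 : V) R) →
      (∀ i ≤ N, m i - θ i ∈ Metric.ball (0 : V) R) →
      (∀ i ≤ N, m i ∈ Metric.ball (0 : V) R) →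
      (∀ i < N, N * ‖m (i + 1) - m i‖ ≤ 3 * R) →
      (∀ i < N, N * ‖m (i + 1) + θ (i + 1) - (m i + θ i)‖ ≤ 4 * R) →
      (∀ i < N, N * ‖m (i + 1) - θ (i + 1) - (m i - θ i)‖ ≤ 4 * R) →
      |N * ∑ i ∈ Finset.range N, dist (e (m i + θ i)) (e (m (i + 1) + θ (i + 1))) ^ 2 +
        N * ∑ i ∈ Finset.range N, dist (e (m i - θ i)) (e (m (i + 1) - θ (i + 1))) ^ 2 -
        2 * (N * ∑ i ∈ Finset.range N, dist (e (m i)) (e (m (i + 1))) ^ 2) -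
        2 * (N * ∑ i ∈ Finset.range N, ‖θ (i + 1) - θ i‖ ^ 2)| ≤
        β * (2 * ‖h‖ ^ 2 + 3 * (N * ∑ i ∈ Finset.range N, ‖θ (i + 1) - θ i‖ ^ 2)) +
          (4 * (K * (4 * R) ^ 3)) / N := by
    intro N hN m θ hθ0 hp hq hm' h3 h4 h5
    have hN' : (0 : ℝ) < N := by exact_mod_cast hN
    have a1 := hc.abs_sum_dist_sq_sub_chainEnergy_le hK hN (c := fun i ↦ m i + θ i) hp h4
    have a2 := hc.abs_sum_dist_sq_sub_chainEnergy_le hK hN (c := fun i ↦ m i - θ i) hq h5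
    have a3 := hc.abs_sum_dist_sq_sub_chainEnergy_le hK hN (c := m) hm' (C := 4 * R)
      fun i hi ↦ (h3 i hi).trans (by linarith)
    have a4 := hc.abs_chainEnergy_secondDiff_le hK hm.metric_zero hN hp hq h3
    have a5 := sum_norm_sq_le θ hN
    rw [hθ0] at a5
    set S := (N : ℝ) * ∑ i ∈ Finset.range N, ‖θ (i + 1) - θ i‖ ^ 2
    have hS : 0 ≤ S := by positivity
    have hT : 0 ≤ (∑ i ∈ Finset.range N, ‖θ i‖ ^ 2) / N := by positivity
    have a6 := mul_le_mul_of_nonneg_right hcoef1 hT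
    have a7 := mul_le_mul_of_nonneg_right hcoef2 hS
    have a8 := mul_le_mul_of_nonneg_left a5 hβ.le
    rw [mul_div_assoc]
    rw [abs_le] at *
    constructor <;> linarith [a1.1, a1.2, a2.1, a2.2, a3.1, a3.2, a4.1, a4.2]
  rw [abs_le]
  constructor
  · -- lower bound: compare with the midpoints of two minimizing chains
    suffices hlow : 2 * ‖k - h‖ ^ 2 - ε * (‖h‖ ^ 2 + ‖k‖ ^ 2) ≤
        dist (e (x + h)) (e (y + k)) ^ 2 + dist (e (x - h)) (e (y - k)) ^ 2
        - 2 * dist (e x) (e y) ^ 2 by linarith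
    refine le_of_forall_nat_le_add_div (Z := 4 * (K * (4 * R) ^ 3)) fun N hN ↦ ?_
    have hN' : (0 : ℝ) < N := by exact_mod_cast hN
    obtain ⟨a, ha0, haN, ham, haB, haS⟩ := hchain _ hxp _ hyp N hN
    obtain ⟨b, hb0, hbN, hbm, hbB, hbS⟩ := hchain _ hxm _ hym N hN
    let m : ℕ → V := fun i ↦ (1 / 2 : ℝ) • (a i + b i)
    let θ : ℕ → V := fun i ↦ (1 / 2 : ℝ) • (a i - b i)
    have hmp : ∀ i, m i + θ i = a i := fun i ↦ by simp only [m, θ]; module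
    have hmm : ∀ i, m i - θ i = b i := fun i ↦ by simp only [m, θ]; module
    have hsub : Metric.ball (0 : V) (R / 2) ⊆ Metric.ball 0 R := Metric.ball_subset_ball (by linarith)
    have hθ0 : θ 0 = h := by simp only [θ, ha0, hb0]; module
    have hθN : θ N = k := by simp only [θ, haN, hbN]; module
    have hm0 : m 0 = x := by simp only [m, ha0, hb0]; module
    have hmN : m N = y := by simp only [m, haN, hbN]; module
    have hmR : ∀ i ≤ N, m i ∈ Metric.ball (0 : V) R := fun i hi ↦ by
      have := (convex_ball (0 : V) R) (hsub (ham i hi)) (hsub (hbm i hi)) (a := 1 / 2) (b := 1 / 2)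
        (by norm_num) (by norm_num) (by norm_num)
      simpa only [m, smul_add] using this
    have key := main N hN m θ hθ0 (fun i hi ↦ (hmp i).symm ▸ hsub (ham i hi))
      (fun i hi ↦ (hmm i).symm ▸ hsub (hbm i hi)) hmR
      (fun i hi ↦ by
        have h1 := haB i hi
        have h2 := hbB i hi
        have h3 : ‖m (i + 1) - m i‖ ≤ (‖a (i + 1) - a i‖ + ‖b (i + 1) - b i‖) / 2 := by
          rw [show m (i + 1) - m i = (1 / 2 : ℝ) • ((a (i + 1) - a i) + (b (i + 1) - b i)) by
            simp only [m]; module, norm_smul]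
          have := norm_add_le (a (i + 1) - a i) (b (i + 1) - b i)
          norm_num
          linarith
        have := mul_le_mul_of_nonneg_left h3 hN'.le
        linarith)
      (fun i hi ↦ by rw [hmp, hmp]; linarith [haB i hi])
      (fun i hi ↦ by rw [hmm, hmm]; linarith [hbB i hi])
    simp only [hmp, hmm] at key
    rw [haS, hbS] at key
    have h1 := dist_sq_le_mul_sum (fun i ↦ e (m i)) N
    have h2 := norm_sq_sub_le_mul_sum θ N
    simp only [hm0, hmN] at h1
    rw [hθ0, hθN] at h2
    set S := (N : ℝ) * ∑ i ∈ Finset.range N, ‖θ (i + 1) - θ i‖ ^ 2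
    have h3 := (abs_le.1 key).1
    have h4 : (2 - 3 * β) * ‖k - h‖ ^ 2 ≤ (2 - 3 * β) * S := by gcongr; linarith
    have h5 : 8 * β * (‖h‖ ^ 2 + ‖k‖ ^ 2) ≤ ε * (‖h‖ ^ 2 + ‖k‖ ^ 2) := by gcongr
    have h6 : 3 * β * ‖k - h‖ ^ 2 ≤ 3 * β * (2 * (‖h‖ ^ 2 + ‖k‖ ^ 2)) := by gcongr
    have h7 : 0 ≤ β * ‖k‖ ^ 2 := by positivity
    linarith
  · -- upper bound: shift a minimizing chain
    suffices hup : dist (e (x + h)) (e (y + k)) ^ 2 + dist (e (x - h)) (e (y - k)) ^ 2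
        - 2 * dist (e x) (e y) ^ 2 ≤ 2 * ‖k - h‖ ^ 2 + ε * (‖h‖ ^ 2 + ‖k‖ ^ 2) by linarith
    refine le_of_forall_nat_le_add_div (Z := 4 * (K * (4 * R) ^ 3)) fun N hN ↦ ?_
    have hN' : (0 : ℝ) < N := by exact_mod_cast hN
    obtain ⟨m, hm0, hmN, hmm, hmB, hmS⟩ := hchain _ hx _ hy N hN
    let θ : ℕ → V := fun i ↦ h + (i / N : ℝ) • (k - h)
    have hθ0 : θ 0 = h := by simp [θ]
    have hθN : θ N = k := by simp [θ, hN'.ne']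
    have hdθ : ∀ i, θ (i + 1) - θ i = (1 / N : ℝ) • (k - h) := fun i ↦ by
      simp only [θ]; push_cast; rw [add_sub_add_left_eq_sub, ← sub_smul]; congr 1; ring
    have hθn : ∀ i ≤ N, ‖θ i‖ < R / 2 := by
      intro i hi
      have hi' : (i : ℝ) ≤ N := by exact_mod_cast hi
      have := (convex_ball (0 : V) r) (mem_ball_zero_iff.2 hh) (mem_ball_zero_iff.2 hk)
        (a := 1 - i / N) (b := i / N) (by rw [sub_nonneg, div_le_one hN']; exact hi')
        (by positivity) (by ring)
      rw [mem_ball_zero_iff] at this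
      refine lt_of_le_of_lt (le_of_eq ?_) (this.trans_le hrR)
      congr 1; simp only [θ]; module
    have hpm : ∀ i ≤ N, m i + θ i ∈ Metric.ball (0 : V) R ∧ m i - θ i ∈ Metric.ball (0 : V) R ∧
        m i ∈ Metric.ball (0 : V) R := by
      intro i hi
      have h1 := hθn i hi
      have h2 := mem_ball_zero_iff.1 (hmm i hi)
      simp only [mem_ball_zero_iff]
      have := norm_add_le (m i) (θ i)
      have := norm_sub_le (m i) (θ i)
      refine ⟨?_, ?_, ?_⟩ <;> linarith
    have hkh' : ‖k - h‖ ≤ R := (norm_sub_le _ _).trans (by linarith)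
    have hdN : ∀ i, N * ‖θ (i + 1) - θ i‖ = ‖k - h‖ := fun i ↦ by
      rw [hdθ, norm_smul, Real.norm_of_nonneg (by positivity)]; field_simp
    have key := main N hN m θ hθ0 (fun i hi ↦ (hpm i hi).1) (fun i hi ↦ (hpm i hi).2.1)
      (fun i hi ↦ (hpm i hi).2.2) hmB
      (fun i hi ↦ by
        rw [add_sub_add_comm]
        have := mul_le_mul_of_nonneg_left (norm_add_le (m (i + 1) - m i) (θ (i + 1) - θ i)) hN'.le
        linarith [hmB i hi, hdN i])
      (fun i hi ↦ by
        rw [sub_sub_sub_comm]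
        have := mul_le_mul_of_nonneg_left (norm_sub_le (m (i + 1) - m i) (θ (i + 1) - θ i)) hN'.le
        linarith [hmB i hi, hdN i])
    have hS : (N : ℝ) * ∑ i ∈ Finset.range N, ‖θ (i + 1) - θ i‖ ^ 2 = ‖k - h‖ ^ 2 := by
      simp_rw [hdθ, norm_smul, Real.norm_of_nonneg (by positivity : (0 : ℝ) ≤ 1 / N)]
      rw [Finset.sum_const, Finset.card_range, nsmul_eq_mul]
      field_simp
    rw [hmS, hS] at key
    have h1 := dist_sq_le_mul_sum (fun i ↦ e (m i + θ i)) N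
    have h2 := dist_sq_le_mul_sum (fun i ↦ e (m i - θ i)) N
    simp only [hm0, hmN, hθ0, hθN] at h1 h2
    have h3 := (abs_le.1 key).2
    have h5 : 8 * β * (‖h‖ ^ 2 + ‖k‖ ^ 2) ≤ ε * (‖h‖ ^ 2 + ‖k‖ ^ 2) := by gcongr
    have h6 : 3 * β * ‖k - h‖ ^ 2 ≤ 3 * β * (2 * (‖h‖ ^ 2 + ‖k‖ ^ 2)) := by gcongr
    have h7 : 0 ≤ β * ‖k‖ ^ 2 := by positivity
    linarith

end SecondDiff

/-! ### From second differences to mixed differences. -/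

section FourPoint

variable {W : Type*} [NormedAddCommGroup W] [NormedSpace ℝ W]

/-- The four points are the corners of a parallelogram. Subtracting the second differences at its
centre along the two half-diagonals cancels the value at the centre. -/
theorem abs_fourPoint_le_sq {G : W → ℝ} {S : Set W} {ε : ℝ} (hε : 0 ≤ ε)
    (hG : ∀ p η, p + η ∈ S → p - η ∈ S → |G (p + η) + G (p - η) - 2 * G p| ≤ ε * ‖η‖ ^ 2)
    {p η ζ : W} (h0 : p ∈ S) (h1 : p + η ∈ S) (h2 : p + ζ ∈ S) (h3 : p + η + ζ ∈ S) :
    |G (p + η + ζ) + G p - G (p + η) - G (p + ζ)| ≤ ε / 2 * (‖η‖ + ‖ζ‖) ^ 2 := by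
  set c := p + (1 / 2 : ℝ) • (η + ζ)
  set a := (1 / 2 : ℝ) • (η + ζ)
  set b := (1 / 2 : ℝ) • (η - ζ)
  have e1 : p + η + ζ = c + a := by simp only [c, a]; module
  have e2 : p = c - a := by simp only [c, a]; module
  have e3 : p + η = c + b := by simp only [c, b]; module
  have e4 : p + ζ = c - b := by simp only [c, b]; module
  have g1 := hG c a (e1 ▸ h3) (e2 ▸ h0)
  have g2 := hG c b (e3 ▸ h1) (e4 ▸ h2)
  rw [← e1, ← e2] at g1
  rw [← e3, ← e4] at g2
  have na : ‖a‖ ≤ (‖η‖ + ‖ζ‖) / 2 := by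
    simp only [a, norm_smul]; norm_num; linarith [norm_add_le η ζ]
  have nb : ‖b‖ ≤ (‖η‖ + ‖ζ‖) / 2 := by
    simp only [b, norm_smul]; norm_num; linarith [norm_sub_le η ζ]
  have ma : ε * ‖a‖ ^ 2 ≤ ε * ((‖η‖ + ‖ζ‖) / 2) ^ 2 := by gcongr
  have mb : ε * ‖b‖ ^ 2 ≤ ε * ((‖η‖ + ‖ζ‖) / 2) ^ 2 := by gcongr
  rw [abs_le] at *
  constructor <;> linarith [g1.1, g1.2, g2.1, g2.2]

/-- A function with small second differences has small mixed differences. -/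
theorem abs_fourPoint_le {G : W → ℝ} {S : Set W} {ε : ℝ} (hε : 0 ≤ ε) (hS : Convex ℝ S)
    (hG : ∀ p η, p + η ∈ S → p - η ∈ S → |G (p + η) + G (p - η) - 2 * G p| ≤ ε * ‖η‖ ^ 2)
    {p η ζ : W} (h0 : p ∈ S) (h1 : p + η ∈ S) (h2 : p + ζ ∈ S) (h3 : p + η + ζ ∈ S) :
    |G (p + η + ζ) + G p - G (p + η) - G (p + ζ)| ≤ 4 * ε * ‖η‖ * ‖ζ‖ := by
  wlog hle : ‖η‖ ≤ ‖ζ‖ generalizing η ζ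
  · have := this h2 h1 (by rwa [add_right_comm]) (le_of_not_ge hle)
    rw [add_right_comm p ζ η] at this
    convert this using 1
    · congr 1; ring
    · ring
  rcases eq_or_ne η 0 with rfl | hη
  · simp
  have hη' : 0 < ‖η‖ := norm_pos_iff.2 hη
  -- Cutting the longer side ζ into n pieces no longer than ‖η‖ gives n parallelograms, each with
  -- error 2ε‖η‖². As n ≤ 2‖ζ‖/‖η‖, the total is bilinear in the side lengths rather than quadratic
  -- in the longer one.
  set n := ⌈‖ζ‖ / ‖η‖⌉₊
  have hone : 1 ≤ ‖ζ‖ / ‖η‖ := (one_le_div hη').2 hle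
  have hn : ‖ζ‖ / ‖η‖ ≤ n := Nat.le_ceil _
  have hn2 : (n : ℝ) ≤ 2 * (‖ζ‖ / ‖η‖) := by
    have := (Nat.ceil_lt_add_one (by positivity : 0 ≤ ‖ζ‖ / ‖η‖)).le
    linarith
  have hn0 : (0 : ℝ) < n := by linarith
  let F : ℕ → ℝ := fun i ↦ G (p + (i / n : ℝ) • ζ + η) - G (p + (i / n : ℝ) • ζ)
  have hmem : ∀ i ≤ n, p + (i / n : ℝ) • ζ ∈ S ∧ p + (i / n : ℝ) • ζ + η ∈ S := by
    intro i hi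
    have hi' : (i / n : ℝ) ≤ 1 := (div_le_one hn0).2 (by exact_mod_cast hi)
    constructor
    · have := hS h0 h2 (a := 1 - i / n) (b := i / n) (by linarith) (by positivity) (by ring)
      convert this using 1; module
    · have := hS h1 h3 (a := 1 - i / n) (b := i / n) (by linarith) (by positivity) (by ring)
      convert this using 1; module
  have hstep : ∀ i ∈ Finset.range n, |F (i + 1) - F i| ≤ 2 * ε * ‖η‖ ^ 2 := by
    intro i hi
    have hi := Finset.mem_range.1 hi
    have e1 : p + ((i + 1 : ℕ) / n : ℝ) • ζ = p + (i / n : ℝ) • ζ + (1 / n : ℝ) • ζ := by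
      push_cast; rw [add_div, add_smul, add_assoc]
    have e2 : p + ((i + 1 : ℕ) / n : ℝ) • ζ + η = p + (i / n : ℝ) • ζ + η + (1 / n : ℝ) • ζ := by
      rw [e1]; abel
    have := abs_fourPoint_le_sq hε hG (p := p + (i / n : ℝ) • ζ) (η := η) (ζ := (1 / n : ℝ) • ζ)
      (hmem i hi.le).1 (hmem i hi.le).2 (e1 ▸ (hmem (i + 1) hi).1) (e2 ▸ (hmem (i + 1) hi).2)
    simp only [F]
    rw [e2, e1]
    have hz : ‖(1 / n : ℝ) • ζ‖ ≤ ‖η‖ := by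
      rw [norm_smul, Real.norm_of_nonneg (by positivity), one_div, inv_mul_le_iff₀ hn0]
      rwa [div_le_iff₀ hη'] at hn
    calc _ = _ := by congr 1; ring
      _ ≤ _ := this
      _ ≤ ε / 2 * (‖η‖ + ‖η‖) ^ 2 := by gcongr
      _ = _ := by ring
  have htel := Finset.sum_range_sub F n
  have hF : F n - F 0 = G (p + η + ζ) + G p - G (p + η) - G (p + ζ) := by
    simp only [F, div_self hn0.ne', Nat.cast_zero, zero_div, zero_smul, add_zero, one_smul,
      add_right_comm p ζ η]
    ring
  rw [← hF, ← htel]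
  calc _ ≤ ∑ i ∈ Finset.range n, 2 * ε * ‖η‖ ^ 2 :=
        (Finset.abs_sum_le_sum_abs _ _).trans (Finset.sum_le_sum hstep)
    _ = n * (2 * ε * ‖η‖ ^ 2) := by rw [Finset.sum_const, Finset.card_range, nsmul_eq_mul]
    _ ≤ 2 * (‖ζ‖ / ‖η‖) * (2 * ε * ‖η‖ ^ 2) := by gcongr
    _ = _ := by field_simp; ring

end FourPoint

/-! ### Stability of minimizing geodesics under change of end points. -/

section Between

variable {V : Type*} [NormedAddCommGroup V] [InnerProductSpace ℝ V] {M : Type*} [MetricSpace M]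
  {e : V → M} {g : V → V →L[ℝ] V →L[ℝ] ℝ}

/-- `e m` lies between `e x` and `e y`, and divides the distance in the ratio `l : 1 - l`. -/
def IsBetween (e : V → M) (x y : V) (l : ℝ) (m : V) : Prop :=
  dist (e x) (e m) = l * dist (e x) (e y) ∧ dist (e m) (e y) = (1 - l) * dist (e x) (e y)

/-- The deviation of `m` from the point which divides the segment `[x, y]` in the ratio
`l : 1 - l`. -/
def deviation (x y : V) (l : ℝ) (m : V) : V := m - ((1 - l) • x + l • y)

theorem isBetween_self (x : V) (l : ℝ) : IsBetween e x x l x := by simp [IsBetween]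

/-- With d the distance of the ends, (1 - l)a² + l b² = l(1 - l)(a + b)² + ((1 - l)a - l b)² for a,
b the distances to z. By the triangle inequality this is at least l(1 - l)d², the value at m. This
variational property is all that is used of geodesics. -/
theorem IsBetween.le_weighted_sum {x y m : V} {l : ℝ} (h : IsBetween e x y l m)
    (hl : l ∈ Icc (0 : ℝ) 1) (z : V) :
    (1 - l) * dist (e x) (e m) ^ 2 + l * dist (e m) (e y) ^ 2 ≤
      (1 - l) * dist (e x) (e z) ^ 2 + l * dist (e z) (e y) ^ 2 := by
  rw [h.1, h.2]
  have ht := dist_triangle (e x) (e z) (e y)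
  set a := dist (e x) (e z)
  set b := dist (e z) (e y)
  have h1 : dist (e x) (e y) ^ 2 ≤ (a + b) ^ 2 := by gcongr
  have h2 : 0 ≤ l * (1 - l) := mul_nonneg hl.1 (by linarith [hl.2])
  nlinarith [mul_le_mul_of_nonneg_left h1 h2, sq_nonneg ((1 - l) * a - l * b)]

/-- In the flat case the gradient at m of the weighted sum of squares is twice the deviation, so
minimality can be played against the deviation. -/
theorem weighted_norm_sq_sub (x y m h : V) (l : ℝ) :
    (1 - l) * (‖m + h - x‖ ^ 2 - ‖m - x‖ ^ 2) + l * (‖y - (m + h)‖ ^ 2 - ‖y - m‖ ^ 2) =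
      2 * inner ℝ h (deviation x y l m) + ‖h‖ ^ 2 := by
  have e1 : ‖m + h - x‖ ^ 2 = ‖m - x‖ ^ 2 + 2 * inner ℝ h (m - x) + ‖h‖ ^ 2 := by
    rw [show m + h - x = (m - x) + h by abel, norm_add_sq_real, real_inner_comm]
  have e2 : ‖y - (m + h)‖ ^ 2 = ‖y - m‖ ^ 2 + 2 * inner ℝ h (m - y) + ‖h‖ ^ 2 := by
    rw [show y - (m + h) = (y - m) - h by abel, norm_sub_sq_real, real_inner_comm,
      ← neg_sub m y, inner_neg_right]
    ring
  rw [e1, e2, deviation, show m - ((1 - l) • x + l • y) = (1 - l) • (m - x) + l • (m - y) by module,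
    inner_add_right, inner_smul_right, inner_smul_right]
  ring

/-- Stability of the points of minimizing geodesics with respect to the end points. -/
theorem IsNormalModel.exists_norm_deviation_sub_le (hm : IsNormalModel e g)
    (hgeo : ∀ x y : M, ∃ γ : ℝ → M, IsMinimizingGeodesic γ x y) {δ : ℝ} (hδ : 0 < δ) :
    ∃ R > 0, ∀ x ∈ Metric.ball (0 : V) R, ∀ y ∈ Metric.ball (0 : V) R,
      ∀ m ∈ Metric.ball (0 : V) R, ∀ x' ∈ Metric.ball (0 : V) R, ∀ y' ∈ Metric.ball (0 : V) R,
      ∀ m' ∈ Metric.ball (0 : V) R, ∀ l ∈ Icc (0 : ℝ) 1,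
      IsBetween e x y l m → IsBetween e x' y' l m' →
      ‖deviation x y l m - deviation x' y' l m'‖ ≤
        δ * ((1 - l) * ‖x - x'‖ + l * ‖y - y'‖) := by
  obtain ⟨κ, hκ, hκδ, hκ3⟩ : ∃ κ > 0, 4 * κ ≤ δ ∧ 3 * κ ≤ 1 :=
    ⟨min (δ / 4) (1 / 3), by positivity, by linarith [min_le_left (δ / 4) (1 / 3)],
      by linarith [min_le_right (δ / 4) (1 / 3)]⟩
  obtain ⟨R, hR, hsd⟩ := hm.exists_abs_secondDiff_dist_sq_le hgeo (ε := κ / 8) (by positivity)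
  -- G is the non-flat part of the squared distance. Its second differences are small, hence so are
  -- its mixed differences.
  let G : V × V → ℝ := fun q ↦ dist (e q.1) (e q.2) ^ 2 - ‖q.2 - q.1‖ ^ 2
  let S : Set (V × V) := Metric.ball (0 : V) R ×ˢ Metric.ball (0 : V) R
  have hG : ∀ p η, p + η ∈ S → p - η ∈ S →
      |G (p + η) + G (p - η) - 2 * G p| ≤ κ / 4 * ‖η‖ ^ 2 := by
    intro p η hp hq
    have := hsd p.1 p.2 η.1 η.2 hp.1 hq.1 hp.2 hq.2
    have hpar := parallelogram_law_with_norm ℝ (p.2 - p.1) (η.2 - η.1)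
    have h1 : ‖η.1‖ ^ 2 ≤ ‖η‖ ^ 2 := by gcongr; exact norm_fst_le η
    have h2 : ‖η.2‖ ^ 2 ≤ ‖η‖ ^ 2 := by gcongr; exact norm_snd_le η
    have e1 : G (p + η) + G (p - η) - 2 * G p =
        dist (e (p.1 + η.1)) (e (p.2 + η.2)) ^ 2 + dist (e (p.1 - η.1)) (e (p.2 - η.2)) ^ 2
        - 2 * dist (e p.1) (e p.2) ^ 2 - 2 * ‖η.2 - η.1‖ ^ 2 := by
      simp only [G, Prod.fst_add, Prod.snd_add, Prod.fst_sub, Prod.snd_sub, add_sub_add_comm,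
        sub_sub_sub_comm p.2]
      linear_combination -hpar
    rw [e1]
    refine this.trans ?_
    nlinarith
  have h4 : ∀ p η ζ : V × V, p ∈ S → p + η ∈ S → p + ζ ∈ S → p + η + ζ ∈ S →
      |G (p + η + ζ) + G p - G (p + η) - G (p + ζ)| ≤ κ * ‖η‖ * ‖ζ‖ := by
    intro p η ζ h0 h1 h2 h3
    have := abs_fourPoint_le (by positivity) ((convex_ball _ _).prod (convex_ball _ _)) hG h0 h1 h2 h3
    linarith
  refine ⟨R / 3, by positivity, fun x hx y hy m hmm x' hx' y' hy' m' hmm' l hl hb hb' ↦ ?_⟩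
  have hl0 : 0 ≤ l := hl.1
  have hl1 : 0 ≤ 1 - l := by linarith [hl.2]
  set w := deviation x y l m - deviation x' y' l m' with hw
  have hcomb : ∀ {p q : V}, p ∈ Metric.ball (0 : V) (R / 3) → q ∈ Metric.ball (0 : V) (R / 3) →
      ‖(1 - l) • p + l • q‖ < R / 3 := fun hp hq ↦
    mem_ball_zero_iff.1 ((convex_ball (0 : V) (R / 3)) hp hq hl1 hl0 (by ring))
  have hwR : ‖w‖ < 4 * (R / 3) := by
    have h1 := hcomb hx hy
    have h2 := hcomb hx' hy'
    have h3 := mem_ball_zero_iff.1 hmm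
    have h4 := mem_ball_zero_iff.1 hmm'
    simp only [hw, deviation]
    refine (norm_sub_le _ _).trans_lt ?_
    linarith [norm_sub_le m ((1 - l) • x + l • y), norm_sub_le m' ((1 - l) • x' + l • y')]
  -- Minimality of m is tested at m + h and that of m' at m' - h. The flat parts add up to 2⟨h, w⟩ +
  -- 2‖h‖², which this h makes equal to -‖w‖²/2; so ‖w‖²/2 is bounded by weighted mixed differences
  -- of G with h as one side.
  set h := (-(1 / 2) : ℝ) • w with hh
  have hhn : ‖h‖ = ‖w‖ / 2 := by rw [hh, norm_smul]; norm_num; ring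
  have hsub : ∀ {p : V}, p ∈ Metric.ball (0 : V) (R / 3) → p ∈ Metric.ball (0 : V) R := fun hp ↦
    Metric.ball_subset_ball (by linarith) hp
  have hmh : m + h ∈ Metric.ball (0 : V) R := by
    rw [mem_ball_zero_iff] at *
    linarith [norm_add_le m h]
  have hmh' : m' - h ∈ Metric.ball (0 : V) R := by
    rw [mem_ball_zero_iff] at *
    linarith [norm_sub_le m' h]
  have f1 := hb.le_weighted_sum hl (m + h)
  have f2 := hb'.le_weighted_sum hl (m' - h)
  have i1 := weighted_norm_sq_sub x y m h l
  have i2 := weighted_norm_sq_sub x' y' m' (-h) l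
  rw [← sub_eq_add_neg, inner_neg_left, norm_neg] at i2
  have g1 := h4 (x', m' - h) (0, h) (x - x', m - m' + h) ⟨hsub hx', hmh'⟩
    ⟨by simpa using hsub hx', by simpa using hsub hmm'⟩
    ⟨by simpa using hsub hx, by
      simpa using hsub hmm⟩ ⟨by simpa using hsub hx, by
      convert hmh using 1; simp only [Prod.snd_add]; abel⟩
  have g2 := h4 (m' - h, y') (h, 0) (m - m' + h, y - y') ⟨hmh', hsub hy'⟩
    ⟨by simpa using hsub hmm', by simpa using hsub hy'⟩
    ⟨by simpa using hsub hmm, by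
      simpa using hsub hy⟩ ⟨by
      convert hmh using 1; simp only [Prod.fst_add]; abel, by simpa using hsub hy⟩
  have n1 : ‖((0 : V), h)‖ = ‖h‖ := by simp [Prod.norm_def]
  have n2 : ‖(h, (0 : V))‖ = ‖h‖ := by simp [Prod.norm_def]
  have n3 : ‖(x - x', m - m' + h)‖ ≤ ‖x - x'‖ + (‖m - m'‖ + ‖h‖) := by
    rw [Prod.norm_def]
    refine (max_le_add_of_nonneg (norm_nonneg _) (norm_nonneg _)).trans ?_
    gcongr; exact norm_add_le _ _
  have n4 : ‖(m - m' + h, y - y')‖ ≤ ‖y - y'‖ + (‖m - m'‖ + ‖h‖) := by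
    rw [Prod.norm_def]
    refine (max_le_add_of_nonneg (norm_nonneg _) (norm_nonneg _)).trans ?_
    rw [add_comm]
    gcongr; exact norm_add_le _ _
  rw [n1] at g1
  rw [n2] at g2
  have g1' := (le_abs_self _).trans (g1.trans (mul_le_mul_of_nonneg_left n3 (by positivity)))
  have g2' := (le_abs_self _).trans (g2.trans (mul_le_mul_of_nonneg_left n4 (by positivity)))
  simp only [G, Prod.mk_add_mk, add_zero, sub_add_cancel, add_sub_cancel,
    sub_add_add_cancel] at g1' g2'
  rw [show m' + (m - m' + h) = m + h by abel] at g1' g2'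
  have hinner : inner ℝ h (deviation x y l m) - inner ℝ h (deviation x' y' l m') =
      -(1 / 2) * ‖w‖ ^ 2 := by
    rw [← inner_sub_right, ← hw, hh, real_inner_smul_left, real_inner_self_eq_norm_sq]
  have k1 := mul_le_mul_of_nonneg_left g1' hl1
  have k2 := mul_le_mul_of_nonneg_left g2' hl0
  set s := (1 - l) * ‖x - x'‖ + l * ‖y - y'‖ with hs
  have hs0 : 0 ≤ s := by positivity
  have hq : ‖m - m'‖ ≤ ‖w‖ + s := by
    have : m - m' = w + ((1 - l) • (x - x') + l • (y - y')) := by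
      simp only [hw, deviation]; module
    rw [this]
    refine (norm_add_le _ _).trans ?_
    gcongr
    refine (norm_add_le _ _).trans ?_
    rw [norm_smul, norm_smul, Real.norm_of_nonneg hl0, Real.norm_of_nonneg hl1]
  have hfin : ‖w‖ ^ 2 / 2 ≤ κ * (‖w‖ / 2) * (s + ‖m - m'‖ + ‖w‖ / 2) := by
    rw [hhn] at k1 k2 i1 i2
    have e1 : (1 - l) * (κ * (‖w‖ / 2) * (‖x - x'‖ + (‖m - m'‖ + ‖w‖ / 2))) +
        l * (κ * (‖w‖ / 2) * (‖y - y'‖ + (‖m - m'‖ + ‖w‖ / 2))) =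
        κ * (‖w‖ / 2) * (s + ‖m - m'‖ + ‖w‖ / 2) := by rw [hs]; ring
    linarith [k1, k2, i1, i2, f1, f2, hinner]
  -- Dividing by ‖w‖/2 leaves ‖w‖ ≤ 2κs + (3κ/2)‖w‖, and 3κ ≤ 1 absorbs the last term, giving ‖w‖ ≤
  -- 4κs.
  rcases eq_or_lt_of_le (norm_nonneg w) with hw0 | hw0
  · rw [← hw0]; positivity
  · have : ‖w‖ ≤ κ * (s + ‖m - m'‖ + ‖w‖ / 2) := by
      refine le_of_mul_le_mul_left ?_ (half_pos hw0)
      linarith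
    have h5 : κ * (s + ‖m - m'‖ + ‖w‖ / 2) ≤ κ * (2 * s + 3 / 2 * ‖w‖) :=
      mul_le_mul_of_nonneg_left (by linarith) hκ.le
    have h6 : κ * (3 / 2 * ‖w‖) ≤ 1 / 2 * ‖w‖ := by
      have := mul_le_mul_of_nonneg_right hκ3 (half_pos hw0).le
      linarith
    have h7 : 4 * κ * s ≤ δ * s := by gcongr
    linarith

end Between

/-- A small Lipschitz perturbation of the identity is surjective, locally. -/
theorem exists_eq_of_norm_sub_sub_le {V : Type*} [NormedAddCommGroup V] [NormedSpace ℝ V]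
    [CompleteSpace V] {f : V → V} {b y : V} {s c : ℝ} (hs : 0 ≤ s) (hc0 : 0 ≤ c) (hc : c < 1)
    (hf : ∀ x ∈ Metric.closedBall b s, ∀ x' ∈ Metric.closedBall b s,
      ‖f x - f x' - (x - x')‖ ≤ c * ‖x - x'‖)
    (hy : ‖y - f b‖ ≤ (1 - c) * s) : ∃ x ∈ Metric.closedBall b s, f x = y := by
  have h : ApproximatesLinearOn f (ContinuousLinearMap.id ℝ V) (Metric.closedBall b s) ⟨c, hc0⟩ :=
    fun x hx x' hx' ↦ hf x hx x' hx'
  let inv : (ContinuousLinearMap.id ℝ V).NonlinearRightInverse := ⟨id, 1, by simp, by simp⟩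
  have := h.surjOn_closedBall_of_nonlinearRightInverse inv hs subset_rfl
  refine this ?_
  rw [mem_closedBall_iff_norm]
  refine hy.trans_eq ?_
  simp only [inv, NNReal.coe_one, inv_one]
  rfl

/-! ### Selections of geodesics close to segments. -/

section Selection

variable {V : Type*} [NormedAddCommGroup V] [InnerProductSpace ℝ V] {M : Type*} [MetricSpace M]
  {e : V → M} {g : V → V →L[ℝ] V →L[ℝ] ℝ}

theorem deviation_self (x : V) (l : ℝ) : deviation x x l x = 0 := by
  simp only [deviation]; module

theorem deviation_add (x y : V) (l : ℝ) (m : V) :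
    deviation x y l m + ((1 - l) • x + l • y) = m := by simp [deviation]

/-- `P x y` is, in the coordinates given by `e`, a minimizing geodesic from `x` to `y` which is
close to the segment `[x, y]`, together with its variations. -/
structure IsGeodesicSelection (e : V → M) (δ r R : ℝ) (P : V → V → ℝ → V) : Prop where
  mem : ∀ x ∈ Metric.ball (0 : V) r, ∀ y ∈ Metric.ball (0 : V) r, ∀ l ∈ Icc (0 : ℝ) 1,
    P x y l ∈ Metric.ball (0 : V) R
  geodesic : ∀ x ∈ Metric.ball (0 : V) r, ∀ y ∈ Metric.ball (0 : V) r, ∃ γ : ℝ → M,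
    IsMinimizingGeodesic γ (e x) (e y) ∧ ∀ l ∈ Icc (0 : ℝ) 1, e (P x y l) = γ l
  norm_deviation_le : ∀ x ∈ Metric.ball (0 : V) r, ∀ y ∈ Metric.ball (0 : V) r,
    ∀ l ∈ Icc (0 : ℝ) 1, ‖deviation x y l (P x y l)‖ ≤ δ * (l * (1 - l) * ‖x - y‖)
  norm_deviation_sub_le : ∀ x ∈ Metric.ball (0 : V) r, ∀ y ∈ Metric.ball (0 : V) r,
    ∀ x' ∈ Metric.ball (0 : V) r, ∀ y' ∈ Metric.ball (0 : V) r, ∀ l ∈ Icc (0 : ℝ) 1,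
    ‖deviation x y l (P x y l) - deviation x' y' l (P x' y' l)‖ ≤
      δ * ((1 - l) * ‖x - x'‖ + l * ‖y - y'‖)
  norm_deviation_time_le : ∀ x ∈ Metric.ball (0 : V) r, ∀ y ∈ Metric.ball (0 : V) r,
    ∀ l ∈ Icc (0 : ℝ) 1, ∀ l' ∈ Icc (0 : ℝ) 1,
    ‖deviation x y l (P x y l) - deviation x y l' (P x y l')‖ ≤ δ * (|l - l'| * ‖x - y‖)

theorem IsMinimizingGeodesic.isBetween {γ : ℝ → M} {x y m : V} {l : ℝ}
    (h : IsMinimizingGeodesic γ (e x) (e y)) (hl : l ∈ Icc (0 : ℝ) 1) (hm : e m = γ l) :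
    IsBetween e x y l m := ⟨hm ▸ h.dist_left hl, hm ▸ h.dist_right hl⟩

/-- Stability against the constant geodesic at m, whose deviation is zero. The distances of m to x
and y are at most 3l‖x - y‖ and 3(1 - l)‖x - y‖, which produces the factor l(1 - l). -/
theorem IsNormalModel.exists_norm_deviation_le (hm : IsNormalModel e g)
    (hgeo : ∀ x y : M, ∃ γ : ℝ → M, IsMinimizingGeodesic γ x y) {δ : ℝ} (hδ : 0 < δ) :
    ∃ R > 0, ∀ x ∈ Metric.ball (0 : V) R, ∀ y ∈ Metric.ball (0 : V) R,
      ∀ m ∈ Metric.ball (0 : V) R, ∀ l ∈ Icc (0 : ℝ) 1, IsBetween e x y l m →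
      ‖deviation x y l m‖ ≤ δ * (l * (1 - l) * ‖x - y‖) := by
  obtain ⟨R₁, hR₁, hs⟩ := hm.exists_norm_deviation_sub_le hgeo (δ := δ / 6) (by positivity)
  obtain ⟨R₂, hR₂, hd⟩ := hm.exists_dist_bounds (ε := 1 / 2) (by norm_num) (by norm_num)
  refine ⟨min R₁ R₂, by positivity, fun x hx y hy m hmm l hl hb ↦ ?_⟩
  have h1 : ∀ {p}, p ∈ Metric.ball (0 : V) (min R₁ R₂) → p ∈ Metric.ball (0 : V) R₁ :=
    fun hp ↦ Metric.ball_subset_ball (min_le_left _ _) hp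
  have h2 : ∀ {p}, p ∈ Metric.ball (0 : V) (min R₁ R₂) → p ∈ Metric.ball (0 : V) R₂ :=
    fun hp ↦ Metric.ball_subset_ball (min_le_right _ _) hp
  have hl0 : 0 ≤ l := hl.1
  have hl1 : 0 ≤ 1 - l := by linarith [hl.2]
  have := hs x (h1 hx) y (h1 hy) m (h1 hmm) m (h1 hmm) m (h1 hmm) m (h1 hmm) l hl hb
    (isBetween_self m l)
  rw [deviation_self, sub_zero] at this
  refine this.trans ?_
  have a1 := (hd x (h2 hx) m (h2 hmm)).1
  have a2 := (hd m (h2 hmm) y (h2 hy)).1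
  have a3 := (hd x (h2 hx) y (h2 hy)).2
  rw [hb.1] at a1
  rw [hb.2, norm_sub_rev] at a2
  have b1 : ‖x - m‖ ≤ 3 * (l * ‖x - y‖) := by
    have := mul_le_mul_of_nonneg_left a3 hl0; linarith
  have b2 : ‖y - m‖ ≤ 3 * ((1 - l) * ‖x - y‖) := by
    have := mul_le_mul_of_nonneg_left a3 hl1; linarith
  calc _ ≤ δ / 6 * ((1 - l) * (3 * (l * ‖x - y‖)) + l * (3 * ((1 - l) * ‖x - y‖))) := by gcongr
    _ = _ := by ring

/-- A geodesic cut at parameter l' is again a geodesic, so bounds on deviations at a fixed time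
become bounds on their variation in time. -/
theorem deviation_eq_add_smul (x y m m' : V) {l l' : ℝ} (hl' : l' ≠ 0) :
    deviation x y l m = deviation x m' (l / l') m + (l / l') • deviation x y l' m' := by
  simp only [deviation]
  have : l = l / l' * l' := by field_simp
  nth_rw 1 [this]; nth_rw 2 [this]
  module

/-- An arbitrary choice of minimizing geodesics will do: the stability estimates hold for all of
them, so they give the Lipschitz bounds whatever the choice. -/
theorem IsNormalModel.exists_isGeodesicSelection (hm : IsNormalModel e g)
    (hgeo : ∀ x y : M, ∃ γ : ℝ → M, IsMinimizingGeodesic γ x y) {δ R₀ : ℝ} (hδ : 0 < δ)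
    (hR₀ : 0 < R₀) : ∃ r > 0, r ≤ R₀ ∧ ∃ P, IsGeodesicSelection e δ r R₀ P := by
  obtain ⟨R₁, hR₁, hs⟩ := hm.exists_norm_deviation_sub_le hgeo hδ
  obtain ⟨R₂, hR₂, hd⟩ := hm.exists_dist_bounds (ε := 1 / 2) (by norm_num) (by norm_num)
  obtain ⟨R₃, hR₃, hv⟩ := hm.exists_norm_deviation_le hgeo (δ := δ / 4) (by positivity)
  set R := min (min R₀ R₁) (min R₂ R₃)
  have hR : 0 < R := by positivity
  have s0 : ∀ {p}, p ∈ Metric.ball (0 : V) R → p ∈ Metric.ball (0 : V) R₀ := fun hp ↦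
    Metric.ball_subset_ball ((min_le_left _ _).trans (min_le_left _ _)) hp
  have s1 : ∀ {p}, p ∈ Metric.ball (0 : V) R → p ∈ Metric.ball (0 : V) R₁ := fun hp ↦
    Metric.ball_subset_ball ((min_le_left _ _).trans (min_le_right _ _)) hp
  have s2 : ∀ {p}, p ∈ Metric.ball (0 : V) R → p ∈ Metric.ball (0 : V) R₂ := fun hp ↦
    Metric.ball_subset_ball ((min_le_right _ _).trans (min_le_left _ _)) hp
  have s3 : ∀ {p}, p ∈ Metric.ball (0 : V) R → p ∈ Metric.ball (0 : V) R₃ := fun hp ↦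
    Metric.ball_subset_ball ((min_le_right _ _).trans (min_le_right _ _)) hp
  obtain ⟨r, hr, hrR, hlift⟩ := hm.exists_lift hR
  have hex : ∀ x y : V, ∃ a : ℝ → V, x ∈ Metric.ball (0 : V) r → y ∈ Metric.ball (0 : V) r →
      ∃ γ, IsMinimizingGeodesic γ (e x) (e y) ∧
        ∀ t ∈ Icc (0 : ℝ) 1, a t ∈ Metric.ball (0 : V) R ∧ e (a t) = γ t := by
    intro x y
    by_cases hxy : x ∈ Metric.ball (0 : V) r ∧ y ∈ Metric.ball (0 : V) r
    · obtain ⟨γ, hγ⟩ := hgeo (e x) (e y)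
      obtain ⟨a, ha, -⟩ := hlift x hxy.1 y hxy.2 γ hγ
      exact ⟨a, fun _ _ ↦ ⟨γ, hγ, ha⟩⟩
    · exact ⟨0, fun h1 h2 ↦ absurd ⟨h1, h2⟩ hxy⟩
  choose P hP using hex
  have sr : ∀ {p}, p ∈ Metric.ball (0 : V) r → p ∈ Metric.ball (0 : V) R := fun hp ↦
    Metric.ball_subset_ball hrR hp
  have hbt : ∀ x ∈ Metric.ball (0 : V) r, ∀ y ∈ Metric.ball (0 : V) r, ∀ l ∈ Icc (0 : ℝ) 1,
      IsBetween e x y l (P x y l) ∧ P x y l ∈ Metric.ball (0 : V) R := by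
    intro x hx y hy l hl
    obtain ⟨γ, hγ, ha⟩ := hP x y hx hy
    exact ⟨hγ.isBetween hl (ha l hl).2, (ha l hl).1⟩
  have hdev : ∀ x ∈ Metric.ball (0 : V) r, ∀ y ∈ Metric.ball (0 : V) r, ∀ l ∈ Icc (0 : ℝ) 1,
      ‖deviation x y l (P x y l)‖ ≤ δ / 4 * (l * (1 - l) * ‖x - y‖) := by
    intro x hx y hy l hl
    obtain ⟨hb, hmem⟩ := hbt x hx y hy l hl
    exact hv x (s3 (sr hx)) y (s3 (sr hy)) _ (s3 hmem) l hl hb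
  refine ⟨r, hr, hrR.trans ((min_le_left _ _).trans (min_le_left _ _)), P, ?_, ?_, ?_, ?_, ?_⟩
  · exact fun x hx y hy l hl ↦ s0 (hbt x hx y hy l hl).2
  · intro x hx y hy
    obtain ⟨γ, hγ, ha⟩ := hP x y hx hy
    exact ⟨γ, hγ, fun l hl ↦ (ha l hl).2⟩
  · intro x hx y hy l hl
    refine (hdev x hx y hy l hl).trans ?_
    have : 0 ≤ l * (1 - l) := mul_nonneg hl.1 (by linarith [hl.2])
    gcongr
    linarith
  · intro x hx y hy x' hx' y' hy' l hl
    obtain ⟨hb, hmem⟩ := hbt x hx y hy l hl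
    obtain ⟨hb', hmem'⟩ := hbt x' hx' y' hy' l hl
    exact hs _ (s1 (sr hx)) _ (s1 (sr hy)) _ (s1 hmem) _ (s1 (sr hx')) _ (s1 (sr hy')) _ (s1 hmem')
      l hl hb hb'
  · intro x hx y hy l hl l' hl'
    wlog hle : l < l' generalizing l l'
    · rcases (not_lt.1 hle).eq_or_lt with rfl | hlt
      · simp
      · have := this l' hl' l hl hlt
        rwa [norm_sub_rev, abs_sub_comm] at this
    have hl'0 : 0 < l' := hl.1.trans_lt hle
    obtain ⟨γ, hγ, ha⟩ := hP x y hx hy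
    set m := P x y l
    set m' := P x y l'
    have hb := hγ.isBetween hl (ha l hl).2
    have hb' := hγ.isBetween hl' (ha l' hl').2
    have hmm' := hγ.2.2 l hl l' hl'
    rw [← (ha l hl).2, ← (ha l' hl').2, abs_sub_comm, abs_of_pos (by linarith)] at hmm'
    have hI : l / l' ∈ Icc (0 : ℝ) 1 := ⟨div_nonneg hl.1 hl'0.le, (div_le_one hl'0).2 hle.le⟩
    have hb2 : IsBetween e x m' (l / l') m := by
      constructor
      · rw [hb.1, hb'.1]; field_simp
      · rw [hmm', hb'.1]; field_simp
    have h1 := hv x (s3 (sr hx)) m' (s3 (ha l' hl').1) m (s3 (ha l hl).1) _ hI hb2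
    have h2 := hdev x hx y hy l' hl'
    have h3 := (hd x (s2 (sr hx)) m' (s2 (ha l' hl').1)).1
    have h4 := (hd x (s2 (sr hx)) y (s2 (sr hy))).2
    rw [hb'.1] at h3
    have h5 : ‖x - m'‖ ≤ 3 * (l' * ‖x - y‖) := by
      have := mul_le_mul_of_nonneg_left h4 hl'0.le; linarith
    have h6 : 0 ≤ 1 - l / l' := by linarith [hI.2]
    have h7 : deviation x y l m - deviation x y l' m' =
        deviation x m' (l / l') m - (1 - l / l') • deviation x y l' m' := by
      rw [deviation_eq_add_smul x y m m' hl'0.ne']; module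
    rw [h7, abs_sub_comm, abs_of_pos (by linarith : 0 < l' - l)]
    refine (norm_sub_le _ _).trans ?_
    rw [norm_smul, Real.norm_of_nonneg h6]
    have h8 : l / l' * (1 - l / l') ≤ 1 - l / l' := mul_le_of_le_one_left h6 hI.2
    have h9 : l' * (1 - l') ≤ l' := mul_le_of_le_one_right hl'0.le (by linarith)
    calc _ ≤ δ / 4 * ((1 - l / l') * (3 * (l' * ‖x - y‖))) +
          (1 - l / l') * (δ / 4 * (l' * ‖x - y‖)) := by
          refine add_le_add (h1.trans ?_) (mul_le_mul_of_nonneg_left (h2.trans ?_) h6)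
          · gcongr
          · gcongr
      _ = _ := by field_simp; ring

end Selection

/-! ### Semiconcave functions are locally bounded below. -/

section LowerBound

variable {V : Type*} [NormedAddCommGroup V] [InnerProductSpace ℝ V] {M : Type*} [MetricSpace M]
  {e : V → M} {g : V → V →L[ℝ] V →L[ℝ] ℝ} {φ : M → ℝ}

/-- A selection of geodesics along which `φ` is concave, up to an additive constant. -/
theorem IsNormalModel.exists_selection_of_isSemiconcave (hm : IsNormalModel e g)
    (hgeo : ∀ x y : M, ∃ γ : ℝ → M, IsMinimizingGeodesic γ x y) (hφ : IsSemiconcave φ) :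
    ∃ C : ℝ, 0 ≤ C ∧ ∀ δ > 0, ∀ R₀ > 0, ∃ r > 0, r ≤ R₀ ∧ ∃ P, IsGeodesicSelection e δ r R₀ P ∧
      ∀ x ∈ Metric.ball (0 : V) r, ∀ y ∈ Metric.ball (0 : V) r, ∀ l ∈ Icc (0 : ℝ) 1,
        (1 - l) * φ (e x) + l * φ (e y) - l * (1 - l) * C ≤ φ (e (P x y l)) := by
  obtain ⟨w, hw, hsc⟩ := hφ
  obtain ⟨R, hR, hd⟩ := hm.exists_dist_bounds (ε := 1 / 2) (by norm_num) (by norm_num)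
  -- Inside radius 1/3 distances are at most 1, so monotonicity bounds the modulus by w(1),
  -- independently of δ and R₀.
  refine ⟨w 1, by positivity, fun δ hδ R₀ hR₀ ↦ ?_⟩
  obtain ⟨r, hr, hrR, P, hP⟩ := hm.exists_isGeodesicSelection hgeo hδ
    (R₀ := min R₀ (min R (1 / 3))) (by positivity)
  refine ⟨r, hr, hrR.trans (min_le_left _ _), P, ?_, fun x hx y hy l hl ↦ ?_⟩
  · exact { hP with
      mem := fun x hx y hy l hl ↦ Metric.ball_subset_ball (min_le_left _ _) (hP.mem x hx y hy l hl) }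
  · obtain ⟨γ, hγ, ha⟩ := hP.geodesic x hx y hy
    rw [ha l hl]
    have h1 := hsc (e y) (e x) γ hγ l hl
    have hrR' : r ≤ R := hrR.trans ((min_le_right _ _).trans (min_le_left _ _))
    have hr3 : r ≤ 1 / 3 := hrR.trans ((min_le_right _ _).trans (min_le_right _ _))
    have h2 := (hd y (Metric.ball_subset_ball hrR' hy) x (Metric.ball_subset_ball hrR' hx)).2
    have h3 : dist (e y) (e x) ≤ 1 := by
      have := norm_sub_le y x
      have := mem_ball_zero_iff.1 hx
      have := mem_ball_zero_iff.1 hy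
      linarith
    have h4 : (w (nndist (e y) (e x)) : ℝ) ≤ w 1 :=
      NNReal.coe_le_coe.2 (hw.monotone (NNReal.coe_le_coe.1 (by simpa using h3)))
    have h5 : 0 ≤ l * (1 - l) := mul_nonneg hl.1 (by linarith [hl.2])
    have h6 : l * (1 - l) * dist (e y) (e x) * (w (nndist (e y) (e x)) : ℝ) ≤
        l * (1 - l) * 1 * (w 1 : ℝ) := by gcongr
    linarith

/-- The statement proved by induction on `s`: `φ ∘ e` is bounded below on a surface which is a
small Lipschitz perturbation of the image of the linear map `L`. -/
def BoundedBelowNear (e : V → M) (φ : M → ℝ) (L : V →L[ℝ] V) : Prop :=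
  ∀ δ > 0, ∀ R > 0, ∃ ρ > 0, ρ ≤ R ∧ ∃ (T : V → V) (C : ℝ), ‖T 0‖ ≤ δ * ρ ∧
    (∀ v ∈ Metric.ball (0 : V) ρ, ∀ v' ∈ Metric.ball (0 : V) ρ,
      ‖T v - T v' - L (v - v')‖ ≤ δ * ‖v - v'‖) ∧
    ∀ v ∈ Metric.ball (0 : V) ρ, -C ≤ φ (e (T v))

theorem BoundedBelowNear.zero : BoundedBelowNear e φ 0 := by
  intro δ hδ R hR
  refine ⟨R, hR, le_rfl, 0, |φ (e 0)|, by simp; positivity, ?_, ?_⟩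
  · intro v _ v' _
    simp; positivity
  · intro v _
    simpa using neg_abs_le _

theorem norm_inner_smul_sub_le {b : V} (hb : ‖b‖ = 1) (v v' : V) :
    |(inner ℝ b v : ℝ) - inner ℝ b v'| ≤ ‖v - v'‖ := by
  rw [← inner_sub_right]
  simpa [hb] using abs_real_inner_le_norm b (v - v')

/-- Each point T(2v) is joined to the point A(2⟨b, v⟩) of a short geodesic in the direction b, and
the midpoint is taken; halving undoes the factor 2, so the result is close to Lv + ⟨b, v⟩b. On A the
function is bounded below by its values at the two ends, and semiconcavity passes lower bounds to
midpoints. No continuity of φ enters. -/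
theorem BoundedBelowNear.add_smulRight (hm : IsNormalModel e g)
    (hgeo : ∀ x y : M, ∃ γ : ℝ → M, IsMinimizingGeodesic γ x y) (hφ : IsSemiconcave φ)
    {L : V →L[ℝ] V} (hL : BoundedBelowNear e φ L) {b : V} (hb : ‖b‖ = 1) :
    BoundedBelowNear e φ (L + (innerSL ℝ b).smulRight b) := by
  obtain ⟨C₀, hC₀, hsel⟩ := hm.exists_selection_of_isSemiconcave hgeo hφ
  intro δ hδ R hR
  wlog hδ1 : δ ≤ 1 generalizing δ
  · obtain ⟨ρ, hρ, hρR, T, C, h0, h1, h2⟩ := this 1 one_pos le_rfl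
    have h1δ : 1 ≤ δ := (not_le.1 hδ1).le
    refine ⟨ρ, hρ, hρR, T, C, h0.trans (by gcongr), fun v hv v' hv' ↦ (h1 v hv v' hv').trans ?_, h2⟩
    gcongr
  set K := ‖L‖ + 1
  have hK : 1 ≤ K := by simp [K]
  -- T has Lipschitz constant at most K; the deviation of the joins multiplies it by δ₀, and δ₀K =
  -- δ/16 keeps the sum of all errors below δ.
  set δ₀ := δ / (16 * K)
  have hδ₀ : 0 < δ₀ := by positivity
  have hδ₀K : δ₀ * K = δ / 16 := by simp only [δ₀]; field_simp
  have hδ₀' : δ₀ ≤ δ / 16 := by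
    rw [← hδ₀K]; exact le_mul_of_one_le_right hδ₀.le hK
  obtain ⟨r, hr, hrR, P, hP, hPφ⟩ := hsel δ₀ hδ₀ R hR
  obtain ⟨ρ, hρ, hρr, T, C, hT0, hT1, hTφ⟩ := hL (δ / 4) (by positivity) (r / (4 * K)) (by positivity)
  have hρK : ρ * (4 * K) ≤ r := by rwa [le_div_iff₀ (by positivity)] at hρr
  have hρ4 : 4 * ρ ≤ r := by nlinarith
  have hTlip : ∀ v ∈ Metric.ball (0 : V) ρ, ∀ v' ∈ Metric.ball (0 : V) ρ,
      ‖T v - T v'‖ ≤ K * ‖v - v'‖ := by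
    intro v hv v' hv'
    have h1 := hT1 v hv v' hv'
    have h2 := L.le_opNorm (v - v')
    have h3 : ‖T v - T v'‖ ≤ ‖T v - T v' - L (v - v')‖ + ‖L (v - v')‖ := by
      simpa using norm_add_le (T v - T v' - L (v - v')) (L (v - v'))
    have h4 : δ / 4 * ‖v - v'‖ ≤ 1 * ‖v - v'‖ := by gcongr; linarith
    simp only [K]
    linarith
  have hTn : ∀ v ∈ Metric.ball (0 : V) ρ, ‖T v‖ ≤ 2 * (K * ρ) := by
    intro v hv
    have h1 := hTlip v hv 0 (by simpa using hρ)
    have h2 : ‖T v‖ ≤ ‖T v - T 0‖ + ‖T 0‖ := by simpa using norm_add_le (T v - T 0) (T 0)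
    rw [sub_zero] at h1
    have h3 : K * ‖v‖ ≤ K * ρ := by gcongr; exact (mem_ball_zero_iff.1 hv).le
    nlinarith
  have hTm : ∀ v ∈ Metric.ball (0 : V) ρ, T v ∈ Metric.ball (0 : V) r := by
    intro v hv
    rw [mem_ball_zero_iff]
    have := hTn v hv
    have : 0 < K * ρ := by positivity
    linarith
  -- the curve in the direction of `b`
  have hbm : ρ • b ∈ Metric.ball (0 : V) r := by
    rw [mem_ball_zero_iff, norm_smul, hb, Real.norm_of_nonneg hρ.le]; linarith
  have hbm' : -(ρ • b) ∈ Metric.ball (0 : V) r := by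
    rwa [mem_ball_zero_iff, norm_neg, ← mem_ball_zero_iff]
  have hbn : ‖-(ρ • b) - ρ • b‖ = 2 * ρ := by
    rw [show -(ρ • b) - ρ • b = -(2 * ρ) • b by module, norm_smul, hb, Real.norm_eq_abs, abs_neg,
      abs_of_pos (by positivity), mul_one]
  let τ : ℝ → ℝ := fun t ↦ (t + ρ) / (2 * ρ)
  have hτ : ∀ t, |t| < ρ → τ t ∈ Icc (0 : ℝ) 1 := by
    intro t ht
    have := abs_lt.1 ht
    exact ⟨div_nonneg (by linarith) (by linarith), (div_le_one (by linarith)).2 (by linarith)⟩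
  let A : ℝ → V := fun t ↦ P (-(ρ • b)) (ρ • b) (τ t)
  let d : ℝ → V := fun t ↦ deviation (-(ρ • b)) (ρ • b) (τ t) (A t)
  have hA : ∀ t, A t = d t + t • b := by
    intro t
    have h2 : (1 - τ t) • (-(ρ • b)) + τ t • (ρ • b) = t • b := by
      rw [smul_neg, smul_smul, smul_smul, ← neg_smul, ← add_smul]
      congr 1
      simp only [τ]
      field_simp
      ring
    rw [← h2]
    exact (deviation_add _ _ _ _).symm
  have hdd : ∀ t t', |t| < ρ → |t'| < ρ → ‖d t - d t'‖ ≤ δ₀ * |t - t'| := by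
    intro t t' ht ht'
    have := hP.norm_deviation_time_le _ hbm' _ hbm _ (hτ t ht) _ (hτ t' ht')
    rw [hbn] at this
    refine this.trans_eq ?_
    have : τ t - τ t' = (t - t') / (2 * ρ) := by simp only [τ]; ring
    rw [this, abs_div, abs_of_pos (by positivity : 0 < 2 * ρ)]
    field_simp
  have hd0 : ‖d 0‖ ≤ δ₀ * ρ := by
    have := hP.norm_deviation_le _ hbm' _ hbm _ (hτ 0 (by simpa using hρ))
    rw [hbn] at this
    have h0 : τ 0 = 1 / 2 := by simp only [τ]; field_simp; ring
    refine this.trans ?_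
    rw [h0]
    nlinarith [mul_pos hδ₀ hρ]
  have hAlip : ∀ t t', |t| < ρ → |t'| < ρ → ‖A t - A t'‖ ≤ 2 * |t - t'| := by
    intro t t' ht ht'
    rw [hA, hA, add_sub_add_comm, ← sub_smul]
    refine (norm_add_le _ _).trans ?_
    rw [norm_smul, hb, mul_one, Real.norm_eq_abs]
    have := hdd t t' ht ht'
    have h2 : δ₀ * |t - t'| ≤ 1 * |t - t'| := by gcongr; linarith
    linarith
  have hA0 : ‖A 0‖ ≤ δ₀ * ρ := by rw [hA]; simpa using hd0
  have hAm : ∀ t, |t| < ρ → A t ∈ Metric.ball (0 : V) r := by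
    intro t ht
    rw [mem_ball_zero_iff]
    have h1 := hAlip t 0 ht (by simpa using hρ)
    have h2 : ‖A t‖ ≤ ‖A t - A 0‖ + ‖A 0‖ := by simpa using norm_add_le (A t - A 0) (A 0)
    rw [sub_zero] at h1
    nlinarith
  have hAφ : ∀ t, |t| < ρ →
      -(|φ (e (-(ρ • b)))| + |φ (e (ρ • b))| + C₀) ≤ φ (e (A t)) := by
    intro t ht
    obtain ⟨h1, h2⟩ := hτ t ht
    refine le_trans ?_ (hPφ _ hbm' _ hbm _ (hτ t ht))
    set l := τ t
    have e1 := neg_abs_le (φ (e (-(ρ • b))))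
    have e2 := neg_abs_le (φ (e (ρ • b)))
    have e3 := abs_nonneg (φ (e (-(ρ • b))))
    have e4 := abs_nonneg (φ (e (ρ • b)))
    have f1 := mul_le_mul_of_nonneg_left e1 (by linarith : 0 ≤ 1 - l)
    have f2 := mul_le_mul_of_nonneg_left e2 h1
    have f3 : l * (1 - l) * C₀ ≤ 1 * C₀ := by
      gcongr; nlinarith
    have f4 := mul_nonneg h1 e3
    have f5 := mul_nonneg (by linarith : 0 ≤ 1 - l) e4
    linarith
  -- the new surface
  have hhalf : (1 / 2 : ℝ) ∈ Icc (0 : ℝ) 1 := by norm_num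
  have h2v : ∀ v ∈ Metric.ball (0 : V) (ρ / 2), (2 : ℝ) • v ∈ Metric.ball (0 : V) ρ ∧
      |2 * (inner ℝ b v : ℝ)| < ρ := by
    intro v hv
    rw [mem_ball_zero_iff] at *
    have h1 := abs_real_inner_le_norm b v
    rw [hb, one_mul] at h1
    constructor
    · rw [norm_smul, Real.norm_ofNat]; linarith
    · rw [abs_mul, abs_two]; linarith
  refine ⟨ρ / 2, by positivity, by linarith,
    fun v ↦ P (T ((2 : ℝ) • v)) (A (2 * inner ℝ b v)) (1 / 2),
    |C| + (|φ (e (-(ρ • b)))| + |φ (e (ρ • b))| + C₀) + C₀, ?_, ?_, ?_⟩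
  · simp only [smul_zero, inner_zero_right, mul_zero]
    have hTm0 := hTm 0 (by simpa using hρ)
    have hAm0 := hAm 0 (by simpa using hρ)
    have h1 := hP.norm_deviation_le _ hTm0 _ hAm0 _ hhalf
    rw [← deviation_add (T 0) (A 0) (1 / 2) (P (T 0) (A 0) (1 / 2))]
    have h2 := norm_sub_le (T 0) (A 0)
    have h3 : ‖(1 - 1 / 2 : ℝ) • T 0 + (1 / 2 : ℝ) • A 0‖ ≤ 1 / 2 * ‖T 0‖ + 1 / 2 * ‖A 0‖ := by
      refine (norm_add_le _ _).trans_eq ?_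
      rw [norm_smul, norm_smul]; norm_num
    have h4 : δ₀ * (1 / 2 * (1 - 1 / 2) * ‖T 0 - A 0‖) ≤ ‖T 0‖ / 4 + ‖A 0‖ / 4 := by
      have : δ₀ * (1 / 2 * (1 - 1 / 2) * ‖T 0 - A 0‖) ≤ 1 * (1 / 2 * (1 - 1 / 2) * ‖T 0 - A 0‖) := by
        gcongr; linarith
      linarith
    refine (norm_add_le _ _).trans ?_
    have h5 : δ₀ * ρ ≤ δ / 16 * ρ := by gcongr
    have h6 : 0 < δ * ρ := by positivity
    linarith
  · intro v hv v' hv'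
    obtain ⟨hv1, hv2⟩ := h2v v hv
    obtain ⟨hv1', hv2'⟩ := h2v v' hv'
    set t := 2 * (inner ℝ b v : ℝ)
    set t' := 2 * (inner ℝ b v' : ℝ)
    have htt : |t - t'| ≤ 2 * ‖v - v'‖ := by
      simp only [t, t']
      rw [← mul_sub, abs_mul, abs_two]
      gcongr; exact norm_inner_smul_sub_le hb v v'
    have hvv : ‖(2 : ℝ) • v - (2 : ℝ) • v'‖ = 2 * ‖v - v'‖ := by
      rw [← smul_sub, norm_smul, Real.norm_ofNat]
    have h1 := hP.norm_deviation_sub_le _ (hTm _ hv1) _ (hAm _ hv2) _ (hTm _ hv1') _ (hAm _ hv2')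
      _ hhalf
    have h2 := hTlip _ hv1 _ hv1'
    have h3 := hAlip _ _ hv2 hv2'
    have h4 := hT1 _ hv1 _ hv1'
    have h5 := hdd _ _ hv2 hv2'
    rw [hvv] at h2 h4
    have key : P (T ((2 : ℝ) • v)) (A t) (1 / 2) - P (T ((2 : ℝ) • v')) (A t') (1 / 2) -
        (L + (innerSL ℝ b).smulRight b) (v - v') =
        (deviation (T ((2 : ℝ) • v)) (A t) (1 / 2) (P (T ((2 : ℝ) • v)) (A t) (1 / 2)) -
          deviation (T ((2 : ℝ) • v')) (A t') (1 / 2) (P (T ((2 : ℝ) • v')) (A t') (1 / 2))) +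
        (1 / 2 : ℝ) • (T ((2 : ℝ) • v) - T ((2 : ℝ) • v') - L ((2 : ℝ) • v - (2 : ℝ) • v')) +
        (1 / 2 : ℝ) • (d t - d t') := by
      simp only [add_apply, ContinuousLinearMap.smulRight_apply, innerSL_apply_apply, deviation, hA,
        map_sub, map_smul, t, t']
      module
    rw [key]
    refine (norm_add₃_le).trans ?_
    rw [norm_smul, norm_smul, Real.norm_of_nonneg (by norm_num)]
    have h6 : δ₀ * ((1 - 1 / 2) * ‖T ((2 : ℝ) • v) - T ((2 : ℝ) • v')‖ + 1 / 2 * ‖A t - A t'‖) ≤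
        δ₀ * ((1 - 1 / 2) * (K * (2 * ‖v - v'‖)) + 1 / 2 * (2 * (2 * ‖v - v'‖))) :=
      mul_le_mul_of_nonneg_left (by linarith) hδ₀.le
    have h7 : δ₀ * |t - t'| ≤ δ₀ * (2 * ‖v - v'‖) := by gcongr
    have h8 : δ₀ * K * ‖v - v'‖ = δ / 16 * ‖v - v'‖ := by rw [hδ₀K]
    have h9 : δ₀ * ‖v - v'‖ ≤ δ / 16 * ‖v - v'‖ := by gcongr
    have h10 : 0 ≤ δ * ‖v - v'‖ := by positivity
    linarith
  · intro v hv
    obtain ⟨hv1, hv2⟩ := h2v v hv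
    refine le_trans ?_ (hPφ _ (hTm _ hv1) _ (hAm _ hv2) _ hhalf)
    have h1 := hTφ _ hv1
    have h2 := hAφ _ hv2
    have h3 := le_abs_self C
    have h4 := abs_nonneg C
    have e3 := abs_nonneg (φ (e (-(ρ • b))))
    have e4 := abs_nonneg (φ (e (ρ • b)))
    linarith

variable [FiniteDimensional ℝ V]

/-- A semiconcave function is locally bounded below. -/
theorem IsNormalModel.exists_le_of_isSemiconcave (hm : IsNormalModel e g)
    (hgeo : ∀ x y : M, ∃ γ : ℝ → M, IsMinimizingGeodesic γ x y) (hφ : IsSemiconcave φ) :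
    ∃ R > 0, ∃ C : ℝ, ∀ v ∈ Metric.ball (0 : V) R, -C ≤ φ (e v) := by
  -- One direction of an orthonormal basis is added at a time. With all of them the linear part is
  -- the identity, so the surface contains a ball by the perturbation lemma.
  have hall : ∀ s : Finset (Fin (Module.finrank ℝ V)), BoundedBelowNear e φ
      (∑ i ∈ s, (innerSL ℝ (stdOrthonormalBasis ℝ V i)).smulRight (stdOrthonormalBasis ℝ V i)) := by
    intro s
    induction s using Finset.induction_on with
    | empty => simpa using BoundedBelowNear.zero
    | insert i s hi ih =>
      rw [Finset.sum_insert hi, add_comm]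
      exact ih.add_smulRight hm hgeo hφ (by simp)
  obtain ⟨ρ, hρ, -, T, C, hT0, hT1, hTφ⟩ := hall Finset.univ (1 / 8) (by norm_num) 1 one_pos
  refine ⟨ρ / 8, by positivity, C, fun v hv ↦ ?_⟩
  have hid : ∀ w : V, (∑ i, (innerSL ℝ (stdOrthonormalBasis ℝ V i)).smulRight
      (stdOrthonormalBasis ℝ V i) : V →L[ℝ] V) w = w := by
    intro w
    simpa using (stdOrthonormalBasis ℝ V).sum_repr' w
  have hsub : Metric.closedBall (0 : V) (ρ / 2) ⊆ Metric.ball 0 ρ :=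
    Metric.closedBall_subset_ball (by linarith)
  obtain ⟨x, hx, rfl⟩ := exists_eq_of_norm_sub_sub_le (f := T) (b := 0) (y := v) (s := ρ / 2)
    (c := 1 / 8) (by positivity) (by norm_num) (by norm_num)
    (fun x hx x' hx' ↦ by simpa only [hid] using hT1 x (hsub hx) x' (hsub hx'))
    (by
      rw [mem_ball_zero_iff] at hv
      refine (norm_sub_le _ _).trans ?_
      linarith)
  exact hTφ x (hsub hx)

end LowerBound

/-! ### Lipschitz continuity and approximate concavity in coordinates. -/

section LocalLipschitz

variable {V : Type*} [NormedAddCommGroup V] [InnerProductSpace ℝ V] {M : Type*} [MetricSpace M]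
  {e : V → M} {g : V → V →L[ℝ] V →L[ℝ] ℝ} {φ : M → ℝ}

/-- Geodesics of a selection can be prolonged: `y` is a prescribed point of a geodesic which
starts at `x`. -/
theorem IsGeodesicSelection.exists_eq [CompleteSpace V] {r R : ℝ} {P : V → V → ℝ → V}
    (hP : IsGeodesicSelection e (1 / 2) r R P) {x y : V} {l : ℝ} (hl : 0 < l) (hl1 : l ≤ 1)
    (hx : x ∈ Metric.ball (0 : V) r)
    (hr : Metric.closedBall (x + l⁻¹ • (y - x)) (l⁻¹ * ‖y - x‖) ⊆ Metric.ball (0 : V) r) :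
    ∃ b ∈ Metric.closedBall (x + l⁻¹ • (y - x)) (l⁻¹ * ‖y - x‖), P x b l = y := by
  set b₀ := x + l⁻¹ • (y - x)
  set s := l⁻¹ * ‖y - x‖
  have hs : 0 ≤ s := by positivity
  have hxb : ‖x - b₀‖ = s := by
    simp only [b₀, s]
    rw [sub_add_cancel_left, norm_neg, norm_smul, Real.norm_of_nonneg (by positivity)]
  have hl' : l ∈ Icc (0 : ℝ) 1 := ⟨hl.le, hl1⟩
  have hF : ∀ b, x + l⁻¹ • (P x b l - x) = b + l⁻¹ • deviation x b l (P x b l) := by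
    intro b
    simp only [deviation]
    have : b = l⁻¹ • (l • b) := by rw [smul_smul, inv_mul_cancel₀ hl.ne', one_smul]
    nth_rw 2 [this]
    have h2 : (1 - l) • x = x - l • x := by module
    rw [h2, smul_smul, inv_mul_cancel₀ hl.ne']
    simp only [smul_sub, smul_add, smul_smul, inv_mul_cancel₀ hl.ne']
    module
  -- The deviation varies with the far end point by at most l/2 times its displacement. The factor l
  -- cancels the rescaling l⁻¹, so the contraction constant 1/2 does not depend on l.
  obtain ⟨b, hb, hbe⟩ := exists_eq_of_norm_sub_sub_le (f := fun b ↦ x + l⁻¹ • (P x b l - x))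
    (b := b₀) (y := b₀) (s := s) (c := 1 / 2) hs (by norm_num) (by norm_num)
    (fun b hb b' hb' ↦ by
      have := hP.norm_deviation_sub_le x hx b (hr hb) x hx b' (hr hb') l hl'
      rw [sub_self, norm_zero, mul_zero, zero_add] at this
      rw [hF, hF, add_sub_add_comm, add_sub_cancel_left, ← smul_sub, norm_smul,
        Real.norm_of_nonneg (by positivity), inv_mul_le_iff₀ hl]
      linarith)
    (by
      have := hP.norm_deviation_le x hx b₀ (hr (Metric.mem_closedBall_self hs)) l hl'
      rw [hxb] at this
      rw [hF, sub_add_cancel_left, norm_neg, norm_smul, Real.norm_of_nonneg (by positivity),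
        inv_mul_le_iff₀ hl]
      nlinarith [mul_nonneg (mul_nonneg hl.le hl.le) hs])
  refine ⟨b, hb, ?_⟩
  have h1 : l⁻¹ • (P x b l - x) = l⁻¹ • (y - x) := add_left_cancel hbe
  exact sub_left_injective (smul_right_injective V (inv_ne_zero hl.ne') h1)

variable [FiniteDimensional ℝ V]

/-- A semiconcave function is locally Lipschitz. -/
theorem IsNormalModel.exists_abs_sub_le_of_isSemiconcave (hm : IsNormalModel e g)
    (hgeo : ∀ x y : M, ∃ γ : ℝ → M, IsMinimizingGeodesic γ x y) (hφ : IsSemiconcave φ) :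
    ∃ R > 0, ∃ K : ℝ, 0 ≤ K ∧ ∀ u ∈ Metric.ball (0 : V) R, ∀ v ∈ Metric.ball (0 : V) R,
      |φ (e u) - φ (e v)| ≤ K * ‖u - v‖ := by
  obtain ⟨ρ, hρ, C, hC⟩ := hm.exists_le_of_isSemiconcave hgeo hφ
  obtain ⟨C₀, hC₀, hsel⟩ := hm.exists_selection_of_isSemiconcave hgeo hφ
  obtain ⟨r, hr, hrρ, P, hP, hPφ⟩ := hsel (1 / 2) (by norm_num) ρ hρ
  have hCr : ∀ v ∈ Metric.ball (0 : V) r, -C ≤ φ (e v) := fun v hv ↦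
    hC v (Metric.ball_subset_ball hrρ hv)
  -- Upper bound: 0 is the midpoint of a geodesic from x to some b near -x, so φ(x) is bounded by φ
  -- at 0 and the lower bound at b.
  obtain ⟨B, hB0, hB⟩ : ∃ B : ℝ, 0 ≤ B ∧ ∀ v ∈ Metric.ball (0 : V) (r / 8), |φ (e v)| ≤ B := by
    refine ⟨|C| + (2 * |φ (e 0)| + |C| + C₀), by positivity, fun x hx ↦ ?_⟩
    have hx8 := mem_ball_zero_iff.1 hx
    have hxr : x ∈ Metric.ball (0 : V) r := Metric.ball_subset_ball (by linarith) hx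
    have hsub : Metric.closedBall (x + (1 / 2 : ℝ)⁻¹ • (0 - x)) ((1 / 2 : ℝ)⁻¹ * ‖0 - x‖) ⊆
        Metric.ball (0 : V) r := by
      intro b hb
      rw [mem_closedBall_iff_norm, show x + (1 / 2 : ℝ)⁻¹ • (0 - x) = -x by norm_num; module,
        sub_neg_eq_add, zero_sub, norm_neg] at hb
      rw [mem_ball_zero_iff]
      have : ‖b‖ ≤ ‖b + x‖ + ‖x‖ := by simpa using norm_sub_le (b + x) x
      norm_num at hb
      linarith
    obtain ⟨b, hb, hbe⟩ := hP.exists_eq (x := x) (y := 0) (l := 1 / 2) (by norm_num) (by norm_num)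
      hxr hsub
    have h1 := hPφ x hxr b (hsub hb) (1 / 2) (by norm_num)
    rw [hbe] at h1
    have h2 := hCr b (hsub hb)
    have h3 := hCr x hxr
    have h4 := le_abs_self (φ (e 0))
    have h5 := le_abs_self C
    have h6 := abs_nonneg (φ (e 0))
    have h7 := abs_nonneg C
    rw [abs_le]
    constructor <;> linarith
  refine ⟨r / 128, by positivity, (2 * B + C₀) / (r / 64), by positivity, ?_⟩
  have one : ∀ x ∈ Metric.ball (0 : V) (r / 128), ∀ y ∈ Metric.ball (0 : V) (r / 128),
      φ (e x) - φ (e y) ≤ (2 * B + C₀) / (r / 64) * ‖x - y‖ := by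
    intro x hx y hy
    rcases eq_or_ne x y with rfl | hxy
    · simp
    have hn : 0 < ‖y - x‖ := norm_pos_iff.2 (sub_ne_zero.2 hxy.symm)
    have hxn := mem_ball_zero_iff.1 hx
    have hyn := mem_ball_zero_iff.1 hy
    -- The geodesic from x through y is prolonged to some b with y at parameter l, where b still
    -- lies in the ball on which |φ| ≤ B. Concavity up to C₀ then gives φ(x) - φ(y) ≤ l(2B + C₀),
    -- which is linear in ‖x - y‖.
    set l := ‖y - x‖ / (r / 64)
    have hl : 0 < l := by positivity
    have hl1 : l ≤ 1 := (div_le_one (by positivity)).2 ((norm_sub_le _ _).trans (by linarith))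
    have hlinv : l⁻¹ * ‖y - x‖ = r / 64 := by simp only [l]; field_simp
    have hsub : Metric.closedBall (x + l⁻¹ • (y - x)) (l⁻¹ * ‖y - x‖) ⊆
        Metric.ball (0 : V) (r / 8) := by
      intro b hb
      rw [hlinv, mem_closedBall_iff_norm] at hb
      rw [mem_ball_zero_iff]
      have h1 : ‖l⁻¹ • (y - x)‖ = r / 64 := by
        rw [norm_smul, Real.norm_of_nonneg (by positivity), hlinv]
      have h2 : ‖b‖ ≤ ‖b - (x + l⁻¹ • (y - x))‖ + ‖x + l⁻¹ • (y - x)‖ := by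
        simpa using norm_add_le (b - (x + l⁻¹ • (y - x))) (x + l⁻¹ • (y - x))
      have h3 := norm_add_le x (l⁻¹ • (y - x))
      linarith
    have h8 : Metric.ball (0 : V) (r / 8) ⊆ Metric.ball 0 r := Metric.ball_subset_ball (by linarith)
    have hx8 : x ∈ Metric.ball (0 : V) (r / 8) := Metric.ball_subset_ball (by linarith) hx
    obtain ⟨b, hb, hbe⟩ := hP.exists_eq hl hl1 (h8 hx8) (hsub.trans h8)
    have h1 := hPφ x (h8 hx8) b (h8 (hsub hb)) l ⟨hl.le, hl1⟩
    rw [hbe] at h1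
    have h2 := (abs_le.1 (hB b (hsub hb))).1
    have h3 := (abs_le.1 (hB x hx8)).2
    have h4 : l * (1 - l) * C₀ ≤ l * C₀ := by
      gcongr; exact mul_le_of_le_one_right hl.le (by linarith)
    have h5 : (2 * B + C₀) / (r / 64) * ‖x - y‖ = l * (2 * B + C₀) := by
      simp only [l]; rw [norm_sub_rev]; ring
    rw [h5]
    have h6 := mul_le_mul_of_nonneg_left h2 hl.le
    have h7 := mul_le_mul_of_nonneg_left h3 hl.le
    linarith
  intro u hu v hv
  rw [abs_le]
  have h1 := one u hu v hv
  have h2 := one v hv u hu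
  rw [norm_sub_rev] at h2
  constructor <;> linarith

/-- `f` is concave near `0` up to an error which is of smaller order than the distance. -/
def IsApproxConcave (f : V → ℝ) : Prop :=
  ∀ ε > 0, ∃ R > 0, ∀ x ∈ Metric.ball (0 : V) R, ∀ y ∈ Metric.ball (0 : V) R,
    ∀ l ∈ Icc (0 : ℝ) 1,
    (1 - l) * f x + l * f y - ε * (l * (1 - l) * ‖x - y‖) ≤ f ((1 - l) • x + l • y)

/-- Half of ε pays for the modulus at short distances. The other half pays for replacing the
geodesic point by the point of the segment, at most K times a deviation that already carries l(1 -
l)‖x - y‖. -/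
theorem IsNormalModel.isApproxConcave (hm : IsNormalModel e g)
    (hgeo : ∀ x y : M, ∃ γ : ℝ → M, IsMinimizingGeodesic γ x y) (hφ : IsSemiconcave φ) :
    IsApproxConcave (fun v ↦ φ (e v)) := by
  intro ε hε
  obtain ⟨R₁, hR₁, K, hK, hlip⟩ := hm.exists_abs_sub_le_of_isSemiconcave hgeo hφ
  obtain ⟨R₂, hR₂, hd⟩ := hm.exists_dist_bounds (ε := 1 / 2) (by norm_num) (by norm_num)
  obtain ⟨w, hw, hsc⟩ := hφ
  have hwε : ∀ᶠ s in 𝓝[>] (0 : ℝ≥0), w s < Real.toNNReal (ε / 3) :=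
    hw.tendsto_zero.eventually_lt_const (by simpa using hε)
  obtain ⟨η, hη, hηw⟩ := (mem_nhdsGT_iff_exists_Ioo_subset' (u' := 1) one_pos).1 hwε
  have hη' : (0 : ℝ) < η := hη
  obtain ⟨r, hr, hrR, P, hP⟩ := hm.exists_isGeodesicSelection hgeo
    (δ := ε / (2 * (K + 1))) (by positivity) (R₀ := min (min R₁ R₂) (η / 3)) (by positivity)
  have s1 : ∀ {p}, p ∈ Metric.ball (0 : V) r → p ∈ Metric.ball (0 : V) R₁ := fun hp ↦
    Metric.ball_subset_ball (hrR.trans ((min_le_left _ _).trans (min_le_left _ _))) hp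
  have s2 : ∀ {p}, p ∈ Metric.ball (0 : V) r → p ∈ Metric.ball (0 : V) R₂ := fun hp ↦
    Metric.ball_subset_ball (hrR.trans ((min_le_left _ _).trans (min_le_right _ _))) hp
  refine ⟨r, hr, fun x hx y hy l hl ↦ ?_⟩
  have hl0 : 0 ≤ l := hl.1
  have hl1 : 0 ≤ 1 - l := by linarith [hl.2]
  obtain ⟨γ, hγ, ha⟩ := hP.geodesic x hx y hy
  have h1 := hsc (e y) (e x) γ hγ l hl
  rw [← ha l hl] at h1
  have h2 := (hd y (s2 hy) x (s2 hx)).2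
  have h3 : dist (e y) (e x) * (w (nndist (e y) (e x)) : ℝ) ≤ ε / 2 * ‖x - y‖ := by
    rcases eq_or_lt_of_le (dist_nonneg (x := e y) (y := e x)) with h0 | h0
    · rw [← h0, zero_mul]; positivity
    have hlt : nndist (e y) (e x) < η := by
      rw [← NNReal.coe_lt_coe, coe_nndist]
      have := norm_sub_le y x
      have := mem_ball_zero_iff.1 hx
      have := mem_ball_zero_iff.1 hy
      have := hrR.trans (min_le_right _ _)
      linarith
    have h4 : w (nndist (e y) (e x)) < Real.toNNReal (ε / 3) :=
      hηw ⟨NNReal.coe_lt_coe.1 (by simpa using h0), hlt⟩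
    have h5 : (w (nndist (e y) (e x)) : ℝ) ≤ ε / 3 := by
      have := (NNReal.coe_lt_coe.2 h4).le
      rwa [Real.coe_toNNReal _ (by positivity)] at this
    rw [norm_sub_rev x y]
    calc _ ≤ (1 + 1 / 2) * ‖y - x‖ * (ε / 3) := by gcongr
      _ = _ := by ring
  have hlin : (1 - l) • x + l • y ∈ Metric.ball (0 : V) r :=
    (convex_ball (0 : V) r) hx hy hl1 hl0 (by ring)
  have hPm : P x y l ∈ Metric.ball (0 : V) R₁ :=
    Metric.ball_subset_ball ((min_le_left _ _).trans (min_le_left _ _)) (hP.mem x hx y hy l hl)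
  have h6 := (abs_le.1 (hlip _ hPm _ (s1 hlin))).2
  have h7 := hP.norm_deviation_le x hx y hy l hl
  rw [deviation] at h7
  have h8 : 0 ≤ l * (1 - l) := mul_nonneg hl0 hl1
  have h9 : K * ‖P x y l - ((1 - l) • x + l • y)‖ ≤ ε / 2 * (l * (1 - l) * ‖x - y‖) := by
    calc _ ≤ (K + 1) * (ε / (2 * (K + 1)) * (l * (1 - l) * ‖x - y‖)) := by gcongr; linarith
      _ = _ := by field_simp
  have h10 := mul_le_mul_of_nonneg_left h3 h8
  linarith

end LocalLipschitz

/-! ### Fréchet superdifferentials of approximately concave functions. -/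

section FrechetSuperdifferential

variable {V : Type*} [NormedAddCommGroup V] [NormedSpace ℝ V]

/-- `p` is an element of the Fréchet superdifferential of `f` at `u`. -/
def IsSuperdifferentialAt (f : V → ℝ) (u : V) (p : V →L[ℝ] ℝ) : Prop :=
  ∀ ε > 0, ∀ᶠ v in 𝓝 u, f v ≤ f u + p (v - u) + ε * ‖v - u‖

theorem HasFDerivAt.isSuperdifferentialAt {f ψ : V → ℝ} {u : V} {p : V →L[ℝ] ℝ}
    (hψ : HasFDerivAt ψ p u) (hle : ∀ᶠ v in 𝓝 u, f v ≤ ψ v) (heq : ψ u = f u) :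
    IsSuperdifferentialAt f u p := by
  intro ε hε
  filter_upwards [hle, hψ.isLittleO.def hε] with v h1 h2
  have := (abs_le.1 (Real.norm_eq_abs _ ▸ h2)).2
  rw [heq] at this
  linarith

theorem IsSuperdifferentialAt.eventually_le {f : V → ℝ} {u : V} {p : V →L[ℝ] ℝ}
    (h : IsSuperdifferentialAt f u p) {ε : ℝ} (hε : 0 < ε) (v : V) :
    ∀ᶠ t in 𝓝[>] (0 : ℝ), f (u + t • v) ≤ f u + t * (p v + ε * ‖v‖) := by
  have : Tendsto (fun t : ℝ ↦ u + t • v) (𝓝[>] 0) (𝓝 u) := by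
    have : ContinuousAt (fun t : ℝ ↦ u + t • v) 0 := by fun_prop
    simpa using this.tendsto.mono_left nhdsWithin_le_nhds
  filter_upwards [this.eventually (h ε hε), self_mem_nhdsWithin] with t ht ht0
  rw [add_sub_cancel_left, map_smul, norm_smul, Real.norm_of_nonneg (le_of_lt ht0),
    smul_eq_mul] at ht
  linarith

theorem IsSuperdifferentialAt.norm_le {f : V → ℝ} {u : V} {p : V →L[ℝ] ℝ}
    (h : IsSuperdifferentialAt f u p) {K : ℝ} (hK : 0 ≤ K)
    (hf : ∀ᶠ v in 𝓝 u, |f u - f v| ≤ K * ‖u - v‖) : ‖p‖ ≤ K := by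
  have key : ∀ v, -(K * ‖v‖) ≤ p v := by
    intro v
    refine le_of_forall_pos_le_add fun ε hε ↦ ?_
    have hε' : 0 < ε / (‖v‖ + 1) := by positivity
    have h1 := h.eventually_le hε' v
    have h2 : Tendsto (fun t : ℝ ↦ u + t • v) (𝓝[>] 0) (𝓝 u) := by
      have : ContinuousAt (fun t : ℝ ↦ u + t • v) 0 := by fun_prop
      simpa using this.tendsto.mono_left nhdsWithin_le_nhds
    obtain ⟨t, ⟨ht1, ht2⟩, ht⟩ := ((h1.and (h2.eventually hf)).and self_mem_nhdsWithin).exists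
    have ht : 0 < t := ht
    rw [sub_add_cancel_left, norm_neg, norm_smul, Real.norm_of_nonneg ht.le] at ht2
    have h3 := (abs_le.1 ht2).2
    have h4 : ε / (‖v‖ + 1) * ‖v‖ ≤ ε := by
      rw [div_mul_eq_mul_div, div_le_iff₀ (by positivity)]; nlinarith [norm_nonneg v]
    have h5 : t * -(K * ‖v‖) ≤ t * (p v + ε / (‖v‖ + 1) * ‖v‖) := by linarith
    have h6 := le_of_mul_le_mul_left h5 ht
    linarith
  refine p.opNorm_le_bound hK fun v ↦ ?_
  rw [Real.norm_eq_abs, abs_le]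
  refine ⟨key v, ?_⟩
  have := key (-v)
  rw [norm_neg, map_neg] at this
  linarith

end FrechetSuperdifferential

section FrechetConcave

variable {V : Type*} [NormedAddCommGroup V] [InnerProductSpace ℝ V]

/-- Letting t → 0 in approximate concavity on [u, v] makes the infinitesimal inequality at u hold on
a ball that depends neither on u nor on p. This uniformity yields the closed graph of the
superdifferential and the step inequality. -/
theorem IsApproxConcave.exists_le {f : V → ℝ} (hf : IsApproxConcave f) {ε : ℝ} (hε : 0 < ε) :
    ∃ R > 0, ∀ u ∈ Metric.ball (0 : V) R, ∀ v ∈ Metric.ball (0 : V) R, ∀ p : V →L[ℝ] ℝ,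
      IsSuperdifferentialAt f u p → f v ≤ f u + p (v - u) + ε * ‖v - u‖ := by
  obtain ⟨R, hR, hc⟩ := hf ε hε
  refine ⟨R, hR, fun u hu v hv p hp ↦ ?_⟩
  refine le_of_forall_pos_le_add fun η hη ↦ ?_
  have hη' : 0 < η / (‖v - u‖ + 1) := by positivity
  have h1 := hp.eventually_le hη' (v - u)
  obtain ⟨t, ht1, ht⟩ := (h1.and (Ioo_mem_nhdsGT (zero_lt_one' ℝ))).exists
  have h2 := hc u hu v hv t ⟨ht.1.le, ht.2.le⟩
  rw [show (1 - t) • u + t • v = u + t • (v - u) by module, norm_sub_rev] at h2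
  have h4 : η / (‖v - u‖ + 1) * ‖v - u‖ ≤ η := by
    rw [div_mul_eq_mul_div, div_le_iff₀ (by positivity)]; nlinarith [norm_nonneg (v - u)]
  have h5 : t * (1 - t) * ‖v - u‖ ≤ t * ‖v - u‖ := by
    gcongr; exact mul_le_of_le_one_right ht.1.le (by linarith [ht.1])
  have h6 := mul_le_mul_of_nonneg_left h5 hε.le
  have h7 : t * f v ≤ t * (f u + p (v - u) + η / (‖v - u‖ + 1) * ‖v - u‖ + ε * ‖v - u‖) := by
    linarith
  have h8 := le_of_mul_le_mul_left h7 ht.1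
  linarith

/-- Limits of superdifferentials at points which tend to `0` are superdifferentials at `0`. -/
theorem IsApproxConcave.isSuperdifferentialAt_of_tendsto {f : V → ℝ} (hf : IsApproxConcave f)
    (hc : ContinuousAt f 0) {ι : Type*} {L : Filter ι} [L.NeBot] {u : ι → V} {p : ι → V →L[ℝ] ℝ}
    {p₀ : V →L[ℝ] ℝ} (hu : Tendsto u L (𝓝 0)) (hp : Tendsto p L (𝓝 p₀))
    (h : ∀ᶠ i in L, IsSuperdifferentialAt f (u i) (p i)) : IsSuperdifferentialAt f 0 p₀ := by
  intro ε hε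
  obtain ⟨R, hR, hle⟩ := hf.exists_le hε
  filter_upwards [Metric.ball_mem_nhds (0 : V) hR] with v hv
  have h1 : ∀ᶠ i in L, f v ≤ f (u i) + p i (v - u i) + ε * ‖v - u i‖ := by
    filter_upwards [h, hu.eventually (Metric.ball_mem_nhds (0 : V) hR)] with i hi hi'
    exact hle _ hi' v hv _ hi
  have h2 : Tendsto (fun i ↦ f (u i) + p i (v - u i) + ε * ‖v - u i‖) L
      (𝓝 (f 0 + p₀ (v - 0) + ε * ‖v - 0‖)) := by
    have hv' : Tendsto (fun i ↦ v - u i) L (𝓝 (v - 0)) := tendsto_const_nhds.sub hu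
    have hpv : Tendsto (fun i ↦ p i (v - u i)) L (𝓝 (p₀ (v - 0))) :=
      (isBoundedBilinearMap_apply.continuous.tendsto (p₀, v - 0)).comp (hp.prodMk_nhds hv')
    exact ((hc.tendsto.comp hu).add hpv).add (hv'.norm.const_mul ε)
  exact ge_of_tendsto h2 h1

end FrechetConcave

/-! ### Existence of minimizing geodesics. -/

section MinimizingGeodesics

variable {E : Type*} [NormedAddCommGroup E] [NormedSpace ℝ E]
  {M : Type*} [MetricSpace M] [ChartedSpace E M]
  [RiemannianBundle (fun x : M ↦ TangentSpace 𝓘(ℝ, E) x)]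
  [IsRiemannianManifold 𝓘(ℝ, E) M]

variable (E) in
/-- Along a `C¹` curve, the sum of consecutive distances is bounded by the length. -/
theorem dist_add_dist_add_dist_lt_of_pathELength_lt {γ : ℝ → M}
    (hγ : ContMDiff 𝓘(ℝ, ℝ) 𝓘(ℝ, E) 1 γ) {r : ℝ}
    (h : pathELength 𝓘(ℝ, E) γ 0 1 < ENNReal.ofReal r) {a b : ℝ} (ha : 0 ≤ a) (hab : a ≤ b)
    (hb : b ≤ 1) :
    dist (γ 0) (γ a) + dist (γ a) (γ b) + dist (γ b) (γ 1) < r := by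
  have key : ∀ {s t : ℝ}, s ≤ t → edist (γ s) (γ t) ≤ pathELength 𝓘(ℝ, E) γ s t := by
    intro s t hst
    rw [IsRiemannianManifold.out (I := 𝓘(ℝ, E)) (γ s) (γ t)]
    exact riemannianEDist_le_pathELength hγ.contMDiffOn rfl rfl hst
  have : edist (γ 0) (γ a) + edist (γ a) (γ b) + edist (γ b) (γ 1) < ENNReal.ofReal r := by
    refine lt_of_le_of_lt ?_ h
    rw [← pathELength_add (ha.trans hab) hb, ← pathELength_add ha hab]
    exact add_le_add (add_le_add (key ha) (key hab)) (key hb)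
  simp only [edist_dist] at this
  rw [← ENNReal.ofReal_add dist_nonneg dist_nonneg,
    ← ENNReal.ofReal_add (by positivity) dist_nonneg] at this
  exact (ENNReal.ofReal_lt_ofReal_iff_of_nonneg (by positivity)).1 this

end MinimizingGeodesics

/-- A C¹ curve of length below d(x, y) + δ is reparametrized by the distance from x. Two of its
points split it in three parts whose chords sum to less than d(x, y) + δ, which bounds the middle
one. -/
theorem exists_almost_geodesic (E : Type*) [NormedAddCommGroup E] [NormedSpace ℝ E]
    {M : Type*} [MetricSpace M] [ChartedSpace E M]
    [RiemannianBundle (fun x : M ↦ TangentSpace 𝓘(ℝ, E) x)]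
    [IsRiemannianManifold 𝓘(ℝ, E) M] [CompactSpace M] (x y : M) {δ : ℝ} (hδ : 0 < δ) :
    ∃ c : ℝ → M, c 0 = x ∧ c 1 = y ∧ ∀ s ∈ Icc (0 : ℝ) 1, ∀ t ∈ Icc (0 : ℝ) 1,
      dist (c s) (c t) ≤ |s - t| * dist x y + δ := by
  have h1 : riemannianEDist 𝓘(ℝ, E) x y < ENNReal.ofReal (dist x y + δ) := by
    rw [← IsRiemannianManifold.out (I := 𝓘(ℝ, E)) x y, edist_dist]
    exact (ENNReal.ofReal_lt_ofReal_iff_of_nonneg dist_nonneg).2 (by linarith)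
  obtain ⟨γ, h0, h1', hγ, hlen, -, -⟩ :=
    exists_lt_locally_constant_of_riemannianEDist_lt h1 zero_lt_one
  have hcont : Continuous fun t ↦ dist x (γ t) := continuous_const.dist hγ.continuous
  -- For s = 1 the intermediate value theorem could return another point at the same distance from
  -- x, so the end parameters are prescribed.
  have hivt : ∀ s : ℝ, ∃ t ∈ Icc (0 : ℝ) 1, (s ∈ Icc (0 : ℝ) 1 → dist x (γ t) = s * dist x y) ∧
      (s = 0 → t = 0) ∧ (s = 1 → t = 1) := by
    intro s
    by_cases hs0 : s = 0
    · subst hs0; exact ⟨0, by simp, by simp [h0], by simp, by simp⟩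
    by_cases hs1 : s = 1
    · subst hs1; exact ⟨1, by simp, by simp [h1'], by simp, by simp⟩
    by_cases hs : s ∈ Icc (0 : ℝ) 1
    · have := intermediate_value_Icc zero_le_one (f := fun t ↦ dist x (γ t)) hcont.continuousOn
      have hm : s * dist x y ∈ Icc (dist x (γ 0)) (dist x (γ 1)) := by
        rw [h0, h1', dist_self]
        exact ⟨mul_nonneg hs.1 dist_nonneg, mul_le_of_le_one_left dist_nonneg hs.2⟩
      obtain ⟨t, ht, hts⟩ := this hm
      exact ⟨t, ht, fun _ ↦ hts, fun h ↦ absurd h hs0, fun h ↦ absurd h hs1⟩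
    · exact ⟨0, by simp, fun h ↦ absurd h hs, by simp, fun h ↦ absurd h hs1⟩
  choose τ hτ hτd hτ0 hτ1 using hivt
  refine ⟨fun s ↦ γ (τ s), by simp [hτ0 0 rfl, h0], by simp [hτ1 1 rfl, h1'], ?_⟩
  have main : ∀ s ∈ Icc (0 : ℝ) 1, ∀ t ∈ Icc (0 : ℝ) 1, τ s ≤ τ t →
      dist (γ (τ s)) (γ (τ t)) ≤ |s - t| * dist x y + δ := by
    intro s hs t ht hst
    have h3 := dist_add_dist_add_dist_lt_of_pathELength_lt E hγ hlen (hτ s).1 hst (hτ t).2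
    rw [h0, h1', hτd s hs] at h3
    have h4 := dist_triangle x (γ (τ t)) y
    rw [hτd t ht] at h4
    have h5 : (t - s) * dist x y ≤ |s - t| * dist x y := by
      rw [abs_sub_comm]
      exact mul_le_mul_of_nonneg_right (le_abs_self _) dist_nonneg
    nlinarith
  intro s hs t ht
  rcases le_total (τ s) (τ t) with h | h
  · exact main s hs t ht h
  · have := main t ht s hs h
    rwa [dist_comm, abs_sub_comm] at this

/-- In a compact Riemannian manifold, any two points are joined by a minimizing geodesic. -/
theorem exists_isMinimizingGeodesic (E : Type*) [NormedAddCommGroup E] [NormedSpace ℝ E]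
    {M : Type*} [MetricSpace M] [ChartedSpace E M]
    [RiemannianBundle (fun x : M ↦ TangentSpace 𝓘(ℝ, E) x)]
    [IsRiemannianManifold 𝓘(ℝ, E) M] [CompactSpace M] (x y : M) :
    ∃ γ : ℝ → M, IsMinimizingGeodesic γ x y := by
  have hδ : ∀ n : ℕ, (0 : ℝ) < 1 / ((n : ℝ) + 1) := fun n ↦ Nat.one_div_pos_of_nat
  choose c hc0 hc1 hc using fun n : ℕ ↦ exists_almost_geodesic E x y (hδ n)
  -- Pointwise limits along one ultrafilter suffice, as the almost-Lipschitz bounds pass to the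
  -- limit.
  let U : Ultrafilter ℕ := Filter.hyperfilter ℕ
  have hU : (U : Filter ℕ) ≤ atTop := Nat.hyperfilter_le_atTop
  have hlim : ∀ t : ℝ, ∃ z : M, Tendsto (fun n ↦ c n t) U (𝓝 z) := by
    intro t
    obtain ⟨z, -, hz⟩ := isCompact_univ.ultrafilter_le_nhds (U.map fun n ↦ c n t) (by simp)
    exact ⟨z, hz⟩
  choose γ hγ using hlim
  have h0 : γ 0 = x := tendsto_nhds_unique (hγ 0) (by simp [hc0])
  have h1 : γ 1 = y := tendsto_nhds_unique (hγ 1) (by simp [hc1])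
  have hle : ∀ s ∈ Icc (0 : ℝ) 1, ∀ t ∈ Icc (0 : ℝ) 1,
      dist (γ s) (γ t) ≤ |s - t| * dist x y := by
    intro s hs t ht
    have hr : Tendsto (fun n : ℕ ↦ |s - t| * dist x y + 1 / ((n : ℝ) + 1)) U
        (𝓝 (|s - t| * dist x y + 0)) :=
      (tendsto_const_nhds.add tendsto_one_div_add_atTop_nhds_zero_nat).mono_left hU
    rw [add_zero] at hr
    exact le_of_tendsto_of_tendsto' ((hγ s).dist (hγ t)) hr fun n ↦ hc n s hs t ht
  refine ⟨γ, h0, h1, ?_⟩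
  -- The three upper bounds on [0, s], [s, t], [t, 1] add up to d(x, y), so each of them is an
  -- equality.
  have main : ∀ s ∈ Icc (0 : ℝ) 1, ∀ t ∈ Icc (0 : ℝ) 1, s ≤ t →
      dist (γ s) (γ t) = |s - t| * dist x y := by
    intro s hs t ht hst
    refine le_antisymm (hle s hs t ht) ?_
    have e1 := hle 0 (by simp) s hs
    have e2 := hle t ht 1 (by simp)
    rw [h0, zero_sub, abs_neg, abs_of_nonneg hs.1] at e1
    rw [h1, abs_sub_comm, abs_of_nonneg (by linarith [ht.2])] at e2
    have e3 := dist_triangle4 x (γ s) (γ t) y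
    rw [abs_sub_comm, abs_of_nonneg (by linarith)]
    nlinarith
  intro s hs t ht
  rcases le_total s t with h | h
  · exact main s hs t ht h
  · rw [dist_comm, abs_sub_comm]
    exact main t ht s hs h

/-! ### Charts and the Riemannian metric in coordinates. -/

noncomputable section CoordinateMetric

variable {E : Type*} [NormedAddCommGroup E] [NormedSpace ℝ E]
  {M : Type*} [MetricSpace M] [ChartedSpace E M] [IsManifold 𝓘(ℝ, E) ∞ M]

variable (E) in
/-- The differential at `b` of the chart at `x₀`. -/
def chartDifferential (x₀ b : M) : TangentSpace 𝓘(ℝ, E) b →L[ℝ] E :=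
  (trivializationAt E (TangentSpace 𝓘(ℝ, E)) x₀).continuousLinearMapAt ℝ b

variable (E) in
/-- The inverse of the differential at `b` of the chart at `x₀`. -/
def chartCodifferential (x₀ b : M) : E →L[ℝ] TangentSpace 𝓘(ℝ, E) b :=
  (trivializationAt E (TangentSpace 𝓘(ℝ, E)) x₀).symmL ℝ b

theorem mem_baseSet_of_mem_source {x₀ b : M} (hb : b ∈ (extChartAt 𝓘(ℝ, E) x₀).source) :
    b ∈ (trivializationAt E (TangentSpace 𝓘(ℝ, E) : M → Type _) x₀).baseSet := by
  rw [TangentBundle.trivializationAt_baseSet]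
  simpa using hb

theorem chartCodifferential_chartDifferential {x₀ b : M}
    (hb : b ∈ (extChartAt 𝓘(ℝ, E) x₀).source) (ξ : TangentSpace 𝓘(ℝ, E) b) :
    chartCodifferential E x₀ b (chartDifferential E x₀ b ξ) = ξ :=
  (trivializationAt E (TangentSpace 𝓘(ℝ, E)) x₀).symmL_continuousLinearMapAt
    (mem_baseSet_of_mem_source hb) ξ

theorem chartDifferential_chartCodifferential {x₀ b : M}
    (hb : b ∈ (extChartAt 𝓘(ℝ, E) x₀).source) (v : E) :
    chartDifferential E x₀ b (chartCodifferential E x₀ b v) = v :=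
  (trivializationAt E (TangentSpace 𝓘(ℝ, E)) x₀).continuousLinearMapAt_symmL
    (mem_baseSet_of_mem_source hb) v

theorem hasMFDerivAt_extChartAt_chartDifferential {x₀ b : M}
    (hb : b ∈ (extChartAt 𝓘(ℝ, E) x₀).source) :
    HasMFDerivAt 𝓘(ℝ, E) 𝓘(ℝ, E) (extChartAt 𝓘(ℝ, E) x₀) b (chartDifferential E x₀ b) := by
  have hb' : b ∈ (chartAt E x₀).source := by simpa using hb
  have := (mdifferentiableAt_extChartAt (I := 𝓘(ℝ, E)) hb').hasMFDerivAt
  rwa [← TangentBundle.continuousLinearMapAt_trivializationAt hb'] at this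

theorem chartDifferential_self (x₀ : M) (ξ : TangentSpace 𝓘(ℝ, E) x₀) :
    chartDifferential E x₀ x₀ ξ = ξ := by
  have h := TangentBundle.continuousLinearMapAt_trivializationAt (I := 𝓘(ℝ, E)) (𝕜 := ℝ)
    (mem_chart_source E x₀)
  rw [mfderiv_extChartAt_self] at h
  exact congrArg (fun f : TangentSpace 𝓘(ℝ, E) x₀ →L[ℝ] E ↦ f ξ) h

theorem chartCodifferential_self (x₀ : M) (v : E) :
    chartCodifferential E x₀ x₀ v = v := by
  have h := chartDifferential_chartCodifferential (mem_extChartAt_source (I := 𝓘(ℝ, E)) x₀) v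
  rwa [chartDifferential_self] at h

variable [RiemannianBundle (fun x : M ↦ TangentSpace 𝓘(ℝ, E) x)]

variable (E) in
/-- The Riemannian metric at `b`, read in the chart at `x₀`. -/
def coordinateMetric (x₀ b : M) : E →L[ℝ] E →L[ℝ] ℝ :=
  (innerSL ℝ (E := TangentSpace 𝓘(ℝ, E) b)).bilinearComp
    (chartCodifferential E x₀ b) (chartCodifferential E x₀ b)

theorem contMDiffOn_chartCodifferential (x₀ : M) (v : E) :
    ContMDiffOn 𝓘(ℝ, E) (𝓘(ℝ, E).prod 𝓘(ℝ, E)) ∞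
      (fun b : M ↦ (⟨b, chartCodifferential E x₀ b v⟩ : TangentBundle 𝓘(ℝ, E) M))
      (extChartAt 𝓘(ℝ, E) x₀).source := by
  let ψ := trivializationAt E (TangentSpace 𝓘(ℝ, E) : M → Type _) x₀
  intro b hb
  have hb' : b ∈ ψ.baseSet := mem_baseSet_of_mem_source hb
  refine (Bundle.Trivialization.contMDiffWithinAt_section (e := ψ) _ hb').2 ?_
  refine (contMDiffWithinAt_const (c := v)).congr ?_ ?_
  · intro y hy
    have := ψ.continuousLinearMapAt_symmL (R := ℝ) (mem_baseSet_of_mem_source hy) v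
    rwa [Bundle.Trivialization.continuousLinearMapAt_apply_of_mem ℝ ψ
      (mem_baseSet_of_mem_source hy)] at this
  · have := ψ.continuousLinearMapAt_symmL (R := ℝ) hb' v
    rwa [Bundle.Trivialization.continuousLinearMapAt_apply_of_mem ℝ ψ hb'] at this

variable [FiniteDimensional ℝ E]
  [IsContMDiffRiemannianBundle 𝓘(ℝ, E) ∞ E (fun x : M ↦ TangentSpace 𝓘(ℝ, E) x)]

theorem contDiffOn_coordinateMetric (x₀ : M) :
    ContDiffOn ℝ ∞ (fun w ↦ coordinateMetric E x₀ ((extChartAt 𝓘(ℝ, E) x₀).symm w))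
      (extChartAt 𝓘(ℝ, E) x₀).target := by
  refine contDiffOn_clm_apply.2 fun v ↦ contDiffOn_clm_apply.2 fun w ↦ ?_
  have h : ContMDiffOn 𝓘(ℝ, E) 𝓘(ℝ, ℝ) ∞ (fun b : M ↦ coordinateMetric E x₀ b v w)
      (extChartAt 𝓘(ℝ, E) x₀).source :=
    ContMDiffOn.inner_bundle (E := fun b : M ↦ TangentSpace 𝓘(ℝ, E) b)
      (contMDiffOn_chartCodifferential x₀ v) (contMDiffOn_chartCodifferential x₀ w)
  have h2 := h.comp (contMDiffOn_extChartAt_symm x₀) (extChartAt 𝓘(ℝ, E) x₀).mapsTo_symm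
  exact h2.contDiffOn

end CoordinateMetric

noncomputable section LinearChart

variable {E : Type*} [NormedAddCommGroup E] [NormedSpace ℝ E]
  {V : Type*} [NormedAddCommGroup V] [NormedSpace ℝ V]
  {M : Type*} [MetricSpace M] [ChartedSpace E M]

/-- The inverse of the chart at `x₀`, centred at `0` and composed with a linear isomorphism. -/
def chartParam (x₀ : M) (L : V ≃L[ℝ] E) (u : V) : M :=
  (extChartAt 𝓘(ℝ, E) x₀).symm (extChartAt 𝓘(ℝ, E) x₀ x₀ + L u)

/-- The chart at `x₀`, centred at `0` and composed with a linear isomorphism. -/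
def chartCoord (x₀ : M) (L : V ≃L[ℝ] E) (z : M) : V :=
  L.symm (extChartAt 𝓘(ℝ, E) x₀ z - extChartAt 𝓘(ℝ, E) x₀ x₀)

/-- The image of `chartCoord`. -/
def chartDomain (x₀ : M) (L : V ≃L[ℝ] E) : Set V :=
  {u | extChartAt 𝓘(ℝ, E) x₀ x₀ + L u ∈ (extChartAt 𝓘(ℝ, E) x₀).target}

variable {x₀ : M} {L : V ≃L[ℝ] E}

@[simp] theorem chartParam_zero : chartParam x₀ L 0 = x₀ := by
  simp [chartParam]

@[simp] theorem chartCoord_self : chartCoord x₀ L x₀ = 0 := by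
  simp [chartCoord]

theorem isOpen_chartDomain : IsOpen (chartDomain x₀ L) :=
  (isOpen_extChartAt_target (I := 𝓘(ℝ, E)) x₀).preimage (by fun_prop)

theorem chartDomain_mem_nhds : chartDomain x₀ L ∈ 𝓝 (0 : V) :=
  isOpen_chartDomain.mem_nhds (by simp [chartDomain])

theorem chartParam_mem_source {u : V} (hu : u ∈ chartDomain x₀ L) :
    chartParam x₀ L u ∈ (extChartAt 𝓘(ℝ, E) x₀).source :=
  (extChartAt 𝓘(ℝ, E) x₀).map_target hu

theorem chartParam_chartCoord {z : M} (hz : z ∈ (extChartAt 𝓘(ℝ, E) x₀).source) :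
    chartParam x₀ L (chartCoord x₀ L z) = z := by
  rw [chartParam, chartCoord, L.apply_symm_apply, add_sub_cancel]
  exact (extChartAt 𝓘(ℝ, E) x₀).left_inv hz

theorem chartCoord_mem_chartDomain {z : M} (hz : z ∈ (extChartAt 𝓘(ℝ, E) x₀).source) :
    chartCoord x₀ L z ∈ chartDomain x₀ L := by
  rw [chartDomain, mem_ofPred_eq, chartCoord, L.apply_symm_apply, add_sub_cancel]
  exact (extChartAt 𝓘(ℝ, E) x₀).map_source hz

theorem chartCoord_chartParam {u : V} (hu : u ∈ chartDomain x₀ L) :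
    chartCoord x₀ L (chartParam x₀ L u) = u := by
  rw [chartCoord, chartParam, (extChartAt 𝓘(ℝ, E) x₀).right_inv hu, add_sub_cancel_left,
    L.symm_apply_apply]

theorem continuousAt_chartCoord {z : M} (hz : z ∈ (extChartAt 𝓘(ℝ, E) x₀).source) :
    ContinuousAt (chartCoord x₀ L) z :=
  L.symm.continuous.continuousAt.comp
    ((continuousAt_extChartAt' hz).sub continuousAt_const)

theorem continuousAt_chartParam {u : V} (hu : u ∈ chartDomain x₀ L) :
    ContinuousAt (chartParam x₀ L) u :=
  ContinuousAt.comp (f := fun u : V ↦ extChartAt 𝓘(ℝ, E) x₀ x₀ + L u)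
    (continuousAt_extChartAt_symm'' hu) (by fun_prop)

theorem chartParam_image_mem_nhds {U : Set V} (hU : U ∈ 𝓝 (0 : V)) :
    chartParam x₀ L '' U ∈ 𝓝 x₀ := by
  have h1 := (continuousAt_chartCoord (L := L) (mem_extChartAt_source (I := 𝓘(ℝ, E)) x₀))
  rw [ContinuousAt, chartCoord_self] at h1
  filter_upwards [h1 hU, extChartAt_source_mem_nhds (I := 𝓘(ℝ, E)) x₀] with z hz hz'
  exact ⟨_, hz, chartParam_chartCoord hz'⟩

variable [IsManifold 𝓘(ℝ, E) ∞ M]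

theorem contMDiffOn_chartParam :
    ContMDiffOn 𝓘(ℝ, V) 𝓘(ℝ, E) ∞ (chartParam x₀ L) (chartDomain x₀ L) := by
  refine (contMDiffOn_extChartAt_symm x₀).comp
    (f := fun u : V ↦ extChartAt 𝓘(ℝ, E) x₀ x₀ + L u) ?_ fun u hu ↦ hu
  exact (contDiff_const.add L.contDiff).contMDiff.contMDiffOn

theorem contMDiffOn_chartCoord :
    ContMDiffOn 𝓘(ℝ, E) 𝓘(ℝ, V) ∞ (chartCoord x₀ L) (extChartAt 𝓘(ℝ, E) x₀).source := by
  have h1 : ContMDiff 𝓘(ℝ, E) 𝓘(ℝ, V) ∞ fun w : E ↦ L.symm (w - extChartAt 𝓘(ℝ, E) x₀ x₀) :=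
    (L.symm.contDiff.comp (contDiff_id.sub contDiff_const)).contMDiff
  have h2 : ContMDiffOn 𝓘(ℝ, E) 𝓘(ℝ, E) ∞ (extChartAt 𝓘(ℝ, E) x₀)
      (extChartAt 𝓘(ℝ, E) x₀).source := by
    rw [extChartAt_source]
    exact contMDiffOn_extChartAt
  exact h1.comp_contMDiffOn h2

variable (x₀ L) in
/-- The differential of `chartCoord` at `b`. -/
def coordDifferential (b : M) : TangentSpace 𝓘(ℝ, E) b →L[ℝ] V :=
  (L.symm : E →L[ℝ] V).comp (chartDifferential E x₀ b)

variable (x₀ L) in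
/-- The inverse of the differential of `chartCoord` at `b`. -/
def coordCodifferential (b : M) : V →L[ℝ] TangentSpace 𝓘(ℝ, E) b :=
  (chartCodifferential E x₀ b).comp (L : V →L[ℝ] E)

theorem coordCodifferential_coordDifferential {b : M}
    (hb : b ∈ (extChartAt 𝓘(ℝ, E) x₀).source) (ξ : TangentSpace 𝓘(ℝ, E) b) :
    coordCodifferential x₀ L b (coordDifferential x₀ L b ξ) = ξ := by
  simp only [coordCodifferential, coordDifferential, ContinuousLinearMap.comp_apply,
    ContinuousLinearEquiv.coe_coe, L.apply_symm_apply]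
  exact chartCodifferential_chartDifferential hb ξ

theorem coordDifferential_coordCodifferential {b : M}
    (hb : b ∈ (extChartAt 𝓘(ℝ, E) x₀).source) (v : V) :
    coordDifferential x₀ L b (coordCodifferential x₀ L b v) = v := by
  simp only [coordCodifferential, coordDifferential, ContinuousLinearMap.comp_apply,
    ContinuousLinearEquiv.coe_coe]
  rw [chartDifferential_chartCodifferential hb, L.symm_apply_apply]

theorem hasMFDerivAt_chartCoord {b : M} (hb : b ∈ (extChartAt 𝓘(ℝ, E) x₀).source) :
    HasMFDerivAt 𝓘(ℝ, E) 𝓘(ℝ, V) (chartCoord x₀ L) b (coordDifferential x₀ L b) := by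
  have h1 : HasFDerivAt (fun w : E ↦ L.symm (w - extChartAt 𝓘(ℝ, E) x₀ x₀))
      (L.symm : E →L[ℝ] V) (extChartAt 𝓘(ℝ, E) x₀ b) :=
    (L.symm : E →L[ℝ] V).hasFDerivAt.comp _ ((hasFDerivAt_id _).sub_const _)
  exact h1.hasMFDerivAt.comp b (hasMFDerivAt_extChartAt_chartDifferential hb)

theorem hasDerivAt_chartCoord_comp {γ : ℝ → M} {t : ℝ}
    (ht : γ t ∈ (extChartAt 𝓘(ℝ, E) x₀).source)
    (hγ : MDifferentiableAt 𝓘(ℝ, ℝ) 𝓘(ℝ, E) γ t) :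
    HasDerivAt (fun s ↦ chartCoord x₀ L (γ s))
      (coordDifferential x₀ L (γ t) (mfderiv 𝓘(ℝ, ℝ) 𝓘(ℝ, E) γ t 1)) t := by
  have h := (hasMFDerivAt_chartCoord (L := L) ht).comp t hγ.hasMFDerivAt
  let A : ℝ →L[ℝ] V :=
    (coordDifferential x₀ L (γ t)).comp (mfderiv 𝓘(ℝ, ℝ) 𝓘(ℝ, E) γ t)
  have h' : HasFDerivAt (fun s ↦ chartCoord x₀ L (γ s)) A t := h.hasFDerivAt
  exact h'.hasDerivAt

variable [RiemannianBundle (fun x : M ↦ TangentSpace 𝓘(ℝ, E) x)]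

variable (x₀ L) in
/-- The Riemannian metric in the coordinates `chartCoord`. -/
def normalMetric (u : V) : V →L[ℝ] V →L[ℝ] ℝ :=
  (innerSL ℝ (E := TangentSpace 𝓘(ℝ, E) (chartParam x₀ L u))).bilinearComp
    (coordCodifferential x₀ L (chartParam x₀ L u)) (coordCodifferential x₀ L (chartParam x₀ L u))

theorem normalMetric_apply (u v w : V) : normalMetric x₀ L u v w =
    inner ℝ (coordCodifferential x₀ L (chartParam x₀ L u) v)
      (coordCodifferential x₀ L (chartParam x₀ L u) w) := rfl

theorem normalMetric_symm (u v w : V) : normalMetric x₀ L u v w = normalMetric x₀ L u w v := by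
  rw [normalMetric_apply, normalMetric_apply]
  exact real_inner_comm _ _

theorem normalMetric_self_nonneg (u v : V) : 0 ≤ normalMetric x₀ L u v v := by
  rw [normalMetric_apply]
  exact real_inner_self_nonneg

theorem normalMetric_mul_self_le (u v w : V) :
    normalMetric x₀ L u v w ^ 2 ≤ normalMetric x₀ L u v v * normalMetric x₀ L u w w := by
  rw [normalMetric_apply, normalMetric_apply, normalMetric_apply, sq]
  exact real_inner_mul_inner_self_le _ _

theorem normalMetric_coordDifferential {b : M} (hb : b ∈ (extChartAt 𝓘(ℝ, E) x₀).source)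
    (ξ : TangentSpace 𝓘(ℝ, E) b) :
    normalMetric x₀ L (chartCoord x₀ L b) (coordDifferential x₀ L b ξ)
      (coordDifferential x₀ L b ξ) = ‖ξ‖ ^ 2 := by
  have key : ∀ b' (h : b' = b), (inner ℝ (coordCodifferential x₀ L b' (coordDifferential x₀ L b ξ))
      (coordCodifferential x₀ L b' (coordDifferential x₀ L b ξ)) : ℝ) = ‖ξ‖ ^ 2 := by
    rintro b' rfl
    rw [coordCodifferential_coordDifferential hb]
    exact real_inner_self_eq_norm_sq ξ
  exact key _ (chartParam_chartCoord hb)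

theorem normalMetric_zero_apply (v w : V) : normalMetric x₀ L 0 v w =
    inner ℝ (show TangentSpace 𝓘(ℝ, E) x₀ from L v) (show TangentSpace 𝓘(ℝ, E) x₀ from L w) := by
  have key : ∀ b' (h : b' = x₀), (inner ℝ (coordCodifferential x₀ L b' v)
      (coordCodifferential x₀ L b' w) : ℝ) =
        inner ℝ (show TangentSpace 𝓘(ℝ, E) x₀ from L v)
          (show TangentSpace 𝓘(ℝ, E) x₀ from L w) := by
    rintro b' rfl
    simp only [coordCodifferential, ContinuousLinearMap.comp_apply, chartCodifferential_self]
    rfl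
  exact key _ chartParam_zero

theorem norm_mfderiv_sq_eq_normalMetric {γ : ℝ → M} {t : ℝ} {ξ : V}
    (ht : γ t ∈ (extChartAt 𝓘(ℝ, E) x₀).source)
    (hγ : MDifferentiableAt 𝓘(ℝ, ℝ) 𝓘(ℝ, E) γ t)
    (hξ : HasDerivAt (fun s ↦ chartCoord x₀ L (γ s)) ξ t) :
    ‖mfderiv 𝓘(ℝ, ℝ) 𝓘(ℝ, E) γ t 1‖ ^ 2 = normalMetric x₀ L (chartCoord x₀ L (γ t)) ξ ξ := by
  rw [hξ.unique (hasDerivAt_chartCoord_comp ht hγ)]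
  exact (normalMetric_coordDifferential ht _).symm

theorem contDiffOn_normalMetric [FiniteDimensional ℝ E]
    [IsContMDiffRiemannianBundle 𝓘(ℝ, E) ∞ E (fun x : M ↦ TangentSpace 𝓘(ℝ, E) x)] :
    ContDiffOn ℝ ∞ (normalMetric x₀ L) (chartDomain x₀ L) := by
  have : FiniteDimensional ℝ V := L.symm.toLinearEquiv.finiteDimensional
  refine contDiffOn_clm_apply.2 fun v ↦ contDiffOn_clm_apply.2 fun w ↦ ?_
  have h1 := (contDiffOn_coordinateMetric x₀).comp (s := chartDomain x₀ L)
    (f := fun u : V ↦ extChartAt 𝓘(ℝ, E) x₀ x₀ + L u) (by fun_prop) fun u hu ↦ hu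
  exact (h1.clm_apply contDiffOn_const).clm_apply contDiffOn_const

end LinearChart

/-! ### Comparison of the distance with the metric in coordinates. -/

section NormalCoordinates

variable {E : Type*} [NormedAddCommGroup E] [NormedSpace ℝ E]
  {M : Type*} [MetricSpace M] [ChartedSpace E M] [IsManifold 𝓘(ℝ, E) ∞ M]
  [RiemannianBundle (fun x : M ↦ TangentSpace 𝓘(ℝ, E) x)]
  {x₀ : M}

section

variable {V : Type*} [NormedAddCommGroup V] [NormedSpace ℝ V] {L : V ≃L[ℝ] E}

/-- The coordinate segment is a competitor of speed at most Q. -/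
theorem dist_chartParam_le [IsRiemannianManifold 𝓘(ℝ, E) M] {u v : V} {Q : ℝ} (hQ : 0 ≤ Q)
    (hd : ∀ t ∈ Icc (0 : ℝ) 1, u + t • (v - u) ∈ chartDomain x₀ L)
    (hg : ∀ t ∈ Icc (0 : ℝ) 1,
      normalMetric x₀ L (u + t • (v - u)) (v - u) (v - u) ≤ Q ^ 2) :
    dist (chartParam x₀ L u) (chartParam x₀ L v) ≤ Q := by
  let η : ℝ → V := fun t ↦ u + t • (v - u)
  have hη : ContDiff ℝ 1 η := by fun_prop
  have hηd : ∀ t, HasDerivAt η (v - u) t := fun t ↦ by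
    have := ((hasDerivAt_id t).smul_const (v - u)).const_add u
    rwa [one_smul] at this
  let γ : ℝ → M := fun t ↦ chartParam x₀ L (η t)
  have hγ : ContMDiffOn 𝓘(ℝ, ℝ) 𝓘(ℝ, E) 1 γ (Icc 0 1) :=
    (contMDiffOn_chartParam.of_le (by simp)).comp hη.contMDiff.contMDiffOn fun t ht ↦ hd t ht
  have h1 := riemannianEDist_le_pathELength hγ (x := chartParam x₀ L u) (y := chartParam x₀ L v)
    (by simp [γ, η]) (by simp [γ, η]) zero_le_one
  rw [← IsRiemannianManifold.out (I := 𝓘(ℝ, E)), pathELength_eq_lintegral_mfderiv_Ioo] at h1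
  have h2 : ∫⁻ t in Ioo (0 : ℝ) 1, ‖mfderiv 𝓘(ℝ, ℝ) 𝓘(ℝ, E) γ t 1‖ₑ ≤
      ∫⁻ _ in Ioo (0 : ℝ) 1, ENNReal.ofReal Q := by
    refine setLIntegral_mono' measurableSet_Ioo fun t ht ↦ ?_
    have ht' : t ∈ Icc (0 : ℝ) 1 := Ioo_subset_Icc_self ht
    have hmd : MDifferentiableAt 𝓘(ℝ, ℝ) 𝓘(ℝ, E) γ t :=
      (hγ.contMDiffAt (Icc_mem_nhds ht.1 ht.2)).mdifferentiableAt one_ne_zero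
    have hs := chartParam_mem_source (hd t ht')
    have hder : HasDerivAt (fun s ↦ chartCoord x₀ L (γ s)) (v - u) t := by
      refine (hηd t).congr_of_eventuallyEq ?_
      filter_upwards [Icc_mem_nhds ht.1 ht.2] with s hs
      exact chartCoord_chartParam (hd s hs)
    have h3 := norm_mfderiv_sq_eq_normalMetric hs hmd hder
    rw [show chartCoord x₀ L (γ t) = u + t • (v - u) from chartCoord_chartParam (hd t ht')] at h3
    rw [← ofReal_norm]
    exact ENNReal.ofReal_le_ofReal (le_of_sq_le_sq (h3.trans_le (hg t ht')) hQ)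
  have h3 := h1.trans h2
  rw [edist_dist] at h3
  simpa [ENNReal.ofReal_le_ofReal_iff hQ] using h3

/-- Integration of the derivative of Λ along the curve. It serves with Λ the identity, for a coarse
bound, and with Λ a calibrating covector, for the sharp one. -/
theorem norm_map_chartCoord_sub_le {F : Type*} [NormedAddCommGroup F] [NormedSpace ℝ F]
    (Λ : V →L[ℝ] F) {A ℓ τ : ℝ} (hA : 0 ≤ A) (hℓ : 0 ≤ ℓ) {γ : ℝ → M}
    (hγ : ContMDiff 𝓘(ℝ, ℝ) 𝓘(ℝ, E) 1 γ)
    (hlen : pathELength 𝓘(ℝ, E) γ 0 1 ≤ ENNReal.ofReal ℓ) (hτ : τ ∈ Icc (0 : ℝ) 1)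
    (hs : ∀ t ∈ Icc 0 τ, γ t ∈ (extChartAt 𝓘(ℝ, E) x₀).source)
    (hΛ : ∀ t ∈ Icc 0 τ, ∀ ξ,
      ‖Λ ξ‖ ^ 2 ≤ A ^ 2 * normalMetric x₀ L (chartCoord x₀ L (γ t)) ξ ξ) :
    ‖Λ (chartCoord x₀ L (γ τ) - chartCoord x₀ L (γ 0))‖ ≤ A * ℓ := by
  have hmd : ∀ t, MDifferentiableAt 𝓘(ℝ, ℝ) 𝓘(ℝ, E) γ t := hγ.mdifferentiable one_ne_zero
  have hc : ContDiffOn ℝ 1 (fun t ↦ chartCoord x₀ L (γ t)) (Icc 0 τ) :=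
    ((contMDiffOn_chartCoord.of_le (by simp)).comp hγ.contMDiffOn hs).contDiffOn
  have h1 := enorm_sub_le_lintegral_deriv_of_contDiffOn_Icc (Λ.contDiff.comp_contDiffOn hc) hτ.1
  have h2 : ∫⁻ t in Icc 0 τ, ‖deriv (Λ ∘ fun t ↦ chartCoord x₀ L (γ t)) t‖ₑ ≤
      ∫⁻ t in Icc 0 τ, ENNReal.ofReal A * ‖mfderiv 𝓘(ℝ, ℝ) 𝓘(ℝ, E) γ t 1‖ₑ := by
    refine setLIntegral_mono' measurableSet_Icc fun t ht ↦ ?_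
    have hd := hasDerivAt_chartCoord_comp (L := L) (hs t ht) (hmd t)
    rw [(Λ.hasFDerivAt.comp_hasDerivAt t hd).deriv, ← ofReal_norm, ← ofReal_norm,
      ← ENNReal.ofReal_mul hA]
    refine ENNReal.ofReal_le_ofReal (le_of_sq_le_sq ?_ (by positivity))
    rw [mul_pow, norm_mfderiv_sq_eq_normalMetric (hs t ht) (hmd t) hd]
    exact hΛ t ht _
  have h3 : ∫⁻ t in Icc 0 τ, ENNReal.ofReal A * ‖mfderiv 𝓘(ℝ, ℝ) 𝓘(ℝ, E) γ t 1‖ₑ ≤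
      ENNReal.ofReal (A * ℓ) := by
    rw [lintegral_const_mul' _ _ ENNReal.ofReal_ne_top, ENNReal.ofReal_mul hA,
      ← pathELength_eq_lintegral_mfderiv_Icc]
    exact mul_le_mul_right ((pathELength_mono le_rfl hτ.2).trans hlen) _
  have h4 := (h1.trans h2).trans h3
  simp only [Function.comp_apply] at h4
  rw [← ofReal_norm, ENNReal.ofReal_le_ofReal_iff (by positivity)] at h4
  rwa [map_sub]

end

section

variable {V : Type*} [NormedAddCommGroup V] [InnerProductSpace ℝ V] {L : V ≃L[ℝ] E}

noncomputable local instance : NormedAddCommGroup (V →L[ℝ] V →L[ℝ] ℝ) :=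
  ContinuousLinearMap.toNormedAddCommGroup

noncomputable local instance : NormedSpace ℝ (V →L[ℝ] V →L[ℝ] ℝ) :=
  ContinuousLinearMap.toNormedSpace

/-- The domain on which the metric in the coordinates is under control. -/
structure IsMetricControlledOn (x₀ : M) (L : V ≃L[ℝ] E) (C R : ℝ) : Prop where
  subset_domain : Metric.ball (0 : V) R ⊆ chartDomain x₀ L
  abs_sub_le : ∀ u ∈ Metric.ball (0 : V) R, ∀ v ∈ Metric.ball (0 : V) R, ∀ ξ,
    |normalMetric x₀ L u ξ ξ - normalMetric x₀ L v ξ ξ| ≤ C * ‖u - v‖ * ‖ξ‖ ^ 2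
  le_four : ∀ u ∈ Metric.ball (0 : V) R, ∀ ξ, normalMetric x₀ L u ξ ξ ≤ 4 * ‖ξ‖ ^ 2
  four_le : ∀ u ∈ Metric.ball (0 : V) R, ∀ ξ, ‖ξ‖ ^ 2 ≤ 4 * normalMetric x₀ L u ξ ξ

theorem exists_isMetricControlledOn [FiniteDimensional ℝ E]
    [IsContMDiffRiemannianBundle 𝓘(ℝ, E) ∞ E (fun x : M ↦ TangentSpace 𝓘(ℝ, E) x)]
    (hL : ∀ v w, normalMetric x₀ L 0 v w = inner ℝ v w) :
    ∃ C ≥ 0, ∃ R > 0, IsMetricControlledOn x₀ L C R := by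
  have hc : ContDiffAt ℝ 1 (normalMetric x₀ L) 0 :=
    (contDiffOn_normalMetric.contDiffAt chartDomain_mem_nhds).of_le (by simp)
  obtain ⟨C, s, hs, hlip⟩ := hc.exists_lipschitzOnWith
  -- On the ball of radius 1/(2(C + 1)) the metric differs from the inner product by at most half of
  -- it, well within the factors 1/4 and 4.
  obtain ⟨R, hR, hRs⟩ := Metric.mem_nhds_iff.1
    (inter_mem (inter_mem hs (chartDomain_mem_nhds (x₀ := x₀) (L := L)))
      (Metric.ball_mem_nhds (0 : V) (ε := 1 / (2 * (C + 1))) (by positivity)))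
  have habs : ∀ u ∈ Metric.ball (0 : V) R, ∀ v ∈ Metric.ball (0 : V) R, ∀ ξ,
      |normalMetric x₀ L u ξ ξ - normalMetric x₀ L v ξ ξ| ≤ C * ‖u - v‖ * ‖ξ‖ ^ 2 := by
    intro u hu v hv ξ
    have h1 := hlip.norm_sub_le (hRs hu).1.1 (hRs hv).1.1
    have h2 := (normalMetric x₀ L u - normalMetric x₀ L v).le_opNorm₂ ξ ξ
    simp only [sub_apply, Real.norm_eq_abs] at h2
    calc _ ≤ _ := h2
      _ ≤ C * ‖u - v‖ * ‖ξ‖ * ‖ξ‖ := by gcongr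
      _ = _ := by ring
  have h0 : (0 : V) ∈ Metric.ball (0 : V) R := Metric.mem_ball_self hR
  have hhalf : ∀ u ∈ Metric.ball (0 : V) R, ∀ ξ,
      |normalMetric x₀ L u ξ ξ - ‖ξ‖ ^ 2| ≤ 1 / 2 * ‖ξ‖ ^ 2 := by
    intro u hu ξ
    have h1 := habs u hu 0 h0 ξ
    rw [hL, real_inner_self_eq_norm_sq, sub_zero] at h1
    refine h1.trans (mul_le_mul_of_nonneg_right ?_ (sq_nonneg _))
    have h2 : ‖u‖ < 1 / (2 * (C + 1)) := mem_ball_zero_iff.1 (hRs hu).2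
    have h3 : ((C : ℝ) + 1) * ‖u‖ ≤ (C + 1) * (1 / (2 * (C + 1))) :=
      mul_le_mul_of_nonneg_left h2.le (by positivity)
    have h4 : ((C : ℝ) + 1) * (1 / (2 * (C + 1))) = 1 / 2 := by field_simp
    nlinarith [norm_nonneg u]
  refine ⟨C, C.2, R, hR, fun u hu ↦ (hRs hu).1.2, habs, fun u hu ξ ↦ ?_, fun u hu ξ ↦ ?_⟩
  · have := (abs_le.1 (hhalf u hu ξ)).2
    nlinarith [sq_nonneg ‖ξ‖]
  · have := (abs_le.1 (hhalf u hu ξ)).1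
    nlinarith [sq_nonneg ‖ξ‖]

theorem le_of_forall_Ioo_le_of_continuous {a d r : ℝ} {f : ℝ → ℝ} (hd : d < r)
    (hf : Continuous f) (h : ∀ l ∈ Ioo d r, a ≤ f l) : a ≤ f d :=
  ge_of_tendsto ((hf.tendsto d).mono_left nhdsWithin_le_nhds)
    (Filter.mem_of_superset (Ioo_mem_nhdsGT hd) h)

variable [IsRiemannianManifold 𝓘(ℝ, E) M]

/-- An almost shortest curve, of length less than l, stays in the chart since it begins near x₀.
Coarsely, its coordinates stay within 2l of u, so along it the metric at u exceeds the local metric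
by a factor of at most 1 + 8Cl. The sharp bound follows by calibration, and l decreases to d. -/
theorem IsMetricControlledOn.metric_le {C R : ℝ} (hC : 0 ≤ C)
    (h : IsMetricControlledOn x₀ L C R) {ρ : ℝ}
    (hρ : Metric.ball x₀ ρ ⊆ chartParam x₀ L '' Metric.ball 0 R) {u v : V}
    (hu : u ∈ Metric.ball (0 : V) R) (hv : v ∈ Metric.ball (0 : V) R)
    (hu' : dist (chartParam x₀ L u) x₀ < ρ / 4) (hv' : dist (chartParam x₀ L v) x₀ < ρ / 4) :
    ‖v - u‖ ≤ 2 * dist (chartParam x₀ L u) (chartParam x₀ L v) ∧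
      normalMetric x₀ L u (v - u) (v - u) ≤
        (1 + 8 * C * dist (chartParam x₀ L u) (chartParam x₀ L v)) *
          dist (chartParam x₀ L u) (chartParam x₀ L v) ^ 2 := by
  set d := dist (chartParam x₀ L u) (chartParam x₀ L v) with hd
  have hdρ : d < ρ / 2 := by
    have := dist_triangle_right (chartParam x₀ L u) (chartParam x₀ L v) x₀
    linarith
  have hd0 : 0 ≤ d := dist_nonneg
  have key : ∀ l ∈ Ioo d (ρ / 2), ‖v - u‖ ≤ 2 * l ∧
      normalMetric x₀ L u (v - u) (v - u) ≤ (1 + 8 * C * l) * l ^ 2 := by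
    intro l hl
    have hl0 : 0 ≤ l := hd0.trans hl.1.le
    have hrl : riemannianEDist 𝓘(ℝ, E) (chartParam x₀ L u) (chartParam x₀ L v) <
        ENNReal.ofReal l := by
      rw [← IsRiemannianManifold.out (I := 𝓘(ℝ, E)), edist_dist]
      exact (ENNReal.ofReal_lt_ofReal_iff_of_nonneg dist_nonneg).2 hl.1
    obtain ⟨γ, h0, h1, hγ, hlen, -, -⟩ :=
      exists_lt_locally_constant_of_riemannianEDist_lt hrl zero_lt_one
    have hmem : ∀ t ∈ Icc (0 : ℝ) 1, γ t ∈ (extChartAt 𝓘(ℝ, E) x₀).source ∧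
        chartCoord x₀ L (γ t) ∈ Metric.ball (0 : V) R := by
      intro t ht
      have h2 := dist_add_dist_add_dist_lt_of_pathELength_lt E hγ hlen le_rfl ht.1 ht.2
      rw [dist_self, h0] at h2
      have h3 := dist_triangle_left (γ t) x₀ (chartParam x₀ L u)
      obtain ⟨w, hw, hw'⟩ := hρ (show γ t ∈ Metric.ball x₀ ρ by
        rw [Metric.mem_ball]
        linarith [hl.2, dist_nonneg (x := γ t) (y := γ 1)])
      rw [← hw']
      refine ⟨chartParam_mem_source (h.subset_domain hw), ?_⟩
      rwa [chartCoord_chartParam (h.subset_domain hw)]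
    have hc0 : chartCoord x₀ L (γ 0) = u := by
      rw [h0, chartCoord_chartParam (h.subset_domain hu)]
    have hc1 : chartCoord x₀ L (γ 1) = v := by
      rw [h1, chartCoord_chartParam (h.subset_domain hv)]
    have coarse : ∀ t ∈ Icc (0 : ℝ) 1, ‖chartCoord x₀ L (γ t) - u‖ ≤ 2 * l := by
      intro t ht
      have := norm_map_chartCoord_sub_le (L := L) (x₀ := x₀) (ContinuousLinearMap.id ℝ V)
        (A := 2) (by norm_num) hl0 hγ hlen.le ht
        (fun s hs ↦ (hmem s ⟨hs.1, hs.2.trans ht.2⟩).1)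
        (fun s hs ξ ↦ by
          have := h.four_le _ (hmem s ⟨hs.1, hs.2.trans ht.2⟩).2 ξ
          simp only [ContinuousLinearMap.id_apply]
          linarith)
      rwa [hc0] at this
    have h1mem : (1 : ℝ) ∈ Icc (0 : ℝ) 1 := by simp
    refine ⟨hc1 ▸ coarse 1 h1mem, ?_⟩
    set G := normalMetric x₀ L u (v - u) (v - u) with hG
    have hG0 : 0 ≤ G := normalMetric_self_nonneg _ _
    have hA0 : 0 ≤ G * (1 + 8 * C * l) := by positivity
    -- The calibrating covector g_u(v - u, ·) takes the value G on v - u, and by Cauchy–Schwarz its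
    -- square at ξ is at most G g_u(ξ, ξ). Hence G² ≤ G(1 + 8Cl)l², and one factor G cancels.
    have fine := norm_map_chartCoord_sub_le (L := L) (x₀ := x₀) (normalMetric x₀ L u (v - u))
      (A := √(G * (1 + 8 * C * l))) (Real.sqrt_nonneg _) hl0 hγ hlen.le h1mem
      (fun s hs ↦ (hmem s hs).1) (fun s hs ξ ↦ by
        have e1 := normalMetric_mul_self_le (x₀ := x₀) (L := L) u (v - u) ξ
        have e2 := (abs_le.1 (h.abs_sub_le u hu _ (hmem s hs).2 ξ)).2
        have e3 := h.four_le _ (hmem s hs).2 ξ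
        have e4 : C * ‖u - chartCoord x₀ L (γ s)‖ * ‖ξ‖ ^ 2 ≤ C * (2 * l) *
            (4 * normalMetric x₀ L (chartCoord x₀ L (γ s)) ξ ξ) := by
          rw [norm_sub_rev]
          have := coarse s hs
          gcongr
        rw [Real.sq_sqrt hA0, Real.norm_eq_abs, sq_abs, mul_assoc]
        refine e1.trans (mul_le_mul_of_nonneg_left ?_ hG0)
        linarith)
    rw [hc0, hc1, ← hG, Real.norm_of_nonneg hG0] at fine
    have h5 : G ^ 2 ≤ G * ((1 + 8 * C * l) * l ^ 2) := by
      calc G ^ 2 ≤ (√(G * (1 + 8 * C * l)) * l) ^ 2 := by gcongr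
        _ = _ := by rw [mul_pow, Real.sq_sqrt hA0]; ring
    rcases hG0.eq_or_lt with h6 | h6
    · rw [← h6]; positivity
    · rw [sq] at h5
      exact le_of_mul_le_mul_left h5 h6
  exact ⟨le_of_forall_Ioo_le_of_continuous (f := fun l ↦ 2 * l) hdρ (by fun_prop)
    fun l hl ↦ (key l hl).1,
    le_of_forall_Ioo_le_of_continuous (f := fun l ↦ (1 + 8 * C * l) * l ^ 2) hdρ (by fun_prop)
    fun l hl ↦ (key l hl).2⟩

/-- On the segment from u to v the metric differs from that at u by at most C‖v - u‖. -/
theorem IsMetricControlledOn.dist_sq_le {C R : ℝ} (hC : 0 ≤ C)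
    (h : IsMetricControlledOn x₀ L C R) {u v : V}
    (hu : u ∈ Metric.ball (0 : V) R) (hv : v ∈ Metric.ball (0 : V) R) :
    dist (chartParam x₀ L u) (chartParam x₀ L v) ≤ 2 * ‖v - u‖ ∧
      dist (chartParam x₀ L u) (chartParam x₀ L v) ^ 2 ≤
        normalMetric x₀ L u (v - u) (v - u) + C * ‖v - u‖ ^ 3 := by
  have hseg : ∀ t ∈ Icc (0 : ℝ) 1, u + t • (v - u) ∈ Metric.ball (0 : V) R := fun t ht ↦
    (convex_ball (0 : V) R).add_smul_sub_mem hu hv ht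
  have hG0 := normalMetric_self_nonneg (x₀ := x₀) (L := L) u (v - u)
  refine ⟨dist_chartParam_le (by positivity) (fun t ht ↦ h.subset_domain (hseg t ht))
    fun t ht ↦ (h.le_four _ (hseg t ht) _).trans_eq (by ring), ?_⟩
  have h1 : dist (chartParam x₀ L u) (chartParam x₀ L v) ≤
      √(normalMetric x₀ L u (v - u) (v - u) + C * ‖v - u‖ ^ 3) := by
    refine dist_chartParam_le (Real.sqrt_nonneg _) (fun t ht ↦ h.subset_domain (hseg t ht))
      fun t ht ↦ ?_
    rw [Real.sq_sqrt (by positivity)]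
    have h2 := (abs_le.1 (h.abs_sub_le _ (hseg t ht) u hu (v - u))).2
    have h3 : ‖u + t • (v - u) - u‖ ≤ ‖v - u‖ := by
      rw [add_sub_cancel_left, norm_smul, Real.norm_of_nonneg ht.1]
      exact mul_le_of_le_one_left (norm_nonneg _) ht.2
    have h4 : C * ‖u + t • (v - u) - u‖ * ‖v - u‖ ^ 2 ≤ C * ‖v - u‖ * ‖v - u‖ ^ 2 := by gcongr
    nlinarith
  calc _ ≤ √(normalMetric x₀ L u (v - u) (v - u) + C * ‖v - u‖ ^ 3) ^ 2 := by gcongr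
    _ = _ := Real.sq_sqrt (by positivity)

/-- Coordinates which are orthonormal at `x₀` form a normal model of the manifold. -/
theorem isNormalModel_chartParam [FiniteDimensional ℝ E]
    [IsContMDiffRiemannianBundle 𝓘(ℝ, E) ∞ E (fun x : M ↦ TangentSpace 𝓘(ℝ, E) x)]
    (hL : ∀ v w, normalMetric x₀ L 0 v w = inner ℝ v w) :
    IsNormalModel (chartParam x₀ L) (normalMetric x₀ L) where
  contDiffAt := (contDiffOn_normalMetric.contDiffAt chartDomain_mem_nhds).of_le
    (WithTop.coe_le_coe.2 le_top)
  symm := .of_forall fun u v w ↦ normalMetric_symm u v w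
  metric_zero := hL
  image_mem_nhds U hU := by
    rw [chartParam_zero]
    exact chartParam_image_mem_nhds hU
  dist_sq := by
    obtain ⟨C, hC, R, hR, h⟩ := exists_isMetricControlledOn hL
    obtain ⟨ρ, hρ, hρR⟩ := Metric.mem_nhds_iff.1
      (chartParam_image_mem_nhds (x₀ := x₀) (L := L) (Metric.ball_mem_nhds (0 : V) hR))
    have hcont : ContinuousAt (chartParam x₀ L) 0 :=
      continuousAt_chartParam (mem_of_mem_nhds chartDomain_mem_nhds)
    have hnear : ∀ᶠ u in 𝓝 (0 : V), dist (chartParam x₀ L u) x₀ < ρ / 4 := by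
      have := hcont.tendsto
      rw [chartParam_zero] at this
      exact this (Metric.ball_mem_nhds x₀ (by positivity))
    obtain ⟨R', hR', hR'R⟩ := Metric.eventually_nhds_iff_ball.1 hnear
    -- The error 8C d³ with d ≤ 2‖v - u‖ gives 64C; the summand 1 makes the constant positive.
    refine ⟨64 * C + 1, by positivity, min R R', lt_min hR hR', fun u hu v hv ↦ ?_⟩
    have hu1 := Metric.ball_subset_ball (min_le_left R R') hu
    have hv1 := Metric.ball_subset_ball (min_le_left R R') hv
    obtain ⟨-, h2⟩ := h.metric_le hC hρR hu1 hv1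
      (hR'R u (Metric.ball_subset_ball (min_le_right R R') hu))
      (hR'R v (Metric.ball_subset_ball (min_le_right R R') hv))
    obtain ⟨h3, h4⟩ := h.dist_sq_le hC hu1 hv1
    have h5 : C * dist (chartParam x₀ L u) (chartParam x₀ L v) ^ 3 ≤ C * (2 * ‖v - u‖) ^ 3 := by
      gcongr
    have h6 : 0 ≤ C * ‖v - u‖ ^ 3 := by positivity
    have h7 : 0 ≤ ‖v - u‖ ^ 3 := by positivity
    rw [abs_le]
    constructor <;> nlinarith

end

end NormalCoordinates

/-! ### The implicit Euler step on a vector space. -/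

section ImplicitStep

variable {V : Type*} [NormedAddCommGroup V] [InnerProductSpace ℝ V] [FiniteDimensional ℝ V]

/-- The conditions on the restriction of a Hamiltonian to a fibre. -/
structure IsFibreHamiltonian (G : (V →L[ℝ] ℝ) → ℝ) : Prop where
  continuous : Continuous G
  strictConvexOn : StrictConvexOn ℝ univ G
  superlinear : ∀ K : ℝ, ∃ C : ℝ, ∀ p, K * ‖p‖ - C ≤ G p

variable {G : (V →L[ℝ] ℝ) → ℝ}

theorem IsFibreHamiltonian.exists_isMinOn (hG : IsFibreHamiltonian G) (w : V) {S : Set (V →L[ℝ] ℝ)}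
    (hS : IsClosed S) (hne : S.Nonempty) : ∃ q ∈ S, ∀ p ∈ S, G q - q w ≤ G p - p w := by
  obtain ⟨p₀, hp₀⟩ := hne
  obtain ⟨C, hC⟩ := hG.superlinear (‖w‖ + 1)
  have hc : Continuous fun p : V →L[ℝ] ℝ ↦ G p - p w :=
    hG.continuous.sub (by fun_prop)
  obtain ⟨q, hq, hmin⟩ := hc.continuousOn.exists_isMinOn' hS hp₀ (by
    refine Filter.Eventually.filter_mono inf_le_left ?_
    filter_upwards [(tendsto_norm_cocompact_atTop (E := V →L[ℝ] ℝ)).eventually_ge_atTop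
      (G p₀ - p₀ w + C)] with p hp
    have h1 := hC p
    have h2 := (le_abs_self _).trans (Real.norm_eq_abs _ ▸ p.le_opNorm w)
    nlinarith)
  exact ⟨q, hq, fun p hp ↦ hmin hp⟩

theorem IsFibreHamiltonian.eq_of_isMinOn (hG : IsFibreHamiltonian G) (w : V)
    {S : Set (V →L[ℝ] ℝ)} (hS : Convex ℝ S) {q q' : V →L[ℝ] ℝ} (hq : q ∈ S) (hq' : q' ∈ S)
    (h : ∀ p ∈ S, G q - q w ≤ G p - p w) (h' : ∀ p ∈ S, G q' - q' w ≤ G p - p w) : q = q' := by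
  by_contra hne
  obtain ⟨-, hsc⟩ := hG.strictConvexOn
  have h1 := hsc (mem_univ q) (mem_univ q') hne (a := 1 / 2) (b := 1 / 2)
    (by norm_num) (by norm_num) (by norm_num)
  have h2 := h _ (hS hq hq' (a := 1 / 2) (b := 1 / 2) (by norm_num) (by norm_num) (by norm_num))
  have h3 := h' q hq
  simp only [add_apply, smul_apply, smul_eq_mul] at h1 h2
  linarith

/-- The implicit Euler step: a maximizer `u + τ w` of `y ↦ f y - τ L ((y - u) / τ)`, where `L` is
the convex conjugate of `G`. -/
theorem IsFibreHamiltonian.exists_isSuperdifferentialAt_subgradient (hG : IsFibreHamiltonian G)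
    {f : V → ℝ} {u : V} {r K B τ : ℝ} (hK : 0 ≤ K) (hfc : ContinuousOn f (Metric.closedBall u r))
    (hf : ∀ y ∈ Metric.closedBall u r, f y ≤ f u + K * ‖y - u‖)
    (hB : ∀ p, ‖p‖ ≤ K + 1 → G p ≤ B) (hB' : ∀ p, -B ≤ G p) (hτ : 0 < τ) (hr : 2 * B * τ < r) :
    ∃ w : V, ∃ q : V →L[ℝ] ℝ, ‖w‖ ≤ 2 * B ∧ IsSuperdifferentialAt f (u + τ • w) q ∧
      ∀ p, G q + (p w - q w) ≤ G p := by
  -- P w is the maximizer of p ↦ p w - G p, that is, the gradient at w of the conjugate L of G.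
  choose P hPS hP using fun w : V ↦ hG.exists_isMinOn w isClosed_univ univ_nonempty
  replace hP : ∀ w p, G (P w) - P w w ≤ G p - p w := fun w p ↦ hP w p (mem_univ _)
  have hB0 : 0 ≤ B := by
    have h1 := hB 0 (by simpa using by linarith)
    have h2 := hB' 0
    linarith
  -- Superlinearity keeps P bounded near w₀, and every limit point is a maximizer at w₀, which
  -- strict convexity makes unique.
  have hPc : Continuous P := by
    refine continuous_iff_continuousAt.2 fun w₀ ↦ (tendsto_iff_ultrafilter _ _ _).2 fun U hU ↦ ?_
    obtain ⟨C, hC⟩ := hG.superlinear (‖w₀‖ + 2)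
    have hbd : ∀ᶠ w in (U : Filter V), P w ∈ Metric.closedBall 0 (G 0 + C) := by
      filter_upwards [hU (Metric.ball_mem_nhds w₀ one_pos)] with w hw
      have h1 := hP w 0
      have h2 := hC (P w)
      have h3 := (le_abs_self _).trans (Real.norm_eq_abs _ ▸ (P w).le_opNorm w)
      have h4 : ‖w‖ ≤ ‖w₀‖ + 1 := by
        have := norm_le_norm_add_norm_sub' w w₀
        rw [mem_ball_iff_norm] at hw
        linarith
      have h5 := mul_le_mul_of_nonneg_left h4 (norm_nonneg (P w))
      simp only [zero_apply, sub_zero] at h1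
      rw [mem_closedBall_zero_iff]
      linarith
    obtain ⟨q, -, hq⟩ := (isCompact_closedBall (0 : V →L[ℝ] ℝ) (G 0 + C)).ultrafilter_le_nhds
      (U.map P) (le_principal_iff.2 hbd)
    have hq' : Tendsto P U (𝓝 q) := hq
    have hU' : Tendsto (fun w : V ↦ w) (U : Filter V) (𝓝 w₀) := hU
    have hqmin : ∀ p, G q - q w₀ ≤ G p - p w₀ := fun p ↦
      le_of_tendsto_of_tendsto'
        (((hG.continuous.tendsto q).comp hq').sub
          ((isBoundedBilinearMap_apply.continuous.tendsto (q, w₀)).comp (hq'.prodMk_nhds hU')))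
        (tendsto_const_nhds.sub ((p.continuous.tendsto w₀).comp hU')) fun w ↦ hP w p
    have := hG.eq_of_isMinOn w₀ convex_univ (mem_univ q) (mem_univ (P w₀))
      (fun p _ ↦ hqmin p) fun p _ ↦ hP w₀ p
    rwa [← this]
  set L : V → ℝ := fun w ↦ P w w - G (P w) with hL
  have hLc : Continuous L :=
    (isBoundedBilinearMap_apply.continuous.comp (hPc.prodMk continuous_id)).sub
      (hG.continuous.comp hPc)
  have hLge : ∀ w p, p w - G p ≤ L w := fun w p ↦ by have := hP w p; simp only [hL]; linarith
  have hr0 : 0 ≤ r := by nlinarith [mul_nonneg hB0 hτ.le]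
  obtain ⟨y, hy, hmax⟩ := (isCompact_closedBall u r).exists_isMaxOn
    (Metric.nonempty_closedBall.2 hr0)
    (f := fun y ↦ f y - τ * L (τ⁻¹ • (y - u)))
    (hfc.sub (continuous_const.mul (hLc.comp (by fun_prop))).continuousOn)
  set w := τ⁻¹ • (y - u) with hw
  have hyw : y = u + τ • w := by
    rw [hw, smul_smul, mul_inv_cancel₀ hτ.ne', one_smul, add_sub_cancel]
  have hyu : ‖y - u‖ = τ * ‖w‖ := by
    rw [hyw, add_sub_cancel_left, norm_smul, Real.norm_of_nonneg hτ.le]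
  -- Comparison of the maximizer with u. The bound of G on the ball of radius K + 1, one more than
  -- the Lipschitz constant of f, makes L grow with slope K + 1, so that f cannot compensate. It
  -- also puts y in the open ball.
  have hwB : ‖w‖ ≤ 2 * B := by
    have h1 : f u - τ * L (τ⁻¹ • (u - u)) ≤ f y - τ * L w :=
      hmax (Metric.mem_closedBall_self hr0)
    rw [sub_self, smul_zero] at h1
    have h2 : L 0 ≤ B := by
      have := hB' (P 0)
      simp only [hL, map_zero]
      linarith
    obtain ⟨g, hg, hgw⟩ := exists_dual_vector'' ℝ w
    have h3 : (K + 1) * ‖w‖ - B ≤ L w := by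
      have h4 := hLge w ((K + 1) • g)
      have h5 := hB ((K + 1) • g) (by
        rw [norm_smul, Real.norm_of_nonneg (by positivity)]
        exact mul_le_of_le_one_right (by positivity) hg)
      rw [smul_apply, hgw, smul_eq_mul] at h4
      simp only [RCLike.ofReal_real_eq_id, id_eq] at h4
      linarith
    have h6 := hf y hy
    rw [hyu] at h6
    have h7 : τ * ((K + 1) * ‖w‖ - B) ≤ τ * L w := mul_le_mul_of_nonneg_left h3 hτ.le
    have h8 : τ * L 0 ≤ τ * B := mul_le_mul_of_nonneg_left h2 hτ.le
    have h9 : τ * ‖w‖ ≤ τ * (2 * B) := by nlinarith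
    exact le_of_mul_le_mul_left h9 hτ
  refine ⟨w, P w, hwB, ?_, fun p ↦ by linarith [hP w p]⟩
  rw [← hyw]
  have hyball : y ∈ Metric.ball u r := by
    rw [mem_ball_iff_norm, hyu]
    nlinarith
  intro ε hε
  -- At an interior maximum the increments of f are at most those of τL, which are at most P w' (y'
  -- - y); continuity of P replaces P w' by P w up to ε.
  have hcont : ContinuousAt (fun y' ↦ P (τ⁻¹ • (y' - u))) y :=
    (hPc.comp (by fun_prop)).continuousAt
  have hnear := hcont.eventually (Metric.ball_mem_nhds _ hε)
  filter_upwards [hnear, Metric.isOpen_ball.mem_nhds hyball] with y' h1 h2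
  have h3 : f y' - τ * L (τ⁻¹ • (y' - u)) ≤ f y - τ * L w := hmax (Metric.ball_subset_closedBall h2)
  set w' := τ⁻¹ • (y' - u) with hw'
  have h4 := hLge w (P w')
  have h5 : L w' - L w ≤ P w' (w' - w) := by
    simp only [map_sub]
    simp only [hL] at h4 ⊢
    linarith
  have h6 : w' - w = τ⁻¹ • (y' - y) := by rw [hw, hw', ← smul_sub, sub_sub_sub_cancel_right]
  rw [h6, map_smul, smul_eq_mul] at h5
  have h7 : τ * (L w' - L w) ≤ P w' (y' - y) := by
    have := mul_le_mul_of_nonneg_left h5 hτ.le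
    rwa [← mul_assoc, mul_inv_cancel₀ hτ.ne', one_mul] at this
  have h8 : (P w' - P w) (y' - y) ≤ ε * ‖y' - y‖ := by
    refine (le_abs_self _).trans ((Real.norm_eq_abs _ ▸ (P w' - P w).le_opNorm _).trans ?_)
    exact mul_le_mul_of_nonneg_right (mem_ball_iff_norm.1 h1).le (norm_nonneg _)
  rw [sub_apply] at h8
  linarith

end ImplicitStep

/-! ### A function and a Hamiltonian in coordinates. -/

section LocalSystem

variable {V : Type*} [NormedAddCommGroup V] [InnerProductSpace ℝ V]

/-- An approximately concave Lipschitz function together with a Hamiltonian in coordinates. -/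
structure IsLocalSystem (f : V → ℝ) (h : V → (V →L[ℝ] ℝ) → ℝ) (r K B : ℝ) : Prop where
  pos : 0 < r
  nonneg : 0 ≤ K
  isApproxConcave : IsApproxConcave f
  abs_sub_le : ∀ u ∈ Metric.ball (0 : V) r, ∀ v ∈ Metric.ball (0 : V) r,
    |f u - f v| ≤ K * ‖u - v‖
  continuousOn : ContinuousOn (fun z : V × (V →L[ℝ] ℝ) ↦ h z.1 z.2) (Metric.ball 0 r ×ˢ univ)
  isFibreHamiltonian : ∀ u ∈ Metric.ball (0 : V) r, IsFibreHamiltonian (h u)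
  le : ∀ u ∈ Metric.ball (0 : V) r, ∀ p, ‖p‖ ≤ K + 1 → h u p ≤ B
  neg_le : ∀ u ∈ Metric.ball (0 : V) r, ∀ p, -B ≤ h u p

variable {f : V → ℝ} {h : V → (V →L[ℝ] ℝ) → ℝ} {r K B : ℝ}

theorem IsLocalSystem.norm_le (hs : IsLocalSystem f h r K B) {u : V}
    (hu : u ∈ Metric.ball (0 : V) r) {q : V →L[ℝ] ℝ} (hq : IsSuperdifferentialAt f u q) :
    ‖q‖ ≤ K :=
  hq.norm_le hs.nonneg ((Metric.isOpen_ball.eventually_mem hu).mono fun v hv ↦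
    hs.abs_sub_le u hu v hv)

theorem IsLocalSystem.continuousAt (hs : IsLocalSystem f h r K B) {u : V}
    (hu : u ∈ Metric.ball (0 : V) r) : ContinuousAt f u := by
  have h1 : LipschitzOnWith K.toNNReal f (Metric.ball 0 r) := by
    refine LipschitzOnWith.of_dist_le_mul fun u hu v hv ↦ ?_
    rw [Real.dist_eq, dist_eq_norm, Real.coe_toNNReal _ hs.nonneg]
    exact hs.abs_sub_le u hu v hv
  exact h1.continuousOn.continuousAt (Metric.isOpen_ball.mem_nhds hu)

theorem IsLocalSystem.continuousAt_hamiltonian (hs : IsLocalSystem f h r K B) {u : V}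
    (hu : u ∈ Metric.ball (0 : V) r) (p : V →L[ℝ] ℝ) :
    ContinuousAt (fun z : V × (V →L[ℝ] ℝ) ↦ h z.1 z.2) (u, p) :=
  hs.continuousOn.continuousAt ((Metric.isOpen_ball.prod isOpen_univ).mem_nhds ⟨hu, mem_univ _⟩)

theorem IsLocalSystem.zero_mem (hs : IsLocalSystem f h r K B) : (0 : V) ∈ Metric.ball (0 : V) r :=
  Metric.mem_ball_self hs.pos

theorem isSuperdifferentialAt_convex (f : V → ℝ) (u : V) :
    Convex ℝ {q | IsSuperdifferentialAt f u q} := by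
  intro p hp q hq a b ha hb hab ε hε
  filter_upwards [hp ε hε, hq ε hε] with v h1 h2
  rw [add_apply, smul_apply, smul_apply, smul_eq_mul, smul_eq_mul]
  have h3 := add_le_add (mul_le_mul_of_nonneg_left h1 ha) (mul_le_mul_of_nonneg_left h2 hb)
  have h4 : f v = a * f v + b * f v := by rw [← add_mul, hab, one_mul]
  have h5 : a * (f u + p (v - u) + ε * ‖v - u‖) + b * (f u + q (v - u) + ε * ‖v - u‖) =
      (a + b) * (f u + ε * ‖v - u‖) + (a * p (v - u) + b * q (v - u)) := by ring
  rw [hab] at h5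
  linarith

variable [FiniteDimensional ℝ V]

theorem IsLocalSystem.isClosed (hs : IsLocalSystem f h r K B) :
    IsClosed {q | IsSuperdifferentialAt f 0 q} := by
  refine isClosed_iff_ultrafilter.2 fun q U hU hm ↦ ?_
  exact hs.isApproxConcave.isSuperdifferentialAt_of_tendsto (hs.continuousAt hs.zero_mem)
    (L := (U : Filter (V →L[ℝ] ℝ))) (u := fun _ ↦ 0) (p := id) tendsto_const_nhds hU hm

theorem IsLocalSystem.exists_step (hs : IsLocalSystem f h r K B) {u : V} {τ : ℝ} (hτ : 0 < τ)
    (hu : ‖u‖ + 2 * B * τ < r) : ∃ w : V, ∃ q : V →L[ℝ] ℝ, ‖w‖ ≤ 2 * B ∧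
      IsSuperdifferentialAt f (u + τ • w) q ∧ ∀ p, h u q + (p w - q w) ≤ h u p := by
  have hB0 : 0 ≤ B := by
    have h1 := hs.le 0 hs.zero_mem 0 (by simpa using by linarith [hs.nonneg])
    have h2 := hs.neg_le 0 hs.zero_mem 0
    linarith
  obtain ⟨ρ, hρ, hρr⟩ := exists_between (show 2 * B * τ < r - ‖u‖ by linarith)
  have hmem : Metric.closedBall u ρ ⊆ Metric.ball 0 r := by
    intro y hy
    rw [mem_closedBall_iff_norm] at hy
    rw [mem_ball_zero_iff]
    have := norm_le_norm_add_norm_sub' y u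
    linarith
  have hum : u ∈ Metric.ball (0 : V) r :=
    hmem (Metric.mem_closedBall_self (by nlinarith [mul_nonneg hB0 hτ.le]))
  exact (hs.isFibreHamiltonian u hum).exists_isSuperdifferentialAt_subgradient hs.nonneg
    (fun y hy ↦ (hs.continuousAt (hmem hy)).continuousWithinAt)
    (fun y hy ↦ by
      have := (le_abs_self _).trans (hs.abs_sub_le y (hmem hy) u hum)
      linarith)
    (hs.le u hum) (hs.neg_le u hum) hτ hρ

/-- Implicit steps from 0 with τ → 0 give bounded superdifferentials at points tending to 0, and a
limit point belongs to the superdifferential at 0. -/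
theorem IsLocalSystem.nonempty (hs : IsLocalSystem f h r K B) :
    {q | IsSuperdifferentialAt f 0 q}.Nonempty := by
  have h1 : ∀ᶠ τ in 𝓝[>] (0 : ℝ), 2 * B * τ < r := by
    have : ContinuousAt (fun τ : ℝ ↦ 2 * B * τ) 0 := by fun_prop
    refine nhdsWithin_le_nhds (this.eventually_lt_const ?_)
    simpa using hs.pos
  have h2 : ∀ τ : ℝ, ∃ w : V, ∃ q : V →L[ℝ] ℝ, 0 < τ → 2 * B * τ < r →
      ‖w‖ ≤ 2 * B ∧ IsSuperdifferentialAt f (τ • w) q := by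
    intro τ
    by_cases hτ : 0 < τ ∧ 2 * B * τ < r
    · obtain ⟨w, q, hw, hq, -⟩ := hs.exists_step (u := 0) hτ.1 (by simpa using hτ.2)
      exact ⟨w, q, fun _ _ ↦ ⟨hw, by simpa using hq⟩⟩
    · exact ⟨0, 0, fun h h' ↦ absurd ⟨h, h'⟩ hτ⟩
  choose w q hwq using h2
  have hgood : ∀ᶠ τ in 𝓝[>] (0 : ℝ), ‖w τ‖ ≤ 2 * B ∧ IsSuperdifferentialAt f (τ • w τ) (q τ) := by
    filter_upwards [h1, self_mem_nhdsWithin] with τ h h' using hwq τ h' h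
  have hlim : Tendsto (fun τ ↦ τ • w τ) (𝓝[>] (0 : ℝ)) (𝓝 0) := by
    rw [tendsto_zero_iff_norm_tendsto_zero]
    have h3 : Tendsto (fun τ : ℝ ↦ |τ| * (2 * B)) (𝓝[>] 0) (𝓝 0) := by
      have : ContinuousAt (fun τ : ℝ ↦ |τ| * (2 * B)) 0 := by fun_prop
      simpa using this.tendsto.mono_left nhdsWithin_le_nhds
    refine squeeze_zero' (.of_forall fun _ ↦ norm_nonneg _) ?_ h3
    filter_upwards [hgood] with τ hτ
    rw [norm_smul, Real.norm_eq_abs]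
    exact mul_le_mul_of_nonneg_left hτ.1 (abs_nonneg _)
  let U : Ultrafilter ℝ := Ultrafilter.of (𝓝[>] (0 : ℝ))
  have hU : (U : Filter ℝ) ≤ 𝓝[>] (0 : ℝ) := Ultrafilter.of_le _
  have hbd : ∀ᶠ τ in (U : Filter ℝ), q τ ∈ Metric.closedBall 0 K := by
    refine hU ?_
    filter_upwards [hgood, hlim (Metric.ball_mem_nhds _ hs.pos)] with τ h3 h4
    exact mem_closedBall_zero_iff.2 (hs.norm_le h4 h3.2)
  obtain ⟨q₀, -, hq₀⟩ := (isCompact_closedBall (0 : V →L[ℝ] ℝ) K).ultrafilter_le_nhds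
    (U.map q) (le_principal_iff.2 hbd)
  exact ⟨q₀, hs.isApproxConcave.isSuperdifferentialAt_of_tendsto (hs.continuousAt hs.zero_mem)
    (hlim.mono_left hU) hq₀ (hU (hgood.mono fun _ h ↦ h.2))⟩

/-- The minimal energy is lower semicontinuous. -/
theorem IsLocalSystem.eventually_lt (hs : IsLocalSystem f h r K B) {c : ℝ}
    (hc : ∀ q, IsSuperdifferentialAt f 0 q → c < h 0 q) :
    ∀ᶠ u in 𝓝 (0 : V), ∀ q, IsSuperdifferentialAt f u q → c < h u q := by
  by_contra hcon
  have hfr : ∃ᶠ u in 𝓝 (0 : V), ∃ q, IsSuperdifferentialAt f u q ∧ h u q ≤ c := by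
    rw [Filter.not_eventually] at hcon
    refine hcon.mono fun u hu ↦ ?_
    push Not at hu
    exact hu
  let F : Filter V := 𝓝 (0 : V) ⊓ 𝓟 {u | ∃ q, IsSuperdifferentialAt f u q ∧ h u q ≤ c}
  have hF : F.NeBot := frequently_mem_iff_neBot.1 hfr
  choose! q hq using fun u (hu : ∃ q, IsSuperdifferentialAt f u q ∧ h u q ≤ c) ↦ hu
  let U : Ultrafilter V := Ultrafilter.of F
  have hU : (U : Filter V) ≤ F := Ultrafilter.of_le _
  have hU0 : Tendsto (fun u : V ↦ u) (U : Filter V) (𝓝 0) := hU.trans inf_le_left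
  have hUq : ∀ᶠ u in (U : Filter V), IsSuperdifferentialAt f u (q u) ∧ h u (q u) ≤ c :=
    hU.trans inf_le_right (mem_principal.2 hq)
  have hbd : ∀ᶠ u in (U : Filter V), q u ∈ Metric.closedBall 0 K := by
    filter_upwards [hUq, hU0 (Metric.ball_mem_nhds _ hs.pos)] with u h3 h4
    exact mem_closedBall_zero_iff.2 (hs.norm_le h4 h3.1)
  obtain ⟨q₀, -, hq₀⟩ := (isCompact_closedBall (0 : V →L[ℝ] ℝ) K).ultrafilter_le_nhds
    (U.map q) (le_principal_iff.2 hbd)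
  have hq₀' : Tendsto q U (𝓝 q₀) := hq₀
  have h1 := hs.isApproxConcave.isSuperdifferentialAt_of_tendsto (hs.continuousAt hs.zero_mem)
    hU0 hq₀' (hUq.mono fun _ h ↦ h.1)
  have h2 : Tendsto (fun u ↦ h u (q u)) U (𝓝 (h 0 q₀)) :=
    (hs.continuousAt_hamiltonian hs.zero_mem q₀).tendsto.comp (hU0.prodMk_nhds hq₀')
  exact absurd (le_of_tendsto h2 (hUq.mono fun _ h ↦ h.2)) (not_le.2 (hc q₀ h1))

theorem IsLocalSystem.eventually_abs_sub_lt (hs : IsLocalSystem f h r K B) (R : ℝ) {ε : ℝ}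
    (hε : 0 < ε) : ∀ᶠ u in 𝓝 (0 : V), ∀ p ∈ Metric.closedBall (0 : V →L[ℝ] ℝ) R,
      |h u p - h 0 p| < ε := by
  refine (isCompact_closedBall (0 : V →L[ℝ] ℝ) R).eventually_forall_of_forall_eventually
    fun p _ ↦ ?_
  have h1 := hs.continuousAt_hamiltonian hs.zero_mem p
  have h2 : ContinuousAt (fun z : V × (V →L[ℝ] ℝ) ↦ h 0 z.2) (0, p) :=
    ContinuousAt.comp (f := fun z : V × (V →L[ℝ] ℝ) ↦ z.2)
      (hs.isFibreHamiltonian 0 hs.zero_mem).continuous.continuousAt continuousAt_snd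
  have h3 := (h1.sub h2).abs
  exact h3.tendsto.eventually_lt_const (by simpa using hε)

/-- The energy inequality along a step with velocity `w`, which is a subgradient of the Hamiltonian
at an element of the superdifferential at the endpoint. -/
theorem IsLocalSystem.exists_step_inequality (hs : IsLocalSystem f h r K B) {g : V → ℝ}
    (hg : ContDiffAt ℝ 1 g 0) (N : ℝ) {ε : ℝ} (hε : 0 < ε) :
    ∃ ρ > 0, ∀ u ∈ Metric.ball (0 : V) ρ, ∀ y ∈ Metric.ball (0 : V) ρ,
      ∀ u' ∈ Metric.ball (0 : V) ρ, ∀ τ > 0, ∀ w, ‖w‖ ≤ N → y = u + τ • w →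
      ∀ q, IsSuperdifferentialAt f y q → (∀ p, h u' q + (p w - q w) ≤ h u' p) →
      -(τ * (h y (fderiv ℝ g y) - h y q + ε)) ≤ f y - g y - (f u - g u) := by
  set R := max K (‖fderiv ℝ g 0‖ + 1) with hR
  have hN : 0 < |N| + 1 := by positivity
  -- This makes ε₁‖y - u‖ ≤ τε/8. It is spent three times, on the concavity of f, the strict
  -- differentiability of g and the continuity of its differential; four exchanges of base points in
  -- the Hamiltonian cost τε/8 each.
  set ε₁ := ε / (8 * (|N| + 1)) with hε₁
  have hε₁0 : 0 < ε₁ := by positivity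
  obtain ⟨ρ₀, hρ₀, hconc⟩ := hs.isApproxConcave.exists_le hε₁0
  have hgc : ContinuousAt (fderiv ℝ g) 0 := (hg.fderiv_right (m := 0) (by simp)).continuousAt
  have hstrict := (hg.hasStrictFDerivAt one_ne_zero).isLittleO.def hε₁0
  rw [nhds_prod_eq] at hstrict
  obtain ⟨s, hsm, hs'⟩ := hstrict.exists_mem
  obtain ⟨t₁, ht₁, t₂, ht₂, hts⟩ := Filter.mem_prod_iff.1 hsm
  have hall := ((((hs.eventually_abs_sub_lt R (ε := ε / 8) (by positivity)).and
    (hgc.eventually (Metric.ball_mem_nhds _ (lt_min hε₁0 one_pos)))).and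
    (Filter.inter_mem ht₁ ht₂)).and (Metric.ball_mem_nhds (0 : V) hρ₀)).and
    (Metric.ball_mem_nhds (0 : V) hs.pos)
  obtain ⟨ρ, hρ, hρs⟩ := Metric.eventually_nhds_iff_ball.1 hall
  refine ⟨ρ, hρ, fun u hu y hy u' hu' τ hτ w hw hyu q hq hsub ↦ ?_⟩
  obtain ⟨⟨⟨⟨-, -⟩, -, hut⟩, huρ⟩, -⟩ := hρs u hu
  obtain ⟨⟨⟨⟨hyh, hyg⟩, hyt, -⟩, hyρ⟩, hyr⟩ := hρs y hy
  obtain ⟨⟨⟨⟨hu'h, -⟩, -⟩, -⟩, -⟩ := hρs u' hu'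
  have hqK := hs.norm_le hyr hq
  set D := fderiv ℝ g y with hD
  have hyg' : ‖D - fderiv ℝ g 0‖ < min ε₁ 1 := mem_ball_iff_norm.1 hyg
  have hqR : q ∈ Metric.closedBall (0 : V →L[ℝ] ℝ) R :=
    mem_closedBall_zero_iff.2 (hqK.trans (le_max_left _ _))
  have hDR : D ∈ Metric.closedBall (0 : V →L[ℝ] ℝ) R := by
    refine mem_closedBall_zero_iff.2 (le_trans ?_ (le_max_right _ _))
    have := norm_le_norm_add_norm_sub' D (fderiv ℝ g 0)
    have := hyg'.trans_le (min_le_right _ _)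
    linarith
  have hyu' : y - u = τ • w := by rw [hyu, add_sub_cancel_left]
  have hnorm : ‖y - u‖ ≤ τ * (|N| + 1) := by
    rw [hyu', norm_smul, Real.norm_of_nonneg hτ.le]
    exact mul_le_mul_of_nonneg_left (hw.trans ((le_abs_self N).trans (by linarith))) hτ.le
  have hsmall : ε₁ * ‖y - u‖ ≤ τ * (ε / 8) := by
    refine (mul_le_mul_of_nonneg_left hnorm hε₁0.le).trans_eq ?_
    rw [hε₁]; field_simp
  -- concavity of `f`
  have e1 := hconc y hyρ u huρ q hq
  rw [norm_sub_rev, ← neg_sub y u, map_neg, hyu', map_smul, smul_eq_mul, ← hyu'] at e1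
  -- differentiability of `g`
  have e2 := (abs_le.1 (Real.norm_eq_abs _ ▸ hs' (y, u) (hts ⟨hyt, hut⟩))).2
  simp only at e2
  have e3 : |(D - fderiv ℝ g 0) (y - u)| ≤ ε₁ * ‖y - u‖ := by
    refine (Real.norm_eq_abs _ ▸ (D - fderiv ℝ g 0).le_opNorm _).trans ?_
    exact mul_le_mul_of_nonneg_right (hyg'.trans_le (min_le_left _ _)).le (norm_nonneg _)
  have e4 := (abs_le.1 e3).1
  rw [sub_apply] at e4
  have e5 : D (y - u) = τ * D w := by rw [hyu', map_smul, smul_eq_mul]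
  -- comparison of the Hamiltonians
  have e6 := hsub D
  have a1 := abs_lt.1 (hyh q hqR)
  have a2 := abs_lt.1 (hyh D hDR)
  have a3 := abs_lt.1 (hu'h q hqR)
  have a4 := abs_lt.1 (hu'h D hDR)
  have e7 : h y q - h y D - ε / 2 ≤ q w - D w := by linarith [a1.1, a1.2, a2.1, a2.2, a3.1, a4.2]
  have e8 := mul_le_mul_of_nonneg_left e7 hτ.le
  nlinarith

end LocalSystem

/-! ### C¹ majorants of functions that are small to first order. -/

section SmoothMajorant

variable {V : Type*} [NormedAddCommGroup V] [InnerProductSpace ℝ V]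

theorem hasFDerivAt_sqrt_norm_sq_add {δ : ℝ} (hδ : 0 < δ) (v : V) :
    HasFDerivAt (fun v : V ↦ √(‖v‖ ^ 2 + δ ^ 2) - δ)
      ((√(‖v‖ ^ 2 + δ ^ 2))⁻¹ • innerSL ℝ v) v := by
  have h1 : HasFDerivAt (fun v : V ↦ ‖v‖ ^ 2 + δ ^ 2) ((2 : ℝ) • innerSL ℝ v) v := by
    have := (hasStrictFDerivAt_norm_sq v).hasFDerivAt.add_const (δ ^ 2)
    convert! this using 1
    ext w
    simp [two_smul]
  have h2 := (h1.sqrt (by positivity)).sub_const δ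
  convert! h2 using 1
  rw [smul_smul]
  congr 1
  field_simp

theorem norm_inv_sqrt_smul_innerSL_le (δ : ℝ) (v : V) :
    ‖(√(‖v‖ ^ 2 + δ ^ 2))⁻¹ • innerSL ℝ v‖ ≤ 1 := by
  rw [norm_smul, innerSL_apply_norm, norm_inv, Real.norm_of_nonneg (Real.sqrt_nonneg _)]
  refine inv_mul_le_one_of_le₀ ?_ (Real.sqrt_nonneg _)
  exact Real.le_sqrt_of_sq_le (by nlinarith [sq_nonneg δ])

/-- A function which is `o(‖v‖)` from above is bounded by a `C¹` function with the same
property. -/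
theorem exists_contDiff_majorant {f : V → ℝ}
    (hf : ∀ ε > 0, ∀ᶠ v in 𝓝 (0 : V), f v ≤ ε * ‖v‖) :
    ∃ G : V → ℝ, ContDiff ℝ 1 G ∧ G 0 = 0 ∧ HasFDerivAt G (0 : V →L[ℝ] ℝ) 0 ∧
      ∀ᶠ v in 𝓝 (0 : V), f v ≤ G v := by
  have hr : ∀ k : ℕ, ∃ r > 0, ∀ v ∈ Metric.ball (0 : V) r, f v ≤ (1 / 2) ^ k * ‖v‖ := fun k ↦
    Metric.eventually_nhds_iff_ball.1 (hf ((1 / 2) ^ k) (by positivity))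
  choose r hr hrf using hr
  -- radii tending to zero
  let δ : ℕ → ℝ := fun k ↦ min (r (k + 1)) (1 / ((k : ℝ) + 1)) / 2
  have hδ : ∀ k, 0 < δ k := fun k ↦ by
    have := hr (k + 1)
    have h2 : (0 : ℝ) < 1 / ((k : ℝ) + 1) := Nat.one_div_pos_of_nat
    exact half_pos (lt_min this h2)
  have hδr : ∀ k, δ k < r (k + 1) := fun k ↦
    (half_lt_self (by have := hδ k; simp only [δ] at this; linarith)).trans_le (min_le_left _ _)
  have hδ0 : Tendsto δ atTop (𝓝 0) := by
    refine squeeze_zero (fun k ↦ (hδ k).le) (fun k ↦ ?_) tendsto_one_div_add_atTop_nhds_zero_nat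
    exact (half_le_self (by have := hδ k; simp only [δ] at this; linarith)).trans (min_le_right _ _)
  -- Each summand is a smoothed cone √(‖v‖² + δ²) - δ, which is at least ‖v‖/4 when δ ≤ ‖v‖. The
  -- factor 4 makes the k-th one dominate 2⁻ᵏ‖v‖ there, and the slopes remain summable.
  let c : ℕ → ℝ := fun k ↦ 4 * (1 / 2) ^ k
  have hc : ∀ k, 0 ≤ c k := fun k ↦ by positivity
  have hcs : Summable c := summable_geometric_two.mul_left 4
  let F : ℕ → V → ℝ := fun k v ↦ c k * (√(‖v‖ ^ 2 + δ k ^ 2) - δ k)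
  let F' : ℕ → V → V →L[ℝ] ℝ := fun k v ↦ c k • ((√(‖v‖ ^ 2 + δ k ^ 2))⁻¹ • innerSL ℝ v)
  have hF : ∀ k v, HasFDerivAt (F k) (F' k v) v := fun k v ↦
    (hasFDerivAt_sqrt_norm_sq_add (hδ k) v).const_mul (c k)
  have hF' : ∀ k v, ‖F' k v‖ ≤ c k := fun k v ↦ by
    rw [norm_smul, Real.norm_of_nonneg (hc k)]
    exact mul_le_of_le_one_right (hc k) (norm_inv_sqrt_smul_innerSL_le _ _)
  have hF0 : ∀ k, F k 0 = 0 := fun k ↦ by simp [F, Real.sqrt_sq (hδ k).le]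
  have hFs0 : Summable fun k ↦ F k 0 := by simp [hF0]
  have hF'c : ∀ k, Continuous (F' k) := fun k ↦ by
    have h1 : Continuous fun v : V ↦ √(‖v‖ ^ 2 + δ k ^ 2) := by fun_prop
    have h2 : Continuous fun v : V ↦ (√(‖v‖ ^ 2 + δ k ^ 2))⁻¹ := h1.inv₀ fun v ↦ by
      have := hδ k
      positivity
    exact (h2.smul (innerSL ℝ).continuous).const_smul (c k)
  have hG : ∀ v, HasFDerivAt (fun v ↦ ∑' k, F k v) (∑' k, F' k v) v := fun v ↦
    hasFDerivAt_tsum hcs hF hF' hFs0 v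
  have hFnonneg : ∀ k v, 0 ≤ F k v := fun k v ↦
    mul_nonneg (hc k) (sub_nonneg.2 (Real.le_sqrt_of_sq_le (by nlinarith [sq_nonneg ‖v‖])))
  refine ⟨fun v ↦ ∑' k, F k v, ?_, by simp [hF0], ?_, ?_⟩
  · exact contDiff_one_iff_hasFDerivAt.2
      ⟨_, continuous_tsum hF'c hcs hF', hG⟩
  · convert! hG 0 using 1
    simp [F']
  · filter_upwards [Metric.ball_mem_nhds (0 : V) (hr 0)] with v hv
    have hsum : Summable fun k ↦ F k v := by
      refine Summable.of_nonneg_of_le (fun k ↦ hFnonneg k v) (fun k ↦ ?_) (hcs.mul_right ‖v‖)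
      refine mul_le_mul_of_nonneg_left ?_ (hc k)
      rw [sub_le_iff_le_add]
      refine Real.sqrt_le_iff.2 ⟨by have := hδ k; positivity, ?_⟩
      nlinarith [mul_nonneg (norm_nonneg v) (hδ k).le]
    by_cases hv0 : v = 0
    · subst hv0
      have := hrf 0 0 (by simpa using hr 0)
      simpa [hF0] using this
    have hv0' : 0 < ‖v‖ := norm_pos_iff.2 hv0
    -- the first index at which the radius is smaller than the norm
    have hex : ∃ k, δ k ≤ ‖v‖ := (hδ0.eventually_le_const hv0').exists
    classical
    obtain ⟨k, hk, hmin⟩ : ∃ k, δ k ≤ ‖v‖ ∧ ∀ m < k, ‖v‖ < δ m :=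
      ⟨Nat.find hex, Nat.find_spec hex, fun m hm ↦ not_le.1 (Nat.find_min hex hm)⟩
    have hfk : f v ≤ (1 / 2) ^ k * ‖v‖ := by
      rcases k with _ | k
      · exact hrf 0 v hv
      · refine hrf (k + 1) v (mem_ball_zero_iff.2 ?_)
        exact (hmin k (Nat.lt_succ_self k)).trans (hδr k)
    have h1 : F k v ≤ ∑' k, F k v := hsum.le_tsum k fun m _ ↦ hFnonneg m v
    have h2 : δ k + ‖v‖ / 4 ≤ √(‖v‖ ^ 2 + δ k ^ 2) := by
      refine Real.le_sqrt_of_sq_le ?_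
      nlinarith [hδ k]
    have h3 : (1 / 2) ^ k * ‖v‖ ≤ F k v := by
      have h4 : c k * (‖v‖ / 4) ≤ F k v := mul_le_mul_of_nonneg_left (by linarith) (hc k)
      refine le_trans (le_of_eq ?_) h4
      simp only [c]
      ring
    exact hfk.trans (h3.trans h1)

end SmoothMajorant

/-! ### The superdifferential on the manifold and in coordinates. -/

section ManifoldSuperdifferential

variable {E : Type*} [NormedAddCommGroup E] [NormedSpace ℝ E]
  {V : Type*} [NormedAddCommGroup V] [InnerProductSpace ℝ V]
  {M : Type*} [MetricSpace M] [ChartedSpace E M] [IsManifold 𝓘(ℝ, E) ∞ M]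
  {x₀ : M} {L : V ≃L[ℝ] E} {φ : M → ℝ}

/-- The covector with given coordinates. -/
noncomputable def covectorOf (x₀ : M) (L : V ≃L[ℝ] E) (b : M) (q : V →L[ℝ] ℝ) :
    CotangentSpace E b :=
  q.comp (coordDifferential x₀ L b)

/-- The coordinates of a covector. -/
noncomputable def covectorCoord (x₀ : M) (L : V ≃L[ℝ] E) (b : M) (p : CotangentSpace E b) :
    V →L[ℝ] ℝ :=
  p.comp (coordCodifferential x₀ L b)

theorem covectorOf_covectorCoord {b : M} (hb : b ∈ (extChartAt 𝓘(ℝ, E) x₀).source)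
    (p : CotangentSpace E b) : covectorOf x₀ L b (covectorCoord x₀ L b p) = p := by
  ext ξ
  simp [covectorOf, covectorCoord, coordCodifferential_coordDifferential hb]

theorem covectorCoord_covectorOf {b : M} (hb : b ∈ (extChartAt 𝓘(ℝ, E) x₀).source)
    (q : V →L[ℝ] ℝ) : covectorCoord x₀ L b (covectorOf x₀ L b q) = q := by
  ext v
  simp [covectorOf, covectorCoord, coordDifferential_coordCodifferential hb]

theorem mdifferentiableAt_chartParam {u : V} (hu : u ∈ chartDomain x₀ L) :
    MDifferentiableAt 𝓘(ℝ, V) 𝓘(ℝ, E) (chartParam x₀ L) u :=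
  (contMDiffOn_chartParam.contMDiffAt (isOpen_chartDomain.mem_nhds hu)).mdifferentiableAt
    (by simp)

theorem mfderiv_chartParam_apply {u : V} (hu : u ∈ chartDomain x₀ L) (v : V) :
    mfderiv 𝓘(ℝ, V) 𝓘(ℝ, E) (chartParam x₀ L) u v =
      coordCodifferential x₀ L (chartParam x₀ L u) v := by
  have hs := chartParam_mem_source hu
  have hmd := mdifferentiableAt_chartParam hu
  have hcomp := (hasMFDerivAt_chartCoord (L := L) hs).comp u hmd.hasMFDerivAt
  have hid : HasMFDerivAt 𝓘(ℝ, V) 𝓘(ℝ, V) (chartCoord x₀ L ∘ chartParam x₀ L) u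
      (ContinuousLinearMap.id ℝ V) := by
    refine (hasMFDerivAt_id u).congr_of_eventuallyEq ?_
    filter_upwards [isOpen_chartDomain.mem_nhds hu] with v hv using chartCoord_chartParam hv
  have hun := hasMFDerivAt_unique hcomp hid
  have h1 : coordDifferential x₀ L (chartParam x₀ L u)
      (mfderiv 𝓘(ℝ, V) 𝓘(ℝ, E) (chartParam x₀ L) u v) = v :=
    congrArg (fun A : V →L[ℝ] V ↦ A v) hun
  have h2 := coordCodifferential_coordDifferential (L := L) hs
    (mfderiv 𝓘(ℝ, V) 𝓘(ℝ, E) (chartParam x₀ L) u v)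
  rw [h1] at h2
  exact h2.symm

theorem HasMFDerivAt.hasFDerivAt_chartParam {f : M → ℝ} {u : V} (hu : u ∈ chartDomain x₀ L)
    {p : CotangentSpace E (chartParam x₀ L u)}
    (hf : HasMFDerivAt 𝓘(ℝ, E) 𝓘(ℝ, ℝ) f (chartParam x₀ L u) p) :
    HasFDerivAt (fun v ↦ f (chartParam x₀ L v)) (covectorCoord x₀ L (chartParam x₀ L u) p) u := by
  have hmd := mdifferentiableAt_chartParam hu
  have h3 : HasFDerivAt (f ∘ chartParam x₀ L)
    ((p.comp (mfderiv 𝓘(ℝ, V) 𝓘(ℝ, E) (chartParam x₀ L) u) : V →L[ℝ] ℝ)) u :=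
      (hf.comp u hmd.hasMFDerivAt).hasFDerivAt
  convert! h3 using 1
  ext v
  exact congrArg p (mfderiv_chartParam_apply hu v).symm

theorem isSuperdifferentialAt_covectorCoord {u : V} (hu : u ∈ chartDomain x₀ L)
    {p : CotangentSpace E (chartParam x₀ L u)} (hp : p ∈ superdifferential φ (chartParam x₀ L u)) :
    IsSuperdifferentialAt (fun v ↦ φ (chartParam x₀ L v)) u
      (covectorCoord x₀ L (chartParam x₀ L u) p) := by
  obtain ⟨r, hr, ψ, hψ, hle, heq, hder⟩ := hp
  have hcont := continuousAt_chartParam hu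
  refine HasFDerivAt.isSuperdifferentialAt (ψ := ψ ∘ chartParam x₀ L)
    (hder.hasFDerivAt_chartParam hu) ?_ heq
  filter_upwards [hcont.eventually (Metric.ball_mem_nhds _ hr)] with v hv using hle _ hv

/-- The definition on M asks for a C¹ touching function. The remainder of the Fréchet inequality is
o(‖v‖) from above, so `exists_contDiff_majorant` supplies one. -/
theorem covectorOf_mem_superdifferential {u : V} (hu : u ∈ chartDomain x₀ L) {q : V →L[ℝ] ℝ}
    (hq : IsSuperdifferentialAt (fun v ↦ φ (chartParam x₀ L v)) u q) :
    covectorOf x₀ L (chartParam x₀ L u) q ∈ superdifferential φ (chartParam x₀ L u) := by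
  have hs := chartParam_mem_source hu
  obtain ⟨G, hG, hG0, hGd, hle⟩ := exists_contDiff_majorant (V := V)
    (f := fun v ↦ φ (chartParam x₀ L (u + v)) - φ (chartParam x₀ L u) - q v) (by
      intro ε hε
      have h1 : Tendsto (fun v : V ↦ u + v) (𝓝 0) (𝓝 u) := by
        have : ContinuousAt (fun v : V ↦ u + v) 0 := by fun_prop
        simpa using this.tendsto
      filter_upwards [h1.eventually (hq ε hε)] with v hv
      rw [add_sub_cancel_left] at hv
      linarith)
  let ψ' : V → ℝ := fun v ↦ φ (chartParam x₀ L u) + q (v - u) + G (v - u)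
  have hψ' : ContDiff ℝ 1 ψ' := by
    have h1 : ContDiff ℝ 1 fun v : V ↦ v - u := by fun_prop
    exact (contDiff_const.add (q.contDiff.comp h1)).add (hG.comp h1)
  have hψ'd : HasFDerivAt ψ' q u := by
    have h1 : HasFDerivAt (fun v : V ↦ v - u) (ContinuousLinearMap.id ℝ V) u :=
      (hasFDerivAt_id u).sub_const u
    have h2 : HasFDerivAt G (0 : V →L[ℝ] ℝ) (u - u) := by rwa [sub_self]
    have h3 := ((q.hasFDerivAt.comp u h1).const_add (φ (chartParam x₀ L u))).add
      (HasFDerivAt.comp (f := fun v : V ↦ v - u) u h2 h1)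
    convert! h3 using 1
    ext; simp
  have hcont : ContinuousAt (chartCoord x₀ L) (chartParam x₀ L u) := continuousAt_chartCoord hs
  have hle' : ∀ᶠ z in 𝓝 (chartParam x₀ L u), φ z ≤ ψ' (chartCoord x₀ L z) := by
    have h1 : Tendsto (fun z ↦ chartCoord x₀ L z - u) (𝓝 (chartParam x₀ L u)) (𝓝 0) := by
      have := hcont.tendsto.sub_const u
      rwa [chartCoord_chartParam hu, sub_self] at this
    filter_upwards [h1.eventually hle, (isOpen_extChartAt_source x₀).mem_nhds hs] with z hz hz'
    rw [add_sub_cancel, chartParam_chartCoord hz'] at hz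
    simp only [ψ']
    linarith
  obtain ⟨r, hr, hball⟩ := Metric.mem_nhds_iff.1
    (inter_mem hle' ((isOpen_extChartAt_source (I := 𝓘(ℝ, E)) x₀).mem_nhds hs))
  refine ⟨r, hr, ψ' ∘ chartCoord x₀ L, ?_, fun z hz ↦ (hball hz).1, ?_, ?_⟩
  · exact hψ'.contMDiff.comp_contMDiffOn
      ((contMDiffOn_chartCoord.of_le (by simp)).mono fun z hz ↦ (hball hz).2)
  · simp [ψ', chartCoord_chartParam hu, hG0]
  · have h1 : HasFDerivAt ψ' q (chartCoord x₀ L (chartParam x₀ L u)) := by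
      rwa [chartCoord_chartParam hu]
    exact h1.hasMFDerivAt.comp _ (hasMFDerivAt_chartCoord hs)

end ManifoldSuperdifferential

/-- Compactness turns local bounds, monotone in the constant, into a global one. -/
theorem exists_forall_of_eventually_of_mono {X : Type*} [TopologicalSpace X] [CompactSpace X]
    {P : X → ℝ → Prop} (hmono : ∀ x K K', K ≤ K' → P x K → P x K')
    (h : ∀ x, ∃ K, ∀ᶠ z in 𝓝 x, P z K) : ∃ K, ∀ x, P x K := by
  have := isCompact_univ.induction_on (p := fun s : Set X ↦ ∃ K, ∀ x ∈ s, P x K)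
    ⟨0, by simp⟩ (fun s t hst ⟨K, hK⟩ ↦ ⟨K, fun x hx ↦ hK x (hst hx)⟩)
    (fun s t ⟨K, hK⟩ ⟨K', hK'⟩ ↦ ⟨max K K', fun x hx ↦ hx.elim
      (fun hx ↦ hmono x _ _ (le_max_left _ _) (hK x hx))
      (fun hx ↦ hmono x _ _ (le_max_right _ _) (hK' x hx))⟩)
    (fun x _ ↦ by
      obtain ⟨K, hK⟩ := h x
      exact ⟨_, nhdsWithin_le_nhds hK, K, fun z hz ↦ hz⟩)
  simpa using this

/-! ### The Hamiltonian in coordinates. -/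

section CoordinateHamiltonian

variable {E : Type*} [NormedAddCommGroup E] [NormedSpace ℝ E]
  {M : Type*} [MetricSpace M] [ChartedSpace E M] [IsManifold 𝓘(ℝ, E) ∞ M]

theorem trivializationAt_cotangentBundle_apply (x₀ b : M) (p : CotangentSpace E b) :
    trivializationAt (E →L[ℝ] ℝ) (CotangentSpace E : M → Type _) x₀ ⟨b, p⟩ =
      ⟨b, p.comp (chartCodifferential E x₀ b)⟩ := by
  rw [hom_trivializationAt_apply]
  refine Prod.ext rfl ?_
  refine ContinuousLinearMap.ext fun v ↦ ?_
  change ((Bundle.Trivial.trivialization M ℝ).continuousLinearMapAt ℝ b)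
    (p (chartCodifferential E x₀ b v)) = p (chartCodifferential E x₀ b v)
  rw [Bundle.Trivial.continuousLinearMapAt_trivialization]
  rfl

theorem mem_cotangentBundle_baseSet {x₀ b : M} (hb : b ∈ (extChartAt 𝓘(ℝ, E) x₀).source) :
    b ∈ (trivializationAt (E →L[ℝ] ℝ) (CotangentSpace E : M → Type _) x₀).baseSet := by
  rw [hom_trivializationAt_baseSet]
  exact ⟨mem_baseSet_of_mem_source hb, mem_univ _⟩

theorem IsLocallyLipschitzInCharts.continuous {F H N : Type*} [NormedAddCommGroup F]
    [NormedSpace ℝ F] [TopologicalSpace H] {I : ModelWithCorners ℝ F H} [TopologicalSpace N]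
    [ChartedSpace H N] {f : N → ℝ} (hf : IsLocallyLipschitzInCharts I f) : Continuous f := by
  refine continuous_iff_continuousAt.2 fun q ↦ ?_
  have h1 : ContinuousOn (fun z ↦ (f ∘ (extChartAt I q).symm) (extChartAt I q z))
      (extChartAt I q).source :=
    (hf q).continuousOn.comp (continuousOn_extChartAt q) (extChartAt I q).mapsTo
  refine (h1.continuousAt (extChartAt_source_mem_nhds q)).congr ?_
  filter_upwards [extChartAt_source_mem_nhds (I := I) q] with z hz
  simp only [Function.comp_apply, (extChartAt I q).left_inv hz]

variable {V : Type*} [NormedAddCommGroup V] [InnerProductSpace ℝ V]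
  {x₀ : M} {L : V ≃L[ℝ] E}

variable (x₀ L) in
/-- A Hamiltonian in coordinates. -/
noncomputable def coordHamiltonian (H : CotangentBundle E M → ℝ) (u : V) (q : V →L[ℝ] ℝ) : ℝ :=
  H ⟨chartParam x₀ L u, covectorOf x₀ L (chartParam x₀ L u) q⟩

theorem coordHamiltonian_covectorCoord (H : CotangentBundle E M → ℝ) {u : V}
    (hu : u ∈ chartDomain x₀ L) (p : CotangentSpace E (chartParam x₀ L u)) :
    coordHamiltonian x₀ L H u (covectorCoord x₀ L (chartParam x₀ L u) p) =
      fibreHamiltonian H (chartParam x₀ L u) p := by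
  rw [coordHamiltonian, covectorOf_covectorCoord (chartParam_mem_source hu), fibreHamiltonian]

/-- In the trivialization over the chart, the covector with coordinates (u, q) is (`chartParam x₀ L
u`, q ∘ L⁻¹), which depends continuously on (u, q). -/
theorem continuousOn_coordHamiltonian {H : CotangentBundle E M → ℝ} (hH : Continuous H) :
    ContinuousOn (fun z : V × (V →L[ℝ] ℝ) ↦ coordHamiltonian x₀ L H z.1 z.2)
      (chartDomain x₀ L ×ˢ univ) := by
  let T := trivializationAt (E →L[ℝ] ℝ) (CotangentSpace E : M → Type _) x₀
  have h1 : ContinuousOn (fun z : V × (V →L[ℝ] ℝ) ↦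
      (T.toOpenPartialHomeomorph.symm (chartParam x₀ L z.1, z.2.comp (L.symm : E →L[ℝ] V))))
      (chartDomain x₀ L ×ˢ univ) := by
    refine T.toOpenPartialHomeomorph.continuousOn_symm.comp ?_ fun z hz ↦ ?_
    · refine ContinuousOn.prodMk (fun z hz ↦ ?_) ?_
      · exact (ContinuousAt.comp (f := Prod.fst) (continuousAt_chartParam hz.1)
          continuousAt_fst).continuousWithinAt
      · exact (continuous_snd.clm_comp continuous_const).continuousOn
    · exact T.mem_target.2 (mem_cotangentBundle_baseSet (chartParam_mem_source hz.1))
  refine (hH.comp_continuousOn h1).congr fun z hz ↦ ?_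
  have hs := chartParam_mem_source hz.1
  have h2 : T ⟨chartParam x₀ L z.1, covectorOf x₀ L (chartParam x₀ L z.1) z.2⟩ =
      (chartParam x₀ L z.1, z.2.comp (L.symm : E →L[ℝ] V)) := by
    rw [trivializationAt_cotangentBundle_apply]
    refine Prod.ext rfl (ContinuousLinearMap.ext fun v ↦ ?_)
    change z.2 (L.symm (chartDifferential E x₀ _ (chartCodifferential E x₀ _ v))) = z.2 (L.symm v)
    rw [chartDifferential_chartCodifferential hs]
  simp only [Function.comp_apply]
  rw [← h2]
  exact congrArg H (T.toOpenPartialHomeomorph.left_inv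
    (T.mem_source.2 (mem_cotangentBundle_baseSet hs))).symm

theorem continuous_coordHamiltonian {H : CotangentBundle E M → ℝ} (hH : Continuous H) {u : V}
    (hu : u ∈ chartDomain x₀ L) : Continuous (coordHamiltonian x₀ L H u) :=
  (continuousOn_coordHamiltonian (x₀ := x₀) (L := L) hH).comp_continuous
    (f := fun q : V →L[ℝ] ℝ ↦ (u, q)) (by fun_prop) fun _ ↦ ⟨hu, mem_univ _⟩

variable [RiemannianBundle (fun x : M ↦ TangentSpace 𝓘(ℝ, E) x)]

theorem IsMetricControlledOn.norm_covectorOf_le {C R : ℝ} (h : IsMetricControlledOn x₀ L C R)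
    {u : V} (hu : u ∈ Metric.ball (0 : V) R) (q : V →L[ℝ] ℝ) :
    ‖covectorOf x₀ L (chartParam x₀ L u) q‖ ≤ 2 * ‖q‖ := by
  have hs := chartParam_mem_source (h.subset_domain hu)
  refine ContinuousLinearMap.opNorm_le_bound _ (by positivity) fun ξ ↦ ?_
  have h1 := h.four_le u hu (coordDifferential x₀ L (chartParam x₀ L u) ξ)
  have h2 := normalMetric_coordDifferential (L := L) hs ξ
  rw [chartCoord_chartParam (h.subset_domain hu)] at h2
  rw [h2] at h1
  have h3 : ‖coordDifferential x₀ L (chartParam x₀ L u) ξ‖ ≤ 2 * ‖ξ‖ :=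
    le_of_sq_le_sq (by nlinarith) (by positivity)
  calc _ ≤ ‖q‖ * ‖coordDifferential x₀ L (chartParam x₀ L u) ξ‖ := q.le_opNorm _
    _ ≤ ‖q‖ * (2 * ‖ξ‖) := mul_le_mul_of_nonneg_left h3 (norm_nonneg _)
    _ = _ := by ring

theorem IsMetricControlledOn.norm_covectorCoord_le {C R : ℝ} (h : IsMetricControlledOn x₀ L C R)
    {u : V} (hu : u ∈ Metric.ball (0 : V) R) (p : CotangentSpace E (chartParam x₀ L u)) :
    ‖covectorCoord x₀ L (chartParam x₀ L u) p‖ ≤ 2 * ‖p‖ := by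
  refine ContinuousLinearMap.opNorm_le_bound _ (by positivity) fun v ↦ ?_
  have h1 := h.le_four u hu v
  rw [normalMetric_apply, real_inner_self_eq_norm_sq] at h1
  have h3 : ‖coordCodifferential x₀ L (chartParam x₀ L u) v‖ ≤ 2 * ‖v‖ :=
    le_of_sq_le_sq (by nlinarith) (by positivity)
  calc _ ≤ ‖p‖ * ‖coordCodifferential x₀ L (chartParam x₀ L u) v‖ := p.le_opNorm _
    _ ≤ ‖p‖ * (2 * ‖v‖) := mul_le_mul_of_nonneg_left h3 (norm_nonneg p)
    _ = _ := by ring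

variable (x₀) in
/-- Coordinates which are orthonormal at `x₀`. -/
theorem exists_orthonormal_coordinates [FiniteDimensional ℝ E] :
    ∃ L : EuclideanSpace ℝ (Fin (Module.finrank ℝ E)) ≃L[ℝ] E,
      ∀ v w, normalMetric x₀ L 0 v w = inner ℝ v w := by
  let b := stdOrthonormalBasis ℝ (TangentSpace 𝓘(ℝ, E) x₀)
  let l : EuclideanSpace ℝ (Fin (Module.finrank ℝ E)) ≃ₗ[ℝ] E := b.repr.symm.toLinearEquiv
  refine ⟨l.toContinuousLinearEquiv, fun v w ↦ ?_⟩
  rw [normalMetric_zero_apply]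
  exact b.repr.symm.inner_map_map v w

variable [FiniteDimensional ℝ E]

theorem IsHamiltonian.isFibreHamiltonian_coordHamiltonian [FiniteDimensional ℝ V]
    {H : CotangentBundle E M → ℝ} (hH : IsHamiltonian H) {C R : ℝ}
    (h : IsMetricControlledOn x₀ L C R) {u : V} (hu : u ∈ Metric.ball (0 : V) R) :
    IsFibreHamiltonian (coordHamiltonian x₀ L H u) where
  continuous := continuous_coordHamiltonian hH.locallyLipschitz.continuous (h.subset_domain hu)
  strictConvexOn := by
    refine ⟨convex_univ, fun p _ q _ hpq a b ha hb hab ↦ ?_⟩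
    obtain ⟨-, h1⟩ := hH.strictConvex (chartParam x₀ L u)
    have hne : covectorOf x₀ L (chartParam x₀ L u) p ≠ covectorOf x₀ L (chartParam x₀ L u) q := by
      intro he
      have := congrArg (covectorCoord x₀ L (chartParam x₀ L u)) he
      rw [covectorCoord_covectorOf (chartParam_mem_source (h.subset_domain hu)),
        covectorCoord_covectorOf (chartParam_mem_source (h.subset_domain hu))] at this
      exact hpq this
    have h2 := h1 (mem_univ _) (mem_univ _) hne ha hb hab
    exact h2
  superlinear := by
    intro K
    -- The coordinate norm is at most twice the dual norm, whence slope 2|K|. Covectors in the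
    -- remaining ball are handled by compactness.
    obtain ⟨R', hR'⟩ := hH.superlinear (2 * |K|)
    obtain ⟨m, hm⟩ := ((isCompact_closedBall (0 : V →L[ℝ] ℝ) (2 * |R'|)).image
      (continuous_coordHamiltonian (x₀ := x₀) (L := L) hH.locallyLipschitz.continuous
        (h.subset_domain hu))).bddBelow
    refine ⟨2 * |K| * |R'| + |m|, fun q ↦ ?_⟩
    set p := covectorOf x₀ L (chartParam x₀ L u) q with hp
    have h1 : ‖q‖ ≤ 2 * ‖p‖ := by
      have := h.norm_covectorCoord_le hu p
      rwa [hp, covectorCoord_covectorOf (chartParam_mem_source (h.subset_domain hu))] at this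
    have h0 : K * ‖q‖ ≤ |K| * (2 * ‖p‖) :=
      (mul_le_mul_of_nonneg_right (le_abs_self K) (norm_nonneg _)).trans
        (mul_le_mul_of_nonneg_left h1 (abs_nonneg K))
    change K * ‖q‖ - _ ≤ fibreHamiltonian H (chartParam x₀ L u) p
    have hnn : 0 ≤ 2 * |K| * |R'| := by positivity
    by_cases hpR : ‖p‖ ≤ |R'|
    · have h2 := hm (mem_image_of_mem _ (mem_closedBall_zero_iff.2 (show ‖q‖ ≤ 2 * |R'| by linarith)))
      change m ≤ fibreHamiltonian H (chartParam x₀ L u) p at h2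
      have h3 : |K| * (2 * ‖p‖) ≤ 2 * |K| * |R'| := by
        have := mul_le_mul_of_nonneg_left hpR (abs_nonneg K)
        linarith
      linarith [neg_abs_le m]
    · push Not at hpR
      have hp0 : 0 < ‖p‖ := (abs_nonneg R').trans_lt hpR
      have h2 := hR' _ p ((le_abs_self R').trans_lt hpR)
      rw [le_div_iff₀ hp0] at h2
      linarith [abs_nonneg m]

end CoordinateHamiltonian

/-- The constant is expressed through the distance, so that it does not depend on the chart; only
then can compactness make it uniform. -/
theorem IsSemiconcave.exists_eventually_abs_sub_le (E : Type*) [NormedAddCommGroup E]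
    [NormedSpace ℝ E] [FiniteDimensional ℝ E] {M : Type*} [MetricSpace M] [ChartedSpace E M]
    [IsManifold 𝓘(ℝ, E) ∞ M] [CompactSpace M]
    [RiemannianBundle (fun x : M ↦ TangentSpace 𝓘(ℝ, E) x)]
    [IsContMDiffRiemannianBundle 𝓘(ℝ, E) ∞ E (fun x : M ↦ TangentSpace 𝓘(ℝ, E) x)]
    [IsRiemannianManifold 𝓘(ℝ, E) M] {φ : M → ℝ} (hφ : IsSemiconcave φ) :
    ∃ K, 0 ≤ K ∧ ∀ x : M, ∀ᶠ w in 𝓝 (x, x), |φ w.1 - φ w.2| ≤ K * dist w.1 w.2 := by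
  obtain ⟨K, hK⟩ := exists_forall_of_eventually_of_mono (P := fun (x : M) K ↦
    ∀ᶠ w in 𝓝 (x, x), |φ w.1 - φ w.2| ≤ K * dist w.1 w.2)
    (fun x K K' hKK h ↦ h.mono fun w hw ↦
      hw.trans (mul_le_mul_of_nonneg_right hKK dist_nonneg)) fun x₀ ↦ by
    obtain ⟨L, hL⟩ := exists_orthonormal_coordinates (E := E) x₀
    have hm := isNormalModel_chartParam hL
    obtain ⟨R, hR, K, hK, h⟩ := hm.exists_abs_sub_le_of_isSemiconcave
      (exists_isMinimizingGeodesic E) hφ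
    obtain ⟨R', hR', h'⟩ := hm.exists_dist_bounds (ε := 1 / 2) (by norm_num) (by norm_num)
    have hs := chartParam_image_mem_nhds (x₀ := x₀) (L := L)
      (inter_mem (Metric.ball_mem_nhds _ hR) (Metric.ball_mem_nhds _ hR'))
    refine ⟨K * 2, ?_⟩
    filter_upwards [eventually_mem_nhds_iff.2 hs] with z hz
    filter_upwards [prod_mem_nhds hz hz] with w hw
    obtain ⟨⟨u, hu, hu'⟩, ⟨v, hv, hv'⟩⟩ := hw
    rw [← hu', ← hv']
    have h1 := h u hu.1 v hv.1
    have h2 := (h' u hu.2 v hv.2).1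
    have h3 : K * ‖u - v‖ ≤ K * (2 * dist (chartParam x₀ L u) (chartParam x₀ L v)) :=
      mul_le_mul_of_nonneg_left (by linarith) hK
    linarith
  exact ⟨|K|, abs_nonneg K, fun x ↦ (hK x).mono fun w hw ↦
    hw.trans (mul_le_mul_of_nonneg_right (le_abs_self K) dist_nonneg)⟩

/-! ### Constants independent of the base point. -/

section UniformConstants

variable {E : Type*} [NormedAddCommGroup E] [NormedSpace ℝ E] [FiniteDimensional ℝ E]
  {M : Type*} [MetricSpace M] [ChartedSpace E M] [IsManifold 𝓘(ℝ, E) ∞ M] [CompactSpace M]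
  [RiemannianBundle (fun x : M ↦ TangentSpace 𝓘(ℝ, E) x)]
  [IsContMDiffRiemannianBundle 𝓘(ℝ, E) ∞ E (fun x : M ↦ TangentSpace 𝓘(ℝ, E) x)]

theorem IsHamiltonian.exists_abs_le {H : CotangentBundle E M → ℝ} (hH : IsHamiltonian H) (R : ℝ) :
    ∃ B, ∀ (x : M) (p : CotangentSpace E x), ‖p‖ ≤ R → |fibreHamiltonian H x p| ≤ B := by
  refine exists_forall_of_eventually_of_mono (P := fun (x : M) B ↦
    ∀ p : CotangentSpace E x, ‖p‖ ≤ R → |fibreHamiltonian H x p| ≤ B)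
    (fun x B B' hBB h p hp ↦ (h p hp).trans hBB) fun x₀ ↦ ?_
  obtain ⟨L, hL⟩ := exists_orthonormal_coordinates (E := E) x₀
  obtain ⟨C, hC, r, hr, h⟩ := exists_isMetricControlledOn hL
  have h0 : (0 : EuclideanSpace ℝ (Fin (Module.finrank ℝ E))) ∈ Metric.ball 0 r :=
    Metric.mem_ball_self hr
  have hcont := hH.locallyLipschitz.continuous
  obtain ⟨B, hB⟩ := ((isCompact_closedBall (0 : EuclideanSpace ℝ (Fin (Module.finrank ℝ E)) →L[ℝ] ℝ)
    (2 * R)).image (continuous_coordHamiltonian (x₀ := x₀) (L := L) hcont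
      (h.subset_domain h0)).abs).bddAbove
  have hev : ∀ᶠ u in 𝓝 (0 : EuclideanSpace ℝ (Fin (Module.finrank ℝ E))),
      ∀ q ∈ Metric.closedBall (0 : EuclideanSpace ℝ (Fin (Module.finrank ℝ E)) →L[ℝ] ℝ) (2 * R),
        |coordHamiltonian x₀ L H u q| < B + 1 := by
    refine (isCompact_closedBall _ _).eventually_forall_of_forall_eventually fun q hq ↦ ?_
    have h1 := (continuousOn_coordHamiltonian (x₀ := x₀) (L := L) hcont).continuousAt
      ((isOpen_chartDomain.prod isOpen_univ).mem_nhds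
        (show (0, q) ∈ chartDomain x₀ L ×ˢ univ from ⟨h.subset_domain h0, mem_univ _⟩))
    refine h1.abs.tendsto.eventually_lt_const ?_
    have := hB (mem_image_of_mem _ hq)
    simp only at this ⊢
    linarith
  refine ⟨B + 1, Filter.mem_of_superset (chartParam_image_mem_nhds (x₀ := x₀) (L := L)
    (inter_mem hev (Metric.ball_mem_nhds _ hr))) ?_⟩
  rintro _ ⟨u, ⟨hu, hur⟩, rfl⟩ p hp
  have h2 := h.norm_covectorCoord_le hur p
  have h3 := hu (covectorCoord x₀ L (chartParam x₀ L u) p)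
    (mem_closedBall_zero_iff.2 (by linarith))
  rw [coordHamiltonian_covectorCoord H (h.subset_domain hur)] at h3
  exact h3.le

theorem IsHamiltonian.exists_neg_le {H : CotangentBundle E M → ℝ} (hH : IsHamiltonian H) :
    ∃ B, ∀ (x : M) (p : CotangentSpace E x), -B ≤ fibreHamiltonian H x p := by
  obtain ⟨R, hR⟩ := hH.superlinear 0
  obtain ⟨B, hB⟩ := hH.exists_abs_le (max R 0)
  refine ⟨|B|, fun x p ↦ ?_⟩
  by_cases hp : ‖p‖ ≤ max R 0
  · have := (abs_le.1 (hB x p hp)).1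
    linarith [le_abs_self B]
  · push Not at hp
    have h1 := hR x p ((le_max_left _ _).trans_lt hp)
    have h3 : 0 < ‖p‖ := (le_max_right _ _).trans_lt hp
    rw [le_div_iff₀ h3, zero_mul] at h1
    linarith [abs_nonneg B]

variable [IsRiemannianManifold 𝓘(ℝ, E) M]

/-- Uniform constants for the local systems in orthonormal coordinates. -/
theorem exists_isLocalSystem {φ : M → ℝ} (hφ : IsSemiconcave φ) {H : CotangentBundle E M → ℝ}
    (hH : IsHamiltonian H) : ∃ K B : ℝ, ∀ (x₀ : M)
      (L : EuclideanSpace ℝ (Fin (Module.finrank ℝ E)) ≃L[ℝ] E),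
      (∀ v w, normalMetric x₀ L 0 v w = inner ℝ v w) → ∃ C r : ℝ, 0 ≤ C ∧
        IsMetricControlledOn x₀ L C r ∧
        IsLocalSystem (fun u ↦ φ (chartParam x₀ L u)) (coordHamiltonian x₀ L H) r K B := by
  obtain ⟨K, hK, hKφ⟩ := IsSemiconcave.exists_eventually_abs_sub_le E hφ
  -- In coordinates φ has Lipschitz constant 2K, and covectors of coordinate norm at most 2K + 1
  -- have dual norm at most twice that.
  obtain ⟨B₁, hB₁⟩ := hH.exists_abs_le (2 * (K * 2 + 1))
  obtain ⟨B₂, hB₂⟩ := hH.exists_neg_le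
  refine ⟨K * 2, max B₁ B₂, fun x₀ L hL ↦ ?_⟩
  have hm := isNormalModel_chartParam hL
  obtain ⟨C, hC, R, hR, hmc⟩ := exists_isMetricControlledOn hL
  have hcont : ContinuousAt (chartParam x₀ L) 0 :=
    continuousAt_chartParam (mem_of_mem_nhds chartDomain_mem_nhds)
  have h1 := hKφ x₀
  rw [nhds_prod_eq] at h1
  obtain ⟨s, hs, hs'⟩ := (Filter.eventually_prod_self_iff
    (r := fun a b ↦ |φ a - φ b| ≤ K * dist a b)).1 h1
  have h2 : chartParam x₀ L ⁻¹' s ∈ 𝓝 0 := by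
    refine hcont.preimage_mem_nhds ?_
    rwa [chartParam_zero]
  obtain ⟨R', hR', hR's⟩ := Metric.mem_nhds_iff.1 h2
  have hsub : Metric.ball (0 : EuclideanSpace ℝ (Fin (Module.finrank ℝ E))) (min R R') ⊆
      Metric.ball 0 R := Metric.ball_subset_ball (min_le_left _ _)
  have hsub' : Metric.ball (0 : EuclideanSpace ℝ (Fin (Module.finrank ℝ E))) (min R R') ⊆
      Metric.ball 0 R' := Metric.ball_subset_ball (min_le_right _ _)
  refine ⟨C, min R R', hC, ⟨hsub.trans hmc.subset_domain,
    fun u hu v hv ↦ hmc.abs_sub_le u (hsub hu) v (hsub hv), fun u hu ↦ hmc.le_four u (hsub hu),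
    fun u hu ↦ hmc.four_le u (hsub hu)⟩, ?_⟩
  refine ⟨lt_min hR hR', by positivity,
    hm.isApproxConcave (exists_isMinimizingGeodesic E) hφ, fun u hu v hv ↦ ?_, ?_,
    fun u hu ↦ hH.isFibreHamiltonian_coordHamiltonian hmc (hsub hu), fun u hu p hp ↦ ?_,
    fun u hu p ↦ ?_⟩
  · have h3 := hs' _ (hR's (hsub' hu)) _ (hR's (hsub' hv))
    have h4 := (hmc.dist_sq_le hC (hsub hu) (hsub hv)).1
    rw [norm_sub_rev v u] at h4
    have := mul_le_mul_of_nonneg_left h4 hK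
    linarith
  · exact (continuousOn_coordHamiltonian hH.locallyLipschitz.continuous).mono
      (prod_mono (hsub.trans hmc.subset_domain) le_rfl)
  · have h3 := hmc.norm_covectorOf_le (hsub hu) p
    exact (le_abs_self _).trans ((hB₁ _ _ (by linarith)).trans (le_max_left _ _))
  · exact (neg_le_neg (le_max_right B₁ B₂)).trans (hB₂ _ _)

end UniformConstants

/-! ### Subgradients of the Hamiltonian on a fibre. -/

section DirectionalDerivative

variable {W : Type*} [AddCommGroup W] [Module ℝ W] [TopologicalSpace W] [ContinuousAdd W]
  [ContinuousSMul ℝ W] {f : W → ℝ} {f' : W →L[ℝ] ℝ} {x : W}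

theorem HasFDerivAt.tendsto_inv_mul_sub (h : HasFDerivAt f f' x) (v : W) :
    Tendsto (fun t : ℝ ↦ t⁻¹ * (f (x + t • v) - f x)) (𝓝[>] 0) (𝓝 (f' v)) := by
  have h1 : HasFDerivWithinAt f f' univ x := hasFDerivWithinAt_univ.2 h
  refine h1.lim (c := fun t : ℝ ↦ t⁻¹) (d := fun t : ℝ ↦ t • v) (v := v) ?_ (by simp) ?_
  · have : Tendsto (fun t : ℝ ↦ t • v) (𝓝 0) (𝓝 ((0 : ℝ) • v)) := tendsto_id.smul_const v
    rw [zero_smul] at this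
    exact this.mono_left nhdsWithin_le_nhds
  · refine tendsto_const_nhds.congr' ?_
    filter_upwards [self_mem_nhdsWithin] with t ht
    rw [smul_smul, inv_mul_cancel₀ (ne_of_gt ht), one_smul]

theorem HasFDerivAt.add_le_of_convexOn (h : HasFDerivAt f f' x) (hc : ConvexOn ℝ univ f) (v : W) :
    f x + f' v ≤ f (x + v) := by
  have h1 : f' v ≤ f (x + v) - f x := by
    refine le_of_tendsto (h.tendsto_inv_mul_sub v) ?_
    filter_upwards [Ioo_mem_nhdsGT (zero_lt_one' ℝ)] with t ht
    have h2 := hc.2 (mem_univ x) (mem_univ (x + v)) (sub_nonneg.2 ht.2.le) ht.1.le (by ring)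
    have h3 : (1 - t) • x + t • (x + v) = x + t • v := by module
    rw [h3, smul_eq_mul, smul_eq_mul] at h2
    rw [inv_mul_le_iff₀ ht.1]
    linarith
  linarith

theorem HasFDerivAt.eq_of_forall_add_le (h : HasFDerivAt f f' x) {l : W →L[ℝ] ℝ}
    (hl : ∀ v, f x + l v ≤ f (x + v)) : l = f' := by
  have key : ∀ v, l v ≤ f' v := by
    intro v
    refine ge_of_tendsto (h.tendsto_inv_mul_sub v) ?_
    filter_upwards [self_mem_nhdsWithin] with t ht
    have h2 := hl (t • v)
    rw [map_smul, smul_eq_mul] at h2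
    rw [le_inv_mul_iff₀ ht]
    linarith
  ext v
  refine le_antisymm (key v) ?_
  have := key (-v)
  rw [map_neg, map_neg] at this
  linarith

end DirectionalDerivative

section FibreDerivative

variable {E : Type*} [NormedAddCommGroup E] [NormedSpace ℝ E] [FiniteDimensional ℝ E]
  {M : Type*} [MetricSpace M] [ChartedSpace E M] [IsManifold 𝓘(ℝ, E) ∞ M]
  [RiemannianBundle (fun x : M ↦ TangentSpace 𝓘(ℝ, E) x)]
  {H : CotangentBundle E M → ℝ}

theorem IsHamiltonian.add_fibreDerivative_le (hH : IsHamiltonian H) (x : M)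
    (p q : CotangentSpace E x) :
    fibreHamiltonian H x p + (q (fibreDerivative H ⟨x, p⟩) - p (fibreDerivative H ⟨x, p⟩)) ≤
      fibreHamiltonian H x q := by
  have h1 := ((hH.differentiable x p).hasFDerivAt).add_le_of_convexOn
    (hH.strictConvex x).convexOn (q - p)
  rw [add_sub_cancel] at h1
  have h2 := apply_fibreDerivative H ⟨x, p⟩ (q - p)
  rw [sub_apply] at h2
  rw [h2]
  exact h1

/-- Differentiability leaves only one subgradient. Here the differential inclusion becomes an
equation. -/
theorem IsHamiltonian.eq_fibreDerivative (hH : IsHamiltonian H) {x : M} {p : CotangentSpace E x}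
    {v : TangentSpace 𝓘(ℝ, E) x}
    (hv : ∀ q : CotangentSpace E x,
      fibreHamiltonian H x p + (q v - p v) ≤ fibreHamiltonian H x q) :
    v = fibreDerivative H ⟨x, p⟩ := by
  let l : CotangentSpace E x →L[ℝ] ℝ := ContinuousLinearMap.apply ℝ ℝ v
  have h1 : l = fderiv ℝ (fibreHamiltonian H x) p := by
    refine ((hH.differentiable x p).hasFDerivAt).eq_of_forall_add_le fun q ↦ ?_
    have := hv (p + q)
    rw [add_apply, add_sub_cancel_left] at this
    exact this
  have h2 : ∀ q : CotangentSpace E x, q v = q (fibreDerivative H ⟨x, p⟩) := fun q ↦ by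
    refine Eq.trans ?_ (apply_fibreDerivative H ⟨x, p⟩ q).symm
    exact congrArg (fun A : CotangentSpace E x →L[ℝ] ℝ ↦ A q) h1
  have key : ∀ a b : E, (∀ q : E →L[ℝ] ℝ, q a = q b) → a = b := fun a b hab ↦ by
    by_contra hne
    obtain ⟨q, hq⟩ := SeparatingDual.exists_separating_of_ne (R := ℝ) hne
    exact hq (hab q)
  exact key v (fibreDerivative H ⟨x, p⟩) h2

end FibreDerivative

/-! ### The minimal energy selection. -/

section MinimalEnergy

variable {E : Type*} [NormedAddCommGroup E] [NormedSpace ℝ E] [FiniteDimensional ℝ E]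
  {M : Type*} [MetricSpace M] [ChartedSpace E M] [IsManifold 𝓘(ℝ, E) ∞ M] [CompactSpace M]
  [RiemannianBundle (fun x : M ↦ TangentSpace 𝓘(ℝ, E) x)]
  [IsContMDiffRiemannianBundle 𝓘(ℝ, E) ∞ E (fun x : M ↦ TangentSpace 𝓘(ℝ, E) x)]
  [IsRiemannianManifold 𝓘(ℝ, E) M]
  {φ : M → ℝ} {H : CotangentBundle E M → ℝ}

/-- In coordinates centred at y the superdifferential is nonempty, closed and convex, and the
Hamiltonian is coercive and strictly convex. -/
theorem existsUnique_isMinimalEnergy (hφ : IsSemiconcave φ) (hH : IsHamiltonian H) (y : M) :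
    ∃! p : CotangentSpace E y, IsMinimalEnergy φ H y p := by
  obtain ⟨K, B, hKB⟩ := exists_isLocalSystem hφ hH
  obtain ⟨L, hL⟩ := exists_orthonormal_coordinates (E := E) y
  obtain ⟨C, r, -, -, hs⟩ := hKB y L hL
  have hG := hs.isFibreHamiltonian 0 hs.zero_mem
  have h0 : (0 : EuclideanSpace ℝ (Fin (Module.finrank ℝ E))) ∈ chartDomain y L :=
    mem_of_mem_nhds chartDomain_mem_nhds
  have h0s := chartParam_mem_source h0
  suffices h : ∃! p : CotangentSpace E (chartParam y L 0),
      IsMinimalEnergy φ H (chartParam y L 0) p by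
    rwa [chartParam_zero] at h
  obtain ⟨q, hq, hmin⟩ := hG.exists_isMinOn 0 hs.isClosed hs.nonempty
  simp only [map_zero, sub_zero] at hmin
  have hle : ∀ q', (∀ p ∈ superdifferential φ (chartParam y L 0),
      fibreHamiltonian H (chartParam y L 0) q' ≤ fibreHamiltonian H (chartParam y L 0) p) →
      ∀ p ∈ {q | IsSuperdifferentialAt (fun u ↦ φ (chartParam y L u)) 0 q},
        fibreHamiltonian H (chartParam y L 0) q' ≤ coordHamiltonian y L H 0 p :=
    fun q' h' p hp ↦ h' _ (covectorOf_mem_superdifferential h0 hp)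
  refine ⟨covectorOf y L _ q, ⟨covectorOf_mem_superdifferential h0 hq, fun p hp ↦ ?_⟩,
    fun p' hp' ↦ ?_⟩
  · have h1 := hmin _ (isSuperdifferentialAt_covectorCoord h0 hp)
    rw [coordHamiltonian_covectorCoord H h0] at h1
    exact h1
  · have h1 := isSuperdifferentialAt_covectorCoord h0 hp'.1
    have h2 : covectorCoord y L _ p' = q := by
      refine hG.eq_of_isMinOn 0 (isSuperdifferentialAt_convex _ 0) h1 hq (fun p hp ↦ ?_)
        fun p hp ↦ ?_
      · rw [map_zero, map_zero, sub_zero, sub_zero, coordHamiltonian_covectorCoord H h0]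
        exact hle p' (fun p hp ↦ hp'.2 hp) p hp
      · rw [map_zero, map_zero, sub_zero, sub_zero]
        exact hmin p hp
    rw [← h2, covectorOf_covectorCoord h0s]

theorem isMinimalEnergy_minimalEnergySelection (hφ : IsSemiconcave φ) (hH : IsHamiltonian H)
    (y : M) : IsMinimalEnergy φ H y (minimalEnergySelection φ H y) :=
  Classical.epsilon_spec (existsUnique_isMinimalEnergy hφ hH y).exists

/-- The minimum of the Hamiltonian over the superdifferential. -/
noncomputable def minimalEnergy (φ : M → ℝ) (H : CotangentBundle E M → ℝ) (x : M) : ℝ :=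
  fibreHamiltonian H x (minimalEnergySelection φ H x)

theorem minimalEnergy_le_coordHamiltonian (hφ : IsSemiconcave φ) (hH : IsHamiltonian H) {x₀ : M}
    {V : Type*} [NormedAddCommGroup V] [InnerProductSpace ℝ V] {L : V ≃L[ℝ] E} {u : V}
    (hu : u ∈ chartDomain x₀ L) {q : V →L[ℝ] ℝ}
    (hq : IsSuperdifferentialAt (fun v ↦ φ (chartParam x₀ L v)) u q) :
    minimalEnergy φ H (chartParam x₀ L u) ≤ coordHamiltonian x₀ L H u q :=
  (isMinimalEnergy_minimalEnergySelection hφ hH _).2 (covectorOf_mem_superdifferential hu hq)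

end MinimalEnergy

/-! ### Discrete steps and their energy inequality. -/

section Steps

variable {E : Type*} [NormedAddCommGroup E] [NormedSpace ℝ E] [FiniteDimensional ℝ E]
  {M : Type*} [MetricSpace M] [ChartedSpace E M]
  {φ : M → ℝ} {H : CotangentBundle E M → ℝ}

/-- The excess of the energy of the differential of `f` over the minimal energy. -/
noncomputable def energyGap (φ : M → ℝ) (H : CotangentBundle E M → ℝ) (f : M → ℝ) (z : M) : ℝ :=
  fibreHamiltonian H z (mfderiv 𝓘(ℝ, E) 𝓘(ℝ, ℝ) f z) - minimalEnergy φ H z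

/-- A step of length `τ` from `z` to `z'`, tested against finitely many functions. -/
def IsStep (φ : M → ℝ) (H : CotangentBundle E M → ℝ) (N : ℝ) (F : Finset (M → ℝ)) (ε τ : ℝ)
    (z z' : M) : Prop :=
  dist z z' ≤ N * τ ∧ ∀ f ∈ F, ContMDiff 𝓘(ℝ, E) 𝓘(ℝ, ℝ) 1 f →
    -(τ * (energyGap φ H f z' + ε)) ≤ φ z' - f z' - (φ z - f z)

variable [IsManifold 𝓘(ℝ, E) ∞ M]

theorem coordHamiltonian_fderiv {V : Type*} [NormedAddCommGroup V] [InnerProductSpace ℝ V]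
    {x₀ : M} {L : V ≃L[ℝ] E} {u : V} (hu : u ∈ chartDomain x₀ L) {f : M → ℝ}
    (hf : MDifferentiableAt 𝓘(ℝ, E) 𝓘(ℝ, ℝ) f (chartParam x₀ L u)) :
    coordHamiltonian x₀ L H u (fderiv ℝ (fun v ↦ f (chartParam x₀ L v)) u) =
      fibreHamiltonian H (chartParam x₀ L u)
        (mfderiv 𝓘(ℝ, E) 𝓘(ℝ, ℝ) f (chartParam x₀ L u)) := by
  rw [(hf.hasMFDerivAt.hasFDerivAt_chartParam hu).fderiv]
  exact coordHamiltonian_covectorCoord H hu _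

theorem contDiffAt_comp_chartParam {V : Type*} [NormedAddCommGroup V] [NormedSpace ℝ V]
    {x₀ : M} {L : V ≃L[ℝ] E} {f : M → ℝ} (hf : ContMDiff 𝓘(ℝ, E) 𝓘(ℝ, ℝ) 1 f) :
    ContDiffAt ℝ 1 (fun v ↦ f (chartParam x₀ L v)) 0 := by
  have h1 := hf.comp_contMDiffOn ((contMDiffOn_chartParam (x₀ := x₀) (L := L)).of_le (by simp))
  exact (h1.contMDiffAt chartDomain_mem_nhds).contDiffAt

variable [CompactSpace M]
  [RiemannianBundle (fun x : M ↦ TangentSpace 𝓘(ℝ, E) x)]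
  [IsContMDiffRiemannianBundle 𝓘(ℝ, E) ∞ E (fun x : M ↦ TangentSpace 𝓘(ℝ, E) x)]
  [IsRiemannianManifold 𝓘(ℝ, E) M]

/-- The energy gap is upper semicontinuous. -/
theorem eventually_energyGap_lt (hφ : IsSemiconcave φ) (hH : IsHamiltonian H) {f : M → ℝ}
    (hf : ContMDiff 𝓘(ℝ, E) 𝓘(ℝ, ℝ) 1 f) {x₀ : M} {c : ℝ} (hc : energyGap φ H f x₀ < c) :
    ∀ᶠ z in 𝓝 x₀, energyGap φ H f z < c := by
  obtain ⟨K, B, hKB⟩ := exists_isLocalSystem hφ hH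
  obtain ⟨L, hL⟩ := exists_orthonormal_coordinates (E := E) x₀
  obtain ⟨C, r, -, hm, hs⟩ := hKB x₀ L hL
  have h0 : (0 : EuclideanSpace ℝ (Fin (Module.finrank ℝ E))) ∈ chartDomain x₀ L :=
    mem_of_mem_nhds chartDomain_mem_nhds
  set d := (c - energyGap φ H f x₀) / 2 with hd
  have hd0 : 0 < d := by linarith
  -- Half of the slack goes to the minimal energy, which is lower semicontinuous, and half to H(z,
  -- Df(z)), which is continuous.
  have h1 := hs.eventually_lt (c := minimalEnergy φ H x₀ - d) fun q hq ↦ by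
    have := minimalEnergy_le_coordHamiltonian hφ hH h0 hq
    rw [chartParam_zero] at this
    linarith
  have hg := contDiffAt_comp_chartParam (x₀ := x₀) (L := L) hf
  have hgc := (hg.fderiv_right (m := 0) (by simp)).continuousAt
  have h2 : ContinuousAt (fun u ↦ coordHamiltonian x₀ L H u
      (fderiv ℝ (fun v ↦ f (chartParam x₀ L v)) u)) 0 :=
    ContinuousAt.comp (f := fun u ↦ (u, fderiv ℝ (fun v ↦ f (chartParam x₀ L v)) u))
      (hs.continuousAt_hamiltonian hs.zero_mem _) (continuousAt_id.prodMk hgc)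
  have hmd : ∀ z, MDifferentiableAt 𝓘(ℝ, E) 𝓘(ℝ, ℝ) f z := hf.mdifferentiable one_ne_zero
  have h3 := h2.tendsto.eventually_lt_const
    (u := fibreHamiltonian H x₀ (mfderiv 𝓘(ℝ, E) 𝓘(ℝ, ℝ) f x₀) + d) (by
      have key : ∀ x, x = x₀ → fibreHamiltonian H x (mfderiv 𝓘(ℝ, E) 𝓘(ℝ, ℝ) f x) <
          fibreHamiltonian H x₀ (mfderiv 𝓘(ℝ, E) 𝓘(ℝ, ℝ) f x₀) + d := by
        rintro x rfl
        linarith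
      rw [coordHamiltonian_fderiv h0 (hmd _)]
      exact key _ chartParam_zero)
  refine Filter.mem_of_superset (chartParam_image_mem_nhds (x₀ := x₀) (L := L)
    (inter_mem (inter_mem h1 h3) (Metric.ball_mem_nhds _ hs.pos))) ?_
  rintro _ ⟨u, ⟨⟨hu1, hu3⟩, hur⟩, rfl⟩
  have hud := hm.subset_domain hur
  have h4 := hu1 _ (isSuperdifferentialAt_covectorCoord hud
    (isMinimalEnergy_minimalEnergySelection hφ hH (chartParam x₀ L u)).1)
  rw [coordHamiltonian_covectorCoord H hud] at h4
  have h5 : fibreHamiltonian H (chartParam x₀ L u)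
      (mfderiv 𝓘(ℝ, E) 𝓘(ℝ, ℝ) f (chartParam x₀ L u)) <
        fibreHamiltonian H x₀ (mfderiv 𝓘(ℝ, E) 𝓘(ℝ, ℝ) f x₀) + d := by
    rw [← coordHamiltonian_fderiv hud (hmd _)]
    exact hu3
  change _ < minimalEnergy φ H (chartParam x₀ L u) at h4
  change fibreHamiltonian H _ _ - minimalEnergy φ H (chartParam x₀ L u) < c
  have h6 : energyGap φ H f x₀ = fibreHamiltonian H x₀ (mfderiv 𝓘(ℝ, E) 𝓘(ℝ, ℝ) f x₀) -
    minimalEnergy φ H x₀ := rfl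
  linarith

/-- A common radius on which the step inequality holds for finitely many test functions. -/
theorem exists_radius_isStep (hφ : IsSemiconcave φ) (hH : IsHamiltonian H) {x₀ : M}
    {V : Type*} [NormedAddCommGroup V] [InnerProductSpace ℝ V] [FiniteDimensional ℝ V]
    {L : V ≃L[ℝ] E} {C r K B : ℝ} (hC : 0 ≤ C) (hm : IsMetricControlledOn x₀ L C r)
    (hs : IsLocalSystem (fun u ↦ φ (chartParam x₀ L u)) (coordHamiltonian x₀ L H) r K B)
    (F : Finset (M → ℝ)) {ε : ℝ} (hε : 0 < ε) :
    ∃ ρ > 0, ρ ≤ r ∧ ∀ u ∈ Metric.ball (0 : V) ρ, ∀ y ∈ Metric.ball (0 : V) ρ,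
      ∀ u' ∈ Metric.ball (0 : V) ρ, ∀ τ > 0, ∀ w, ‖w‖ ≤ 2 * B → y = u + τ • w →
      ∀ q, IsSuperdifferentialAt (fun u ↦ φ (chartParam x₀ L u)) y q →
        (∀ p, coordHamiltonian x₀ L H u' q + (p w - q w) ≤ coordHamiltonian x₀ L H u' p) →
        IsStep φ H (4 * B) F ε τ (chartParam x₀ L u) (chartParam x₀ L y) := by
  have h1 : ∀ᶠ ρ in 𝓝[>] (0 : ℝ), ∀ f ∈ F, ContMDiff 𝓘(ℝ, E) 𝓘(ℝ, ℝ) 1 f →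
      ∀ u ∈ Metric.ball (0 : V) ρ, ∀ y ∈ Metric.ball (0 : V) ρ,
      ∀ u' ∈ Metric.ball (0 : V) ρ, ∀ τ > 0, ∀ w, ‖w‖ ≤ 2 * B → y = u + τ • w →
      ∀ q, IsSuperdifferentialAt (fun u ↦ φ (chartParam x₀ L u)) y q →
        (∀ p, coordHamiltonian x₀ L H u' q + (p w - q w) ≤ coordHamiltonian x₀ L H u' p) →
        -(τ * (coordHamiltonian x₀ L H y (fderiv ℝ (fun v ↦ f (chartParam x₀ L v)) y) -
          coordHamiltonian x₀ L H y q + ε)) ≤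
        φ (chartParam x₀ L y) - f (chartParam x₀ L y) -
          (φ (chartParam x₀ L u) - f (chartParam x₀ L u)) := by
    rw [Filter.eventually_all_finset]
    intro f _
    by_cases hf : ContMDiff 𝓘(ℝ, E) 𝓘(ℝ, ℝ) 1 f
    · obtain ⟨ρ₀, hρ₀, h⟩ := hs.exists_step_inequality (contDiffAt_comp_chartParam hf) (2 * B) hε
      filter_upwards [Ioo_mem_nhdsGT hρ₀] with ρ hρ _ u hu y hy u' hu'
      have hsub := Metric.ball_subset_ball (x := (0 : V)) hρ.2.le
      exact h u (hsub hu) y (hsub hy) u' (hsub hu')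
    · exact .of_forall fun ρ h ↦ absurd h hf
  obtain ⟨ρ, hρ, hρr⟩ := (h1.and (Ioo_mem_nhdsGT hs.pos)).exists
  refine ⟨ρ, hρr.1, hρr.2.le, fun u hu y hy u' hu' τ hτ w hw hyu q hq hsub ↦ ⟨?_, ?_⟩⟩
  · have hsb := Metric.ball_subset_ball (x := (0 : V)) hρr.2.le
    refine (hm.dist_sq_le hC (hsb hu) (hsb hy)).1.trans ?_
    rw [hyu, add_sub_cancel_left, norm_smul, Real.norm_of_nonneg (le_of_lt hτ)]
    nlinarith [mul_le_mul_of_nonneg_left hw (le_of_lt hτ)]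
  · intro f hfF hf
    have hyd := hm.subset_domain (Metric.ball_subset_ball hρr.2.le hy)
    refine le_trans ?_ (hρ f hfF hf u hu y hy u' hu' τ hτ w hw hyu q hq hsub)
    rw [coordHamiltonian_fderiv hyd (hf.mdifferentiable one_ne_zero _)]
    -- The energy of q at the endpoint is at least the minimal one, so the inequality is only
    -- weakened, and no longer mentions q or the chart.
    have h2 := minimalEnergy_le_coordHamiltonian hφ hH hyd hq
    refine neg_le_neg (mul_le_mul_of_nonneg_left ?_ (le_of_lt hτ))
    have h6 : energyGap φ H f (chartParam x₀ L y) = fibreHamiltonian H (chartParam x₀ L y)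
      (mfderiv 𝓘(ℝ, E) 𝓘(ℝ, ℝ) f (chartParam x₀ L y)) - minimalEnergy φ H (chartParam x₀ L y) := rfl
    linarith

/-- The subgradient inequality is tested at q + g with ‖g‖ ≤ 1 and g(w) = ‖w‖; hence the room K + 1
in the bound on the Hamiltonian. -/
theorem IsLocalSystem.norm_le_of_subgradient {V : Type*} [NormedAddCommGroup V]
    [InnerProductSpace ℝ V] {f : V → ℝ} {h : V → (V →L[ℝ] ℝ) → ℝ} {r K B : ℝ}
    (hs : IsLocalSystem f h r K B) {y : V} (hy : y ∈ Metric.ball (0 : V) r) {q : V →L[ℝ] ℝ}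
    (hq : ‖q‖ ≤ K) {w : V} (hw : ∀ p, h y q + (p w - q w) ≤ h y p) : ‖w‖ ≤ 2 * B := by
  obtain ⟨g, hg, hgw⟩ := exists_dual_vector'' ℝ w
  have h1 := hw (q + g)
  rw [add_apply, hgw, add_sub_cancel_left] at h1
  have h2 := hs.le y hy (q + g) ((norm_add_le _ _).trans (add_le_add hq hg))
  have h3 := hs.neg_le y hy q
  simp only [RCLike.ofReal_real_eq_id, id_eq] at h1
  linarith

/-- Forward and backward steps exist near every point. -/
theorem eventually_exists_isStep_nhds (hφ : IsSemiconcave φ) (hH : IsHamiltonian H) {x₀ : M}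
    {V : Type*} [NormedAddCommGroup V] [InnerProductSpace ℝ V] [FiniteDimensional ℝ V]
    {L : V ≃L[ℝ] E} {C r K B : ℝ} (hC : 0 ≤ C) (hm : IsMetricControlledOn x₀ L C r)
    (hs : IsLocalSystem (fun u ↦ φ (chartParam x₀ L u)) (coordHamiltonian x₀ L H) r K B)
    (F : Finset (M → ℝ)) {ε : ℝ} (hε : 0 < ε) :
    ∃ s ∈ 𝓝 x₀, ∀ᶠ τ in 𝓝[>] (0 : ℝ), ∀ z ∈ s,
      (∃ z', IsStep φ H (4 * B) F ε τ z z') ∧ ∃ z', IsStep φ H (4 * B) F ε τ z' z := by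
  obtain ⟨ρ, hρ, hρr, hstep⟩ := exists_radius_isStep hφ hH hC hm hs F hε
  refine ⟨_, chartParam_image_mem_nhds (x₀ := x₀) (L := L)
    (Metric.ball_mem_nhds (0 : V) (half_pos hρ)), ?_⟩
  have h1 : ∀ᶠ τ in 𝓝[>] (0 : ℝ), 2 * B * τ < ρ / 2 := by
    have : ContinuousAt (fun τ : ℝ ↦ 2 * B * τ) 0 := by fun_prop
    refine nhdsWithin_le_nhds (this.tendsto.eventually_lt_const ?_)
    simpa using hρ
  filter_upwards [h1, self_mem_nhdsWithin] with τ hτρ (hτ : 0 < τ)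
  rintro _ ⟨u, hu, rfl⟩
  rw [mem_ball_zero_iff] at hu
  have huρ : u ∈ Metric.ball (0 : V) ρ := mem_ball_zero_iff.2 (by linarith)
  have hmem : ∀ w : V, ‖w‖ ≤ 2 * B → u + τ • w ∈ Metric.ball (0 : V) ρ ∧
      u - τ • w ∈ Metric.ball (0 : V) ρ := by
    intro w hw
    have h2 : ‖τ • w‖ < ρ / 2 := by
      rw [norm_smul, Real.norm_of_nonneg hτ.le]
      nlinarith [mul_le_mul_of_nonneg_left hw hτ.le]
    exact ⟨mem_ball_zero_iff.2 ((norm_add_le _ _).trans_lt (by linarith)),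
      mem_ball_zero_iff.2 ((norm_sub_le _ _).trans_lt (by linarith))⟩
  constructor
  -- Forward step: q lives at the endpoint while the Hamiltonian is frozen at the starting point, so
  -- u' = u.
  · obtain ⟨w, q, hw, hq, hsub⟩ := hs.exists_step hτ (u := u) (by linarith)
    exact ⟨_, hstep u huρ _ (hmem w hw).1 u huρ τ hτ w hw rfl q hq hsub⟩
  -- Backward step: the endpoint u is given, so its own minimal covector and velocity can be used,
  -- with u' = u and starting point u - τw.
  · have hur := Metric.ball_subset_ball hρr huρ
    have hud := hm.subset_domain hur
    set x := chartParam x₀ L u with hx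
    set p := minimalEnergySelection φ H x with hp
    set q := covectorCoord x₀ L x p with hqdef
    have hq : IsSuperdifferentialAt (fun v ↦ φ (chartParam x₀ L v)) u q :=
      isSuperdifferentialAt_covectorCoord hud (isMinimalEnergy_minimalEnergySelection hφ hH x).1
    set w := coordDifferential x₀ L x (fibreDerivative H ⟨x, p⟩) with hw
    have hsub : ∀ p', coordHamiltonian x₀ L H u q + (p' w - q w) ≤ coordHamiltonian x₀ L H u p' := by
      intro p'
      have h2 := hH.add_fibreDerivative_le x p (covectorOf x₀ L x p')
      have h3 : q w = p (fibreDerivative H ⟨x, p⟩) := by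
        have := coordCodifferential_coordDifferential (L := L) (chartParam_mem_source hud)
          (fibreDerivative H ⟨x, p⟩)
        exact congrArg p this
      rw [hqdef, coordHamiltonian_covectorCoord H hud, ← hqdef, h3]
      exact h2
    have hwB := hs.norm_le_of_subgradient hur (hs.norm_le hur hq) hsub
    exact ⟨_, hstep _ (hmem w hwB).2 u huρ u huρ τ hτ w hwB (by simp) q hq hsub⟩

/-- The speed bound N depends neither on the test functions nor on ε, as the Lipschitz bound in the
limit requires. -/
theorem exists_eventually_isStep (hφ : IsSemiconcave φ) (hH : IsHamiltonian H) :
    ∃ N, ∀ (F : Finset (M → ℝ)) (ε : ℝ), 0 < ε → ∀ᶠ τ in 𝓝[>] (0 : ℝ), ∀ z,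
      (∃ z', IsStep φ H N F ε τ z z') ∧ ∃ z', IsStep φ H N F ε τ z' z := by
  obtain ⟨K, B, hKB⟩ := exists_isLocalSystem hφ hH
  refine ⟨4 * B, fun F ε hε ↦ ?_⟩
  have := isCompact_univ.induction_on (p := fun s : Set M ↦ ∀ᶠ τ in 𝓝[>] (0 : ℝ), ∀ z ∈ s,
      (∃ z', IsStep φ H (4 * B) F ε τ z z') ∧ ∃ z', IsStep φ H (4 * B) F ε τ z' z)
    (by simp) (fun s t hst h ↦ h.mono fun τ hτ z hz ↦ hτ z (hst hz))
    (fun s t hs ht ↦ by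
      filter_upwards [hs, ht] with τ h1 h2 z hz
      exact hz.elim (h1 z) (h2 z))
    (fun x₀ _ ↦ by
      obtain ⟨L, hL⟩ := exists_orthonormal_coordinates (E := E) x₀
      obtain ⟨C, r, hC, hm, hs⟩ := hKB x₀ L hL
      obtain ⟨s, hs', h⟩ := eventually_exists_isStep_nhds hφ hH hC hm hs F hε
      exact ⟨s, nhdsWithin_le_nhds hs', h⟩)
  simpa using this

end Steps

/-- Two-sided chains make the limit curve defined for all times, with the prescribed point at time
0. -/
theorem exists_int_chain {X : Type*} {r : X → X → Prop} (hf : ∀ x, ∃ y, r x y)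
    (hb : ∀ x, ∃ y, r y x) (x : X) : ∃ z : ℤ → X, z 0 = x ∧ ∀ j, r (z j) (z (j + 1)) := by
  choose S hS using hf
  choose P hP using hb
  let z : ℤ → X := fun j ↦ match j with
    | Int.ofNat n => S^[n] x
    | Int.negSucc n => P^[n + 1] x
  refine ⟨z, rfl, fun j ↦ ?_⟩
  match j with
  | Int.ofNat n =>
    change r (S^[n] x) (S^[n + 1] x)
    rw [Function.iterate_succ_apply']
    exact hS _
  | Int.negSucc 0 =>
    change r (P^[1] x) x
    exact hP x
  | Int.negSucc (n + 1) =>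
    change r (P^[n + 1 + 1] x) (P^[n + 1] x)
    rw [Function.iterate_succ_apply' P (n + 1)]
    exact hP _

/-! ### Passage from chains to curves. -/

section Chains

variable {E : Type*} [NormedAddCommGroup E] [NormedSpace ℝ E] [FiniteDimensional ℝ E]
  {M : Type*} [MetricSpace M] [ChartedSpace E M]
  {φ : M → ℝ} {H : CotangentBundle E M → ℝ} {N ε τ : ℝ} {F : Finset (M → ℝ)} {z : ℤ → M}

theorem dist_chain_le (hz : ∀ j, IsStep φ H N F ε τ (z j) (z (j + 1))) (i : ℤ) (n : ℕ) :
    dist (z i) (z (i + n)) ≤ N * τ * n := by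
  induction n with
  | zero => simp
  | succ n ih =>
    have h1 := dist_triangle (z i) (z (i + n)) (z (i + n + 1))
    have h2 := (hz (i + n)).1
    push_cast
    rw [← add_assoc]
    linarith

theorem le_sub_chain (hz : ∀ j, IsStep φ H N F ε τ (z j) (z (j + 1))) (hτ : 0 ≤ τ) {f : M → ℝ}
    (hfF : f ∈ F) (hf : ContMDiff 𝓘(ℝ, E) 𝓘(ℝ, ℝ) 1 f) {c : ℝ} (i : ℤ) (n : ℕ)
    (hc : ∀ k : ℕ, k ≤ n → energyGap φ H f (z (i + k)) ≤ c) :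
    -(τ * (c + ε) * n) ≤ φ (z (i + n)) - f (z (i + n)) - (φ (z i) - f (z i)) := by
  induction n with
  | zero => simp
  | succ n ih =>
    have h1 := ih fun k hk ↦ hc k (hk.trans n.le_succ)
    have h2 := (hz (i + n)).2 f hfF hf
    have h3 := hc (n + 1) le_rfl
    push_cast at h3 ⊢
    rw [← add_assoc] at h3 ⊢
    have h4 := mul_le_mul_of_nonneg_left (add_le_add_left h3 ε) hτ
    linarith

theorem exists_floor_div_eq_add (hτ : 0 < τ) {s t : ℝ} (hst : s ≤ t) :
    ∃ n : ℕ, ⌊t / τ⌋ = ⌊s / τ⌋ + n ∧ |τ * n - (t - s)| ≤ τ := by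
  obtain ⟨n, hn⟩ := Int.eq_ofNat_of_zero_le
    (sub_nonneg.2 (Int.floor_mono (div_le_div_of_nonneg_right hst hτ.le)))
  have h0 : ⌊t / τ⌋ = ⌊s / τ⌋ + n := by omega
  refine ⟨n, h0, ?_⟩
  have h1 := Int.floor_le (t / τ)
  have h2 := Int.lt_floor_add_one (t / τ)
  have h3 := Int.floor_le (s / τ)
  have h4 := Int.lt_floor_add_one (s / τ)
  have h5 : (⌊t / τ⌋ : ℝ) = ⌊s / τ⌋ + n := by exact_mod_cast h0
  have h6 : |(n : ℝ) - (t / τ - s / τ)| ≤ 1 := by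
    rw [abs_le]
    constructor <;> linarith
  have h7 : τ * n - (t - s) = τ * (n - (t / τ - s / τ)) := by field_simp
  rw [h7, abs_mul, abs_of_pos hτ]
  exact mul_le_of_le_one_right hτ.le h6

theorem dist_floor_chain_le (hz : ∀ j, IsStep φ H N F ε τ (z j) (z (j + 1))) (hN : 0 ≤ N)
    (hτ : 0 < τ) (s t : ℝ) : dist (z ⌊s / τ⌋) (z ⌊t / τ⌋) ≤ N * (|s - t| + τ) := by
  have key : ∀ s t : ℝ, s ≤ t → dist (z ⌊s / τ⌋) (z ⌊t / τ⌋) ≤ N * (|s - t| + τ) := by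
    intro s t hst
    obtain ⟨n, hn, hn'⟩ := exists_floor_div_eq_add hτ hst
    rw [hn]
    refine (dist_chain_le hz _ n).trans ?_
    rw [mul_assoc]
    refine mul_le_mul_of_nonneg_left ?_ hN
    rw [abs_sub_comm, abs_of_nonneg (sub_nonneg.2 hst)]
    linarith [(abs_le.1 hn').2]
  rcases le_total s t with h | h
  · exact key s t h
  · rw [dist_comm, abs_sub_comm]
    exact key t s h

variable [IsManifold 𝓘(ℝ, E) ∞ M] [CompactSpace M]
  [RiemannianBundle (fun x : M ↦ TangentSpace 𝓘(ℝ, E) x)]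
  [IsContMDiffRiemannianBundle 𝓘(ℝ, E) ∞ E (fun x : M ↦ TangentSpace 𝓘(ℝ, E) x)]
  [IsRiemannianManifold 𝓘(ℝ, E) M]

theorem IsSemiconcave.continuous (E : Type*) [NormedAddCommGroup E] [NormedSpace ℝ E]
    [FiniteDimensional ℝ E] {M : Type*} [MetricSpace M] [ChartedSpace E M]
    [IsManifold 𝓘(ℝ, E) ∞ M] [CompactSpace M]
    [RiemannianBundle (fun x : M ↦ TangentSpace 𝓘(ℝ, E) x)]
    [IsContMDiffRiemannianBundle 𝓘(ℝ, E) ∞ E (fun x : M ↦ TangentSpace 𝓘(ℝ, E) x)]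
    [IsRiemannianManifold 𝓘(ℝ, E) M] {φ : M → ℝ} (hφ : IsSemiconcave φ) : Continuous φ := by
  obtain ⟨K, hK, h⟩ := IsSemiconcave.exists_eventually_abs_sub_le E hφ
  refine continuous_iff_continuousAt.2 fun x ↦ ?_
  have h1 : Tendsto (fun y : M ↦ (y, x)) (𝓝 x) (𝓝 (x, x)) := by
    have : Continuous fun y : M ↦ (y, x) := by fun_prop
    exact this.tendsto x
  refine tendsto_iff_dist_tendsto_zero.2 ?_
  refine squeeze_zero' (.of_forall fun _ ↦ dist_nonneg) (h1.eventually (h x)) ?_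
  have : Continuous fun y : M ↦ K * dist y x := by fun_prop
  simpa using this.tendsto x

/-- Limits of the chains: curves along which the increments of `φ` satisfy the energy
inequality. -/
theorem exists_energy_curve (hφ : IsSemiconcave φ) (hH : IsHamiltonian H) (x : M) :
    ∃ (K : ℝ≥0) (γ : ℝ → M), LipschitzWith K γ ∧ γ 0 = x ∧
      ∀ f : M → ℝ, ContMDiff 𝓘(ℝ, E) 𝓘(ℝ, ℝ) 1 f → ∀ t₀ c : ℝ, energyGap φ H f (γ t₀) < c →
        ∀ᶠ t in 𝓝[>] t₀,
          -((t - t₀) * c) ≤ φ (γ t) - f (γ t) - (φ (γ t₀) - f (γ t₀)) := by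
  classical
  obtain ⟨N, hN⟩ := exists_eventually_isStep hφ hH
  have hε : ∀ i : Finset (M → ℝ) × ℕ, (0 : ℝ) < 1 / ((i.2 : ℝ) + 1) := fun i ↦
    Nat.one_div_pos_of_nat
  have hτ : ∀ i : Finset (M → ℝ) × ℕ, ∃ τ : ℝ, (∀ z,
      (∃ z', IsStep φ H N i.1 (1 / ((i.2 : ℝ) + 1)) τ z z') ∧
        ∃ z', IsStep φ H N i.1 (1 / ((i.2 : ℝ) + 1)) τ z' z) ∧
      τ ∈ Ioo (0 : ℝ) (1 / ((i.2 : ℝ) + 1)) := fun i ↦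
    ((hN i.1 _ (hε i)).and (Ioo_mem_nhdsGT (hε i))).exists
  choose τ hstep hτ using hτ
  choose z hz0 hz using fun i ↦ exists_int_chain (fun z ↦ (hstep i z).1) (fun z ↦ (hstep i z).2) x
  have hN0 : 0 ≤ N := by
    have h1 := dist_nonneg.trans (hz (∅, 0) 0).1
    exact nonneg_of_mul_nonneg_left h1 (hτ _).1
  -- Indexing by finite families of test functions and accuracies lets every f be tested eventually,
  -- although there are uncountably many of them, and a single limit curve serves them all.
  let U : Ultrafilter (Finset (M → ℝ) × ℕ) := Ultrafilter.of atTop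
  have hU : (U : Filter (Finset (M → ℝ) × ℕ)) ≤ atTop := Ultrafilter.of_le _
  have hεU : Tendsto (fun i : Finset (M → ℝ) × ℕ ↦ 1 / ((i.2 : ℝ) + 1)) U (𝓝 0) := by
    have h1 : Tendsto (fun i : Finset (M → ℝ) × ℕ ↦ i.2) atTop atTop := by
      rw [← prod_atTop_atTop_eq]
      exact tendsto_snd
    exact (tendsto_one_div_add_atTop_nhds_zero_nat.comp h1).mono_left hU
  have hτU : Tendsto τ U (𝓝 0) := squeeze_zero (fun i ↦ (hτ i).1.le) (fun i ↦ (hτ i).2.le) hεU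
  have hFU : ∀ f, ∀ᶠ i in (U : Filter (Finset (M → ℝ) × ℕ)), f ∈ i.1 := fun f ↦ by
    refine hU ?_
    filter_upwards [eventually_ge_atTop (({f}, 0) : Finset (M → ℝ) × ℕ)] with i hi
    exact hi.1 (Finset.mem_singleton_self f)
  have hlim : ∀ t : ℝ, ∃ y : M, Tendsto (fun i ↦ z i ⌊t / τ i⌋) U (𝓝 y) := by
    intro t
    obtain ⟨y, -, hy⟩ := isCompact_univ.ultrafilter_le_nhds
      (U.map fun i ↦ z i ⌊t / τ i⌋) (by simp)
    exact ⟨y, hy⟩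
  choose γ hγ using hlim
  refine ⟨N.toNNReal, γ, LipschitzWith.of_dist_le_mul fun s t ↦ ?_,
    tendsto_nhds_unique (hγ 0) (by simp [hz0]), fun f hf t₀ c hc ↦ ?_⟩
  · rw [Real.coe_toNNReal _ hN0, Real.dist_eq]
    have h1 : Tendsto (fun i ↦ N * (|s - t| + τ i)) U (𝓝 (N * (|s - t| + 0))) :=
      (tendsto_const_nhds.add hτU).const_mul N
    rw [add_zero] at h1
    exact le_of_tendsto_of_tendsto' ((hγ s).dist (hγ t)) h1 fun i ↦
      dist_floor_chain_le (hz i) hN0 (hτ i).1 s t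
  -- On a ball of radius ρ the gap stays below c. The chain remains in it up to time t: it starts
  -- within ρ/4 of γ(t₀) and moves by less than ρ/2 + ρ/4, where the last term pays for rounding
  -- times to multiples of τ.
  · obtain ⟨ρ, hρ, hρc⟩ := Metric.eventually_nhds_iff_ball.1 (eventually_energyGap_lt hφ hH hf hc)
    have hδ : ∀ᶠ t in 𝓝[>] t₀, N * (t - t₀) < ρ / 2 := by
      have : ContinuousAt (fun t : ℝ ↦ N * (t - t₀)) t₀ := by fun_prop
      refine nhdsWithin_le_nhds (this.tendsto.eventually_lt_const ?_)
      simpa using hρ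
    filter_upwards [hδ, self_mem_nhdsWithin] with t htδ (ht : t₀ < t)
    have hcont : Continuous fun y ↦ φ y - f y :=
      (IsSemiconcave.continuous E hφ).sub hf.continuous
    have hleft : Tendsto (fun i ↦ φ (z i ⌊t / τ i⌋) - f (z i ⌊t / τ i⌋) -
        (φ (z i ⌊t₀ / τ i⌋) - f (z i ⌊t₀ / τ i⌋))) U
        (𝓝 (φ (γ t) - f (γ t) - (φ (γ t₀) - f (γ t₀)))) :=
      ((hcont.tendsto _).comp (hγ t)).sub ((hcont.tendsto _).comp (hγ t₀))
    choose n hn hn' using fun i ↦ exists_floor_div_eq_add (hτ i).1 ht.le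
    have hτn : Tendsto (fun i ↦ τ i * n i) U (𝓝 (t - t₀)) := by
      refine tendsto_iff_dist_tendsto_zero.2 ?_
      exact squeeze_zero (fun _ ↦ dist_nonneg) (fun i ↦ hn' i) hτU
    have hright : Tendsto (fun i : Finset (M → ℝ) × ℕ ↦
        -(τ i * (c + 1 / ((i.2 : ℝ) + 1)) * n i)) U (𝓝 (-((t - t₀) * c))) := by
      have h1 := (hτn.mul (hεU.const_add c)).neg
      rw [add_zero] at h1
      refine h1.congr fun i ↦ ?_
      ring
    refine le_of_tendsto_of_tendsto hright hleft ?_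
    have hsmall : Tendsto (fun i ↦ N * τ i) U (𝓝 0) := by
      simpa using hτU.const_mul N
    filter_upwards [hFU f, hsmall.eventually_lt_const (show 0 < ρ / 4 by positivity),
      (hγ t₀) (Metric.ball_mem_nhds _ (show 0 < ρ / 4 by positivity))] with i hi hi2 hi3
    rw [hn i]
    refine le_sub_chain (hz i) (hτ i).1.le hi hf _ (n i) fun k hk ↦ (hρc _ ?_).le
    have h2 := dist_chain_le (hz i) ⌊t₀ / τ i⌋ k
    have h3 : N * τ i * k ≤ N * (t - t₀ + τ i) := by
      have h4 : τ i * k ≤ τ i * n i :=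
        mul_le_mul_of_nonneg_left (by exact_mod_cast hk) (hτ i).1.le
      rw [mul_assoc]
      refine mul_le_mul_of_nonneg_left ?_ hN0
      linarith [(abs_le.1 (hn' i)).2]
    have h5 : dist (z i ⌊t₀ / τ i⌋) (γ t₀) < ρ / 4 := hi3
    rw [Metric.mem_ball]
    have h6 := dist_triangle_left (z i (⌊t₀ / τ i⌋ + k)) (γ t₀) (z i ⌊t₀ / τ i⌋)
    linarith

end Chains

/-! ### From the energy inequality to the equation. -/

section Characteristic

theorem deriv_le_of_eventually_nhdsGT {f g : ℝ → ℝ} {f' g' c t : ℝ} (hf : HasDerivAt f f' t)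
    (hg : HasDerivAt g g' t)
    (h : ∀ᶠ s in 𝓝[>] t, f s - f t - (s - t) * c ≤ g s - g t) : f' - c ≤ g' := by
  have hf1 := (hasDerivAt_iff_tendsto_slope.1 hf).mono_left (nhdsGT_le_nhdsNE t)
  have hg1 := (hasDerivAt_iff_tendsto_slope.1 hg).mono_left (nhdsGT_le_nhdsNE t)
  refine le_of_tendsto_of_tendsto (hf1.sub_const c) hg1 ?_
  filter_upwards [h, self_mem_nhdsWithin] with s hs hst
  have hst' : 0 < s - t := sub_pos.2 hst
  rw [slope_def_field, slope_def_field, sub_le_iff_le_add, div_add' _ _ _ hst'.ne',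
    div_le_div_iff_of_pos_right hst']
  linarith

variable {E : Type*} [NormedAddCommGroup E] [NormedSpace ℝ E]
  {M : Type*} [MetricSpace M] [ChartedSpace E M]

theorem HasMFDerivAt.hasDerivAt_comp_curve {f : M → ℝ} {γ : ℝ → M} {t : ℝ}
    {p : CotangentSpace E (γ t)} (hf : HasMFDerivAt 𝓘(ℝ, E) 𝓘(ℝ, ℝ) f (γ t) p)
    (hγ : MDifferentiableAt 𝓘(ℝ, ℝ) 𝓘(ℝ, E) γ t) :
    HasDerivAt (fun s ↦ f (γ s)) (p (mfderiv 𝓘(ℝ, ℝ) 𝓘(ℝ, E) γ t 1)) t := by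
  let A : ℝ →L[ℝ] ℝ := p.comp (mfderiv 𝓘(ℝ, ℝ) 𝓘(ℝ, E) γ t)
  have h' : HasFDerivAt (fun s ↦ f (γ s)) A t := (hf.comp t hγ.hasMFDerivAt).hasFDerivAt
  exact h'.hasDerivAt

variable [FiniteDimensional ℝ E] [IsManifold 𝓘(ℝ, E) ∞ M]

/-- Every covector is the differential of a globally defined smooth function. -/
theorem exists_contMDiff_hasMFDerivAt (x₀ : M) (p : CotangentSpace E x₀) :
    ∃ f : M → ℝ, ContMDiff 𝓘(ℝ, E) 𝓘(ℝ, ℝ) ∞ f ∧ HasMFDerivAt 𝓘(ℝ, E) 𝓘(ℝ, ℝ) f x₀ p := by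
  let ρ : SmoothBumpFunction 𝓘(ℝ, E) x₀ := Classical.arbitrary _
  let q : E →L[ℝ] ℝ := p.comp (chartCodifferential E x₀ x₀)
  have hx₀ := mem_extChartAt_source (I := 𝓘(ℝ, E)) x₀
  refine ⟨fun z ↦ ρ z • q (extChartAt 𝓘(ℝ, E) x₀ z), ρ.contMDiff_smul ?_, ?_⟩
  · exact q.contDiff.contMDiff.comp_contMDiffOn contMDiffOn_extChartAt
  · have h1 : HasMFDerivAt 𝓘(ℝ, E) 𝓘(ℝ, ℝ) (q ∘ extChartAt 𝓘(ℝ, E) x₀) x₀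
        (q.comp (chartDifferential E x₀ x₀)) :=
      (q.hasFDerivAt (x := extChartAt 𝓘(ℝ, E) x₀ x₀)).hasMFDerivAt.comp x₀
        (hasMFDerivAt_extChartAt_chartDifferential hx₀)
    have h2 : q.comp (chartDifferential E x₀ x₀) = p := by
      ext ξ
      simp [q, chartCodifferential_chartDifferential hx₀]
    rw [h2] at h1
    refine h1.congr_of_eventuallyEq ?_
    filter_upwards [ρ.eventuallyEq_one] with z hz
    simp [hz]

variable [CompactSpace M]
  [RiemannianBundle (fun x : M ↦ TangentSpace 𝓘(ℝ, E) x)]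
  [IsContMDiffRiemannianBundle 𝓘(ℝ, E) ∞ E (fun x : M ↦ TangentSpace 𝓘(ℝ, E) x)]
  [IsRiemannianManifold 𝓘(ℝ, E) M]

/-- Rademacher's theorem in coordinates, on the open set of times spent in each of finitely many
charts. -/
theorem LipschitzWith.ae_mdifferentiableAt {K : ℝ≥0} {γ : ℝ → M} (hγ : LipschitzWith K γ) :
    ∀ᵐ t, MDifferentiableAt 𝓘(ℝ, ℝ) 𝓘(ℝ, E) γ t := by
  have key : ∀ x₀ : M, ∃ U ∈ 𝓝 x₀,
      ∀ᵐ t, γ t ∈ U → MDifferentiableAt 𝓘(ℝ, ℝ) 𝓘(ℝ, E) γ t := by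
    intro x₀
    obtain ⟨L, hL⟩ := exists_orthonormal_coordinates (E := E) x₀
    obtain ⟨R, hR, hd⟩ := (isNormalModel_chartParam hL).exists_dist_bounds
      (ε := 1 / 2) (by norm_num) (by norm_num)
    have hW : chartParam x₀ L '' (Metric.ball 0 R ∩ chartDomain x₀ L) ∩
        (extChartAt 𝓘(ℝ, E) x₀).source ∈ 𝓝 x₀ := inter_mem (chartParam_image_mem_nhds
      (inter_mem (Metric.ball_mem_nhds _ hR) chartDomain_mem_nhds))
      (extChartAt_source_mem_nhds (I := 𝓘(ℝ, E)) x₀)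
    refine ⟨_, interior_mem_nhds.2 hW, ?_⟩
    set U := interior (chartParam x₀ L '' (Metric.ball 0 R ∩ chartDomain x₀ L) ∩
      (extChartAt 𝓘(ℝ, E) x₀).source) with hU
    have hlip : LipschitzOnWith (2 * K) (fun t ↦ chartCoord x₀ L (γ t)) (γ ⁻¹' U) := by
      refine LipschitzOnWith.of_dist_le_mul fun s hs t ht ↦ ?_
      obtain ⟨⟨u, hu, hus⟩, -⟩ := interior_subset hs
      obtain ⟨⟨v, hv, hvt⟩, -⟩ := interior_subset ht
      have h1 := (hd u hu.1 v hv.1).1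
      have h2 := hγ.dist_le_mul s t
      rw [hus, hvt] at h1
      rw [← hus, ← hvt, chartCoord_chartParam hu.2, chartCoord_chartParam hv.2, dist_eq_norm]
      push_cast
      linarith
    filter_upwards [hlip.ae_differentiableWithinAt_of_mem (μ := volume)] with t ht hmem
    have hn : γ ⁻¹' U ∈ 𝓝 t :=
      (isOpen_interior.preimage hγ.continuous).mem_nhds hmem
    have hdiff := (ht hmem).differentiableAt hn
    have hsrc := (interior_subset hmem).2
    have h1 := (mdifferentiableAt_chartParam (x₀ := x₀) (L := L)
      (chartCoord_mem_chartDomain hsrc)).comp t hdiff.mdifferentiableAt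
    refine h1.congr_of_eventuallyEq ?_
    filter_upwards [hn] with s hs
    exact (chartParam_chartCoord (interior_subset hs).2).symm
  choose U hU hae using key
  obtain ⟨S, -, hS⟩ := isCompact_univ.elim_nhds_subcover U fun x _ ↦ hU x
  have h1 : ∀ᵐ t, ∀ x ∈ S, γ t ∈ U x → MDifferentiableAt 𝓘(ℝ, ℝ) 𝓘(ℝ, E) γ t :=
    (Finset.eventually_all S).2 fun x _ ↦ hae x
  filter_upwards [h1] with t ht
  obtain ⟨x, hx, hxt⟩ := mem_iUnion₂.1 (hS (mem_univ (γ t)))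
  exact ht x hx hxt

variable {φ : M → ℝ} {H : CotangentBundle E M → ℝ}

/-- A curve along which `φ` grows at least as fast as the energy gap allows is, where it is
differentiable, an integral curve of the velocity field of minimal energy. -/
theorem hasMFDerivAt_of_energyGap (hφ : IsSemiconcave φ) (hH : IsHamiltonian H) {γ : ℝ → M}
    {t₀ : ℝ}
    (h : ∀ f : M → ℝ, ContMDiff 𝓘(ℝ, E) 𝓘(ℝ, ℝ) 1 f → ∀ c, energyGap φ H f (γ t₀) < c →
      ∀ᶠ t in 𝓝[>] t₀, -((t - t₀) * c) ≤ φ (γ t) - f (γ t) - (φ (γ t₀) - f (γ t₀)))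
    (hγ : MDifferentiableAt 𝓘(ℝ, ℝ) 𝓘(ℝ, E) γ t₀) :
    HasMFDerivAt 𝓘(ℝ, ℝ) 𝓘(ℝ, E) γ t₀ ((1 : ℝ →L[ℝ] ℝ).smulRight
      (fibreDerivative H ⟨γ t₀, minimalEnergySelection φ H (γ t₀)⟩)) := by
  have hmin := isMinimalEnergy_minimalEnergySelection hφ hH (γ t₀)
  -- As ψ touches φ from above at γ(t₀), the increments of φ ∘ γ from t₀ are at most those of ψ ∘ γ,
  -- whose derivative is p^#(v); φ itself need not be differentiable.
  obtain ⟨r, hr, ψ, -, hle, heq, hψ⟩ := hmin.1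
  have hψγ := hψ.hasDerivAt_comp_curve hγ
  have hball : ∀ᶠ t in 𝓝[>] t₀, γ t ∈ Metric.ball (γ t₀) r :=
    nhdsWithin_le_nhds (hγ.continuousAt (Metric.ball_mem_nhds _ hr))
  have hv : mfderiv 𝓘(ℝ, ℝ) 𝓘(ℝ, E) γ t₀ (1 : ℝ) =
      fibreDerivative H ⟨γ t₀, minimalEnergySelection φ H (γ t₀)⟩ := by
    refine hH.eq_fibreDerivative fun q ↦ ?_
    obtain ⟨f, hf, hfq⟩ := exists_contMDiff_hasMFDerivAt (γ t₀) q
    have hgap : energyGap φ H f (γ t₀) = fibreHamiltonian H (γ t₀) q -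
        fibreHamiltonian H (γ t₀) (minimalEnergySelection φ H (γ t₀)) := by
      rw [energyGap, hfq.mfderiv, minimalEnergy]
    refine le_of_forall_pos_le_add fun ε hε ↦ ?_
    have h1 := h f (hf.of_le (by simp)) (energyGap φ H f (γ t₀) + ε) (by linarith)
    -- Right-hand slopes suffice, as f ∘ γ and ψ ∘ γ are differentiable at t₀. The outcome is q(v) -
    -- (H(q) - H(p^#) + ε) ≤ p^#(v).
    have h2 := deriv_le_of_eventually_nhdsGT (c := energyGap φ H f (γ t₀) + ε)
      (hfq.hasDerivAt_comp_curve hγ) hψγ (by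
        filter_upwards [h1, hball] with t ht htr
        have := hle _ htr
        linarith)
    rw [hgap] at h2
    have key : ∀ a b c d : ℝ, b - (d - a + ε) ≤ c → a + (b - c) ≤ d + ε := by
      intros; linarith
    exact key _ _ _ _ h2
  have h1 := hγ.hasMFDerivAt
  rw [← hv]
  have key : ∀ A : ℝ →L[ℝ] E, A = (1 : ℝ →L[ℝ] ℝ).smulRight (A 1) := fun A ↦ by ext; simp
  exact h1.congr_mfderiv (key (mfderiv 𝓘(ℝ, ℝ) 𝓘(ℝ, E) γ t₀))

theorem isStrictSingularCharacteristic_of_energyGap (hφ : IsSemiconcave φ)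
    (hH : IsHamiltonian H) {K : ℝ≥0} {γ : ℝ → M} (hK : LipschitzWith K γ)
    (h : ∀ f : M → ℝ, ContMDiff 𝓘(ℝ, E) 𝓘(ℝ, ℝ) 1 f → ∀ t₀ c, energyGap φ H f (γ t₀) < c →
      ∀ᶠ t in 𝓝[>] t₀, -((t - t₀) * c) ≤ φ (γ t) - f (γ t) - (φ (γ t₀) - f (γ t₀))) :
    IsStrictSingularCharacteristic φ H γ where
  absolutelyContinuous _ _ := hK.lipschitzOnWith.absolutelyContinuousOnInterval
  equation := by
    filter_upwards [hK.ae_mdifferentiableAt (E := E)] with t ht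
    exact hasMFDerivAt_of_energyGap hφ hH (fun f hf c hc ↦ h f hf t c hc) ht

end Characteristic

theorem mainTheorem1
    {E : Type*} [NormedAddCommGroup E] [NormedSpace ℝ E] [FiniteDimensional ℝ E]
    {M : Type*} [MetricSpace M] [ChartedSpace E M] [IsManifold 𝓘(ℝ, E) ∞ M]
    [CompactSpace M] [ConnectedSpace M]
    [RiemannianBundle (fun x : M ↦ TangentSpace 𝓘(ℝ, E) x)]
    [IsContMDiffRiemannianBundle 𝓘(ℝ, E) ∞ E (fun x : M ↦ TangentSpace 𝓘(ℝ, E) x)]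
    [IsRiemannianManifold 𝓘(ℝ, E) M]
    (φ : M → ℝ) (hφ : IsSemiconcave φ)
    (H : CotangentBundle E M → ℝ) (hH : IsHamiltonian H) :
    (∀ y : M, ∃! p : CotangentSpace E y, IsMinimalEnergy φ H y p) ∧
    ∀ x : M, ∃ γ : ℝ → M,
      (∃ K : ℝ≥0, LipschitzWith K γ) ∧ IsStrictSingularCharacteristic φ H γ ∧ γ 0 = x :=
  ⟨fun y ↦ existsUnique_isMinimalEnergy hφ hH y, fun x ↦ by
    obtain ⟨K, γ, hK, h0, h⟩ := exists_energy_curve hφ hH x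
    exact ⟨γ, ⟨K, hK⟩, isStrictSingularCharacteristic_of_energyGap hφ hH hK h, h0⟩⟩
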